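/- **Notation.** $\hat f(\omega)=\int_{\mathbb R^2} f(x)e^{2\pi i\omega\cdot x}dx$, extended to $L^2(\mathbb R^2)$ and to tempered distributions; $\langle f,g\rangle=\int f\bar g$; $T_t$ is translation by $t$; $\mathcal B_r=\{|x|\le r\}$. **Assumptions.** Let $M\ge 1$ be an integer and $L_1,L_2\in\mathbb R$ with $2M-\tfrac12>L_2>M$. Let $0\neq\psi\in L^2(\mathbb R^2)$ have $M$ vanishing moments in $x_1$-direction, $\int|\hat\psi(\omega)|^2|\omega_1|^{-2M}d\omega<\infty$, so that $\psi=(\partial/\partial x_1)^M\theta$ with $\theta\in L^2(\mathbb R^2)$. Assume that $|\hat\psi(\xi)|\le K|\xi_1|^{-L_1}$ for all large $|\xi_1|$, that $|\hat\theta(\xi)|\le K|\xi_2|^{-L_2}$ for almost all $\xi$, and that $$C_\psi:=\int_{\omega_1>0}\frac{|\hat\psi(\omega)|^2}{|\omega_1|^2}d\omega=\int_{\omega_1<0}\frac{|\hat\psi(\omega)|^2}{|\omega_1|^2}d\omega$$ (the equality is automatic if $\psi$ is real-valued). Put $N=2\min(L_2-M,L_1)$. Let $\Phi\in C_c^\infty(\mathbb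 R^2)$ with $\Phi(0)=1$ and $0\le\hat\Phi\le1$. **Construction.** For $a>0$, $s\in\mathbb R$, $t\in\mathbb R^2$ let $$\psi_{ast}(x)=a^{-3/4}\psi\Big(\frac{x_1-t_1-s(x_2-t_2)}a,\frac{x_2-t_2}{a^{1/2}}\Big),\qquad \psi^\nu_{ast}(x)=a^{-3/4}\psi\Big(\frac{x_2-t_2-s(x_1-t_1)}a,\frac{x_1-t_1}{a^{1/2}}\Big),$$ $$\Delta_\psi(\xi)=\int_{-2}^2\int_0^1|\hat\psi(a\xi_1,a^{1/2}(\xi_2-s\xi_1))|^2a^{-3/2}da\,ds,\qquad \Delta_{\psi^\nu}(\xi_1,\xi_2)=\Delta_\psi(\xi_2,\xi_1).$$ Let $\hat p_0=\hat\Phi*\chi_{\{|\xi_2|\le|\xi_1|\}}$, $\hat p_1=1-\hat p_0$ and $\hat q_i=\hat p_i^{1/2}$. Then $\Delta_\psi\le C_\psi$ and $\Delta_{\psi^\nu}\le C_\psi$ almost everywhere, so that there are tempered distributions $\varphi_0,\varphi_1$ whose Fourier transforms are measurable functions with $|\hat\varphi_0|^2=C_\psi-\Delta_\psi$, $|\hat\varphi_1|^2=C_\psi-\Delta_{\psi^\nu}$.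 Take any such $\varphi_0,\varphi_1$ and let $\hat\varphi=(\hat p_0|\hat\varphi_0|^2+\hat p_1|\hat\varphi_1|^2)^{1/2}$. (The distributions $p_i,q_i,\varphi_i,\varphi$ have bounded Fourier transforms; the convolutions $g\mapsto p_i*g,\ q_i*g$ and the coefficient maps $f\mapsto(t\mapsto\langle f,T_t\varphi\rangle)$, given on Schwartz functions by the usual formulas, extend by continuity to bounded operators on $L^2$, and are understood in this way.) **Theorem.** 1. (Tight frame) For all $f\in L^2(\mathbb R^2)$, with all integrals finite, $$\|f\|_2^2=\frac1{C_\psi}\Big(\int_{\mathbb R^2}\int_{-2}^2\int_0^1|\langle f,q_0*\psi_{ast}\rangle|^2\frac{da\,ds\,dt}{a^3}+\int_{\mathbb R^2}\int_{-2}^2\int_0^1|\langle f,q_1*\psi^\nu_{ast}\rangle|^2\frac{da\,ds\,dt}{a^3}+\int_{\mathbb R^2}|\langle f,T_t\varphi\rangle|^2dt\Big).$$ 2. (Reconstruction) For all $f\in L^2(\mathbb R^2)$, $f=f^{\mathrm{high}}+f^{\mathrm{low}}$, where $f^{\mathrm{high}},f^{\mathrm{low}}\in L^2(\mathbb R^2)$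 are given, in the weak sense, by $$f^{\mathrm{high}}=\frac1{C_\psi}\Big(\int_{\mathbb R^2}\int_{-2}^2\int_0^1\langle f,\psi_{ast}\rangle\,p_0*\psi_{ast}\frac{da\,ds\,dt}{a^3}+\int_{\mathbb R^2}\int_{-2}^2\int_0^1\langle f,\psi^\nu_{ast}\rangle\,p_1*\psi^\nu_{ast}\frac{da\,ds\,dt}{a^3}\Big),$$ $$f^{\mathrm{low}}=\frac1{C_\psi}\Big(\int_{\mathbb R^2}\langle f,T_t\varphi_0\rangle\,p_0*T_t\varphi_0\,dt+\int_{\mathbb R^2}\langle f,T_t\varphi_1\rangle\,p_1*T_t\varphi_1\,dt\Big).$$ 3. (Fourier decay) There are constants $K,R$ such that for almost all $\xi$ with $|\xi|\ge R$ one has $|(f^{\mathrm{low}})^\wedge(\xi)|\le K|\xi|^{-N}|\hat f(\xi)|$ for every $f\in L^2(\mathbb R^2)$; consequently $|(f^{\mathrm{low}})^\wedge(\xi)|\le K\|f\|_1|\xi|^{-N}$ for every $f\in L^1\cap L^2$. 4. (Locality) If $\psi$ is supported in $\mathcal B_A$ and $\Phi$ in $\mathcal B_B$, then $f^{\mathrm{low}}(t)$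 only depends on $f$ restricted to $t+\mathcal B_{2(1+\sqrt2)A+B}$: for every open $U\subseteq\mathbb R^2$, if $f_1=f_2$ almost everywhere on $U+\mathcal B_{2(1+\sqrt2)A+B}$, then $f_1^{\mathrm{low}}=f_2^{\mathrm{low}}$ almost everywhere on $U$. -/

import Mathlib

open MeasureTheory Set
open scoped SchwartzMap FourierTransform LineDeriv ENNReal ContDiff ComplexConjugate

noncomputable section

/-- The Euclidean plane. The coordinates `x₁, x₂` of a point `x` are `x 0, x 1`. -/
abbrev Plane := EuclideanSpace ℝ (Fin 2)

/-- The Hilbert space `L²(ℝ²)` of complex-valued functions. Mathlib's `inner ℂ g f` is conjugate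
linear in its first argument, so that `⟨f, g⟩ = ∫ f ḡ` is `inner ℂ g f`. -/
abbrev L2Plane := Lp ℂ 2 (volume : Measure Plane)

/-- The Fourier transform `f̂(ω) = ∫ f(x) exp(2πi ω·x) dx`, extended to `L²`. With this sign it is
what Mathlib calls the inverse Fourier transform. -/
def hat (f : L2Plane) : L2Plane := 𝓕⁻ f

/-- The class in `L²` of a square integrable function. -/
def toL2 (f : Plane → ℂ) : L2Plane :=
  open scoped Classical in if h : MemLp f 2 volume then h.toLp f else 0

/-- The tempered distribution `u` whose Fourier transform `û` (same sign convention as `hat`) is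
the bounded measurable function `m`. -/
def invHat (m : Plane → ℂ) : 𝓢'(Plane, ℂ) :=
  open scoped Classical in
  if h : MemLp m ∞ volume then 𝓕 (Lp.toTemperedDistribution (h.toLp m)) else 0

/-- Extension by continuity, from Schwartz functions to `L²`, of a linear map with values in
functions on the plane (unique when it exists, as Schwartz functions are dense). -/
def extendL2 (T : 𝓢(Plane, ℂ) → Plane → ℂ) : L2Plane →L[ℂ] L2Plane :=
  open scoped Classical in
  if h : ∃ S : L2Plane →L[ℂ] L2Plane, ∀ g : 𝓢(Plane, ℂ), S (g.toLp 2) =ᵐ[volume] T g then h.choose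
  else 0

/-- The convolution `g ↦ u ∗ g` with a tempered distribution `u`: for Schwartz functions `g` it is
`(u ∗ g)(x) = u (y ↦ g (x - y))`, and it is extended to `L²` by continuity. -/
def conv (u : 𝓢'(Plane, ℂ)) : L2Plane →L[ℂ] L2Plane :=
  extendL2 fun g x => u (SchwartzMap.compSubConstCLM ℂ x
    (SchwartzMap.compCLMOfContinuousLinearEquiv ℂ (ContinuousLinearEquiv.neg ℝ) g))

/-- The complex conjugate of a Schwartz function. -/
def conjSchwartz (f : 𝓢(Plane, ℂ)) : 𝓢(Plane, ℂ) :=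
  SchwartzMap.postcompCLM (Complex.conjCLE : ℂ →L[ℝ] ℂ) f

/-- The coefficients `t ↦ ⟨f, T_t φ⟩` with respect to the translates of a tempered distribution
`φ`: for Schwartz functions `f` the number `⟨f, T_t φ⟩ = ∫ f(x) conj (φ (x - t)) dx` is the complex
conjugate of `φ` applied to `y ↦ conj (f (y + t))`, and `f ↦ (t ↦ ⟨f, T_t φ⟩)` is extended to `L²`
by continuity. -/
def windowCoeff (φ : 𝓢'(Plane, ℂ)) : L2Plane →L[ℂ] L2Plane :=
  extendL2 fun f t => conj (φ (conjSchwartz (SchwartzMap.compSubConstCLM ℂ (-t) f)))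

/-- The reflection `x^ν = (x₂, x₁)`. -/
def swap (x : Plane) : Plane := !₂[x 1, x 0]

/-- The shearlet `ψ_{ast}(x) = a^{-3/4} ψ ((x₁ - t₁ - s (x₂ - t₂)) / a, (x₂ - t₂) / a^{1/2})`,
normalized in `L²`. -/
def shearlet (ψ : L2Plane) (a s : ℝ) (t : Plane) : L2Plane :=
  toL2 fun x => ((a ^ (-(3 / 4 : ℝ)) : ℝ) : ℂ) *
    ψ !₂[(x 0 - t 0 - s * (x 1 - t 1)) / a, (x 1 - t 1) / √a]

/-- The shearlet `ψ^ν_{ast}` for the other cone: the roles of the two coordinate axes are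
exchanged, `ψ^ν_{ast}(x) = a^{-3/4} ψ ((x₂ - t₂ - s (x₁ - t₁)) / a, (x₁ - t₁) / a^{1/2})`. -/
def shearletNu (ψ : L2Plane) (a s : ℝ) (t : Plane) : L2Plane :=
  toL2 fun x => ((a ^ (-(3 / 4 : ℝ)) : ℝ) : ℂ) *
    ψ !₂[(x 1 - t 1 - s * (x 0 - t 0)) / a, (x 0 - t 0) / √a]

/-- `M` vanishing moments in `x₁`-direction: `∫ |ψ̂(ω)|² / |ω₁|^{2M} dω < ∞`. -/
def HasVanishingMoments (M : ℕ) (ψ : L2Plane) : Prop :=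
  Integrable (fun ξ : Plane => ‖hat ψ ξ‖ ^ 2 / |ξ 0| ^ (2 * M)) volume

/-- `ψ = (∂/∂x₁)^M θ` in the sense of tempered distributions. -/
def IsIteratedPartial (M : ℕ) (θ ψ : L2Plane) : Prop :=
  Lp.toTemperedDistribution ψ =
    ∂^{fun _ : Fin M => (EuclideanSpace.single 0 1 : Plane)} (Lp.toTemperedDistribution θ)

/-- `C_ψ^+ = ∫_{ω₁ > 0} |ψ̂(ω)|² / |ω₁|² dω`. -/
def constPos (ψ : L2Plane) : ℝ := ∫ ξ in {ξ : Plane | 0 < ξ 0}, ‖hat ψ ξ‖ ^ 2 / |ξ 0| ^ 2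

/-- `C_ψ^- = ∫_{ω₁ < 0} |ψ̂(ω)|² / |ω₁|² dω`. It agrees with `constPos ψ` for real-valued `ψ`;
when the two agree, their common value is
`∫_ℝ ∫_0^∞ |ψ̂(a ξ₁, a^{1/2} (ξ₂ - s ξ₁))|² a^{-3/2} da ds` for every `ξ` with `ξ₁ ≠ 0`. -/
def constNeg (ψ : L2Plane) : ℝ := ∫ ξ in {ξ : Plane | ξ 0 < 0}, ‖hat ψ ξ‖ ^ 2 / |ξ 0| ^ 2

/-- `Δ_ψ(ξ) = ∫_{-2}^2 ∫_0^1 |ψ̂(a ξ₁, a^{1/2} (ξ₂ - s ξ₁))|² a^{-3/2} da ds`. -/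
def shearletDelta (ψ : L2Plane) (ξ : Plane) : ℝ :=
  ∫ s in Icc (-2 : ℝ) 2, ∫ a in Ioc (0 : ℝ) 1,
    ‖hat ψ !₂[a * ξ 0, √a * (ξ 1 - s * ξ 0)]‖ ^ 2 * a ^ (-(3 / 2 : ℝ))

/-- `Δ_{ψ^ν}(ξ)`, the function `Δ` of the system `ψ^ν_{ast}`. -/
def shearletDeltaNu (ψ : L2Plane) (ξ : Plane) : ℝ := shearletDelta ψ (swap ξ)

/-- The cone `|ξ₂| ≤ |ξ₁|`. -/
def cone : Set Plane := {ξ | |ξ 1| ≤ |ξ 0|}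

/-- `p̂₀ = Φ̂ ∗ χ_C`, with `Φ̂(η) = ∫ Φ(x) exp(2πi η·x) dx`. -/
def p0hat (Φ : Plane → ℂ) (ξ : Plane) : ℂ :=
  ∫ η : Plane, 𝓕⁻ Φ η * cone.indicator (fun _ => (1 : ℂ)) (ξ - η)

/-- `p̂₁ = 1 - p̂₀`. -/
def p1hat (Φ : Plane → ℂ) (ξ : Plane) : ℂ := 1 - p0hat Φ ξ

/-- `q̂ = p̂^{1/2}`, for a function `p̂` with values in `[0, ∞)`. -/
def sqrtHat (p : Plane → ℂ) (ξ : Plane) : ℂ := ((√(p ξ).re : ℝ) : ℂ)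

/-- `φ̂ = (p̂₀ |φ̂₀|² + p̂₁ |φ̂₁|²)^{1/2}`, where `u₀ = φ̂₀` and `u₁ = φ̂₁`. -/
def windowHat (Φ : Plane → ℂ) (u₀ u₁ : Plane → ℂ) (ξ : Plane) : ℂ :=
  ((√((p0hat Φ ξ).re * ‖u₀ ξ‖ ^ 2 + (p1hat Φ ξ).re * ‖u₁ ξ‖ ^ 2) : ℝ) : ℂ)

/-- The measure `a^{-3} da ds dt` on the triples `(t, s, a)` with `t ∈ ℝ²`, `s ∈ [-2, 2]` and
`a ∈ (0, 1]`. -/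
def shearletMeasure : Measure (Plane × ℝ × ℝ) :=
  (volume : Measure Plane).prod
    ((volume.restrict (Icc (-2 : ℝ) 2)).prod
      ((volume.restrict (Ioc (0 : ℝ) 1)).withDensity fun a => ENNReal.ofReal (a ^ (-3 : ℝ))))

/-- `h = (1/C) (∫∫∫ ⟨f, ψ_{ast}⟩ p₀ ∗ ψ_{ast} a^{-3} da ds dt
+ ∫∫∫ ⟨f, ψ^ν_{ast}⟩ p₁ ∗ ψ^ν_{ast} a^{-3} da ds dt)` in the weak sense: the integrals converge
absolutely and give `⟨h, g⟩` after taking inner products with any `g` in `L²`. -/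
def IsHighPart (C : ℝ) (ψ : L2Plane) (Φ : Plane → ℂ) (f h : L2Plane) : Prop :=
  ∀ g : L2Plane,
    Integrable (fun z : Plane × ℝ × ℝ => inner ℂ (shearlet ψ z.2.2 z.2.1 z.1) f *
      inner ℂ g (conv (invHat (p0hat Φ)) (shearlet ψ z.2.2 z.2.1 z.1))) shearletMeasure ∧
    Integrable (fun z : Plane × ℝ × ℝ => inner ℂ (shearletNu ψ z.2.2 z.2.1 z.1) f *
      inner ℂ g (conv (invHat (p1hat Φ)) (shearletNu ψ z.2.2 z.2.1 z.1))) shearletMeasure ∧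
    inner ℂ g h = ((1 / C : ℝ) : ℂ) *
      ((∫ z : Plane × ℝ × ℝ, inner ℂ (shearlet ψ z.2.2 z.2.1 z.1) f *
          inner ℂ g (conv (invHat (p0hat Φ)) (shearlet ψ z.2.2 z.2.1 z.1)) ∂shearletMeasure) +
        ∫ z : Plane × ℝ × ℝ, inner ℂ (shearletNu ψ z.2.2 z.2.1 z.1) f *
          inner ℂ g (conv (invHat (p1hat Φ)) (shearletNu ψ z.2.2 z.2.1 z.1)) ∂shearletMeasure)

/-- `h = (1/C) (∫ ⟨f, T_t φ₀⟩ p₀ ∗ T_t φ₀ dt + ∫ ⟨f, T_t φ₁⟩ p₁ ∗ T_t φ₁ dt)` in the weak sense,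
where `φ̂ᵢ = uᵢ`. Here `pᵢ ∗ T_t φᵢ = T_t (pᵢ ∗ φᵢ)`, and `pᵢ ∗ φᵢ` has Fourier transform
`p̂ᵢ φ̂ᵢ`; the integrands are products of two functions in `L²(dt)`. -/
def IsLowPart (C : ℝ) (Φ : Plane → ℂ) (u₀ u₁ : Plane → ℂ) (f h : L2Plane) : Prop :=
  ∀ g : L2Plane,
    inner ℂ g h = ((1 / C : ℝ) : ℂ) *
      ((∫ t : Plane, windowCoeff (invHat u₀) f t *
          conj (windowCoeff (invHat fun ξ => p0hat Φ ξ * u₀ ξ) g t)) +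
        ∫ t : Plane, windowCoeff (invHat u₁) f t *
          conj (windowCoeff (invHat fun ξ => p1hat Φ ξ * u₁ ξ) g t))

/-- The tight frame identity `‖f‖² = (1/C) (∫∫∫ |⟨f, q₀ ∗ ψ_{ast}⟩|² a^{-3} da ds dt
+ ∫∫∫ |⟨f, q₁ ∗ ψ^ν_{ast}⟩|² a^{-3} da ds dt + ∫ |⟨f, T_t φ⟩|² dt)`, all integrals being finite. -/
def TightFrameIdentity (C : ℝ) (ψ : L2Plane) (q₀ q₁ φ : 𝓢'(Plane, ℂ)) (f : L2Plane) : Prop :=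
  Integrable (fun z : Plane × ℝ × ℝ =>
    ‖inner ℂ (conv q₀ (shearlet ψ z.2.2 z.2.1 z.1)) f‖ ^ 2) shearletMeasure ∧
  Integrable (fun z : Plane × ℝ × ℝ =>
    ‖inner ℂ (conv q₁ (shearletNu ψ z.2.2 z.2.1 z.1)) f‖ ^ 2) shearletMeasure ∧
  Integrable (fun t : Plane => ‖windowCoeff φ f t‖ ^ 2) volume ∧
  ‖f‖ ^ 2 = 1 / C *
    ((∫ z : Plane × ℝ × ℝ,
        ‖inner ℂ (conv q₀ (shearlet ψ z.2.2 z.2.1 z.1)) f‖ ^ 2 ∂shearletMeasure) +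
      (∫ z : Plane × ℝ × ℝ,
        ‖inner ℂ (conv q₁ (shearletNu ψ z.2.2 z.2.1 z.1)) f‖ ^ 2 ∂shearletMeasure) +
      ∫ t : Plane, ‖windowCoeff φ f t‖ ^ 2)

end

/-! ### The Fourier transform on `L²` -/

/-! Every operator in the theorem is a Fourier multiplier, so that the theorem reduces to pointwise
statements about bounded symbols.

A shearlet with parameters `a, s, t` has Fourier transform `a^{3/4} e^{2πi t·ξ} ψ̂(aξ₁, √a(ξ₂ +
sξ₁))`. For fixed `(s, a)` the coefficients `t ↦ ⟨f, q ∗ ψ_{ast}⟩` are therefore the Fourier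
transform of a product with `f̂`. Plancherel in `t` and Fubini in `(s, a)` turn the integral of a
product of two such coefficients, for `f` and for `g`, into an integral of `f̂ · conj ĝ` against
`conj q · q' · Δ_ψ` (`integral_shearlet_coeff`). The high part thus has symbol `(p̂₀ Δ_ψ + p̂₁
Δ_{ψ^ν}) / C_ψ`, and the windows contribute `(p̂₀ (C_ψ - Δ_ψ) + p̂₁ (C_ψ - Δ_{ψ^ν})) / C_ψ`. These
add up to `1` because `p̂₀ + p̂₁ = 1`; this gives the tight frame and the reconstruction.

The substitution `η = (aξ₁, √a(ξ₂ + sξ₁))` turns `a^{-3/2} da ds` into `η₁^{-2} dη` on a half plane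
(`lintegral_shear`). Over all `a > 0` and all real `s` the integral is exactly `C_ψ`, so `Δ_ψ ≤
C_ψ`, and `C_ψ - Δ_ψ` is the contribution of `|s| > 2` or `a > 1`.

For the decay, consider first `|ξ₂| ≤ (3/2)|ξ₁|`. There the steep shears `|s| > 2` are controlled by
the moments in `x₁` and the decay of `θ̂` in `ξ₂` (`lintegral_steep_le`), the coarse scales `a > 1`
by the decay of `ψ̂` (`lintegral_coarse_le`). Outside that cone `p̂₀` decays rapidly, since `Φ̂` is
a Schwartz function and `ξ` is at distance comparable to `‖ξ‖` from the cone. Exchanging the axes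
handles `p̂₁`.

For locality it is enough to treat the high part, as `f^low = f - f^high`. Shearlets with `a ≤ 1`
and `|s| ≤ 2` live in balls of radius `(1 + √2) A`, and multiplication by `Φ̂ ∗ χ` on the Fourier
side enlarges supports by at most `B`, because its kernel is `Φ` times a distribution. -/

theorem ae_eq_of_integral_schwartz_mul {f g : Plane → ℂ} (hf : LocallyIntegrable f volume)
    (hg : LocallyIntegrable g volume)
    (h : ∀ u : 𝓢(Plane, ℂ), ∫ x, u x * f x = ∫ x, u x * g x) : f =ᵐ[volume] g := by
  apply ae_eq_of_integral_contDiff_smul_eq hf hg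
  intro u hu hc
  have h₁ : HasCompactSupport (Complex.ofRealCLM ∘ u) := hc.comp_left rfl
  have h₂ : ContDiff ℝ ∞ (Complex.ofRealCLM ∘ u) := by fun_prop
  simpa using h (h₁.toSchwartzMap h₂)

theorem integral_fourier_mul_eq {f g : Plane → ℂ} (hf : Integrable f volume)
    (hg : Integrable g volume) : ∫ ξ, 𝓕 f ξ * g ξ = ∫ x, f x * 𝓕 g x := by
  have := VectorFourier.integral_fourierIntegral_smul_eq_flip (L := innerₗ Plane) (μ := volume)
    (ν := volume) (f := f) (g := g) Real.continuous_fourierChar (by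
      simp only [innerₗ_apply_apply]; fun_prop) hf hg
  rw [flip_innerₗ] at this
  exact this

theorem integral_fourierInv_mul_eq {f g : Plane → ℂ} (hf : Integrable f volume)
    (hg : Integrable g volume) : ∫ ξ, 𝓕⁻ f ξ * g ξ = ∫ x, f x * 𝓕⁻ g x := by
  have := VectorFourier.integral_fourierIntegral_smul_eq_flip (L := -innerₗ Plane) (μ := volume)
    (ν := volume) (f := f) (g := g) Real.continuous_fourierChar (by
      simp only [LinearMap.neg_apply, innerₗ_apply_apply]; fun_prop) hf hg
  have h : (-innerₗ Plane).flip = -innerₗ Plane := by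
    ext x y; simp [real_inner_comm]
  rw [h] at this
  exact this

theorem continuous_fourier {f : Plane → ℂ} (hf : Integrable f volume) : Continuous (𝓕 f) :=
  VectorFourier.fourierIntegral_continuous (L := innerₗ Plane) Real.continuous_fourierChar
    (by simp only [innerₗ_apply_apply]; fun_prop) hf

theorem continuous_fourierInv {f : Plane → ℂ} (hf : Integrable f volume) :
    Continuous (𝓕⁻ f) := by
  rw [Real.fourierInv_eq_fourier_comp_neg]
  exact continuous_fourier hf.comp_neg

theorem L2Plane.locallyIntegrable (f : L2Plane) : LocallyIntegrable f volume :=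
  (Lp.memLp f).locallyIntegrable (by norm_num)

theorem integral_fourier_L2 (f : L2Plane) (u : 𝓢(Plane, ℂ)) :
    ∫ x, u x * (𝓕 f : L2Plane) x = ∫ x, 𝓕 (u : Plane → ℂ) x * f x := by
  have h := DFunLike.congr_fun (Lp.fourier_toTemperedDistribution_eq f) u
  rw [TemperedDistribution.fourier_apply, Lp.toTemperedDistribution_apply,
    Lp.toTemperedDistribution_apply] at h
  exact h.symm

theorem integral_fourierInv_L2 (f : L2Plane) (u : 𝓢(Plane, ℂ)) :
    ∫ x, u x * (𝓕⁻ f : L2Plane) x = ∫ x, 𝓕⁻ (u : Plane → ℂ) x * f x := by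
  have h := DFunLike.congr_fun (Lp.fourierInv_toTemperedDistribution_eq f) u
  rw [TemperedDistribution.fourierInv_apply, Lp.toTemperedDistribution_apply,
    Lp.toTemperedDistribution_apply] at h
  rw [← SchwartzMap.fourierInv_coe]
  exact h.symm

theorem fourier_toLp_ae_eq {f : Plane → ℂ} (hf : Integrable f volume) (hf₂ : MemLp f 2 volume) :
    (𝓕 (hf₂.toLp f) : L2Plane) =ᵐ[volume] 𝓕 f := by
  apply ae_eq_of_integral_schwartz_mul (L2Plane.locallyIntegrable _)
    (continuous_fourier hf).locallyIntegrable
  intro u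
  rw [integral_fourier_L2, ← integral_fourier_mul_eq u.integrable hf]
  apply integral_congr_ae
  filter_upwards [hf₂.coeFn_toLp] with x hx
  rw [hx]

theorem fourierInv_toLp_ae_eq {f : Plane → ℂ} (hf : Integrable f volume)
    (hf₂ : MemLp f 2 volume) : (𝓕⁻ (hf₂.toLp f) : L2Plane) =ᵐ[volume] 𝓕⁻ f := by
  apply ae_eq_of_integral_schwartz_mul (L2Plane.locallyIntegrable _)
    (continuous_fourierInv hf).locallyIntegrable
  intro u
  rw [integral_fourierInv_L2, ← integral_fourierInv_mul_eq u.integrable hf]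
  apply integral_congr_ae
  filter_upwards [hf₂.coeFn_toLp] with x hx
  rw [hx]

theorem fourier_hat (f : L2Plane) : (𝓕 (hat f) : L2Plane) = f :=
  FourierTransform.fourier_fourierInv_eq f

theorem hat_fourier (f : L2Plane) : hat (𝓕 f) = f :=
  FourierTransform.fourierInv_fourier_eq f

theorem hat_injective : Function.Injective hat := fun f g h => by
  rw [← fourier_hat f, h, fourier_hat]

theorem inner_hat (f g : L2Plane) : inner ℂ (hat f) (hat g) = inner ℂ f g := by
  rw [← Lp.inner_fourier_eq, fourier_hat, fourier_hat]

theorem inner_eq_integral_hat (f g : L2Plane) :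
    inner ℂ f g = ∫ ξ, conj (hat f ξ) * hat g ξ := by
  rw [← inner_hat, L2.inner_def]
  simp only [RCLike.inner_apply, mul_comm]

theorem hat_add (f g : L2Plane) : hat (f + g) = hat f + hat g :=
  FourierTransform.fourierInv_add f g

theorem stronglyMeasurable_hat (f : L2Plane) : StronglyMeasurable (hat f : Plane → ℂ) :=
  Lp.stronglyMeasurable _

/-! ### Fourier multipliers -/

/-- Multiplication by a bounded function on `L²`. -/
noncomputable def mulBdd {m : Plane → ℂ} (hm : MemLp m ∞ volume) : L2Plane →L[ℂ] L2Plane :=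
  (ContinuousLinearMap.mul ℂ ℂ).holderL volume ∞ 2 2 (hm.toLp m)

theorem mulBdd_ae_eq {m : Plane → ℂ} (hm : MemLp m ∞ volume) (f : L2Plane) :
    mulBdd hm f =ᵐ[volume] fun ξ => m ξ * f ξ := by
  have h := (ContinuousLinearMap.mul ℂ ℂ).coeFn_holder (r := 2) (hm.toLp m) f
  filter_upwards [h, hm.coeFn_toLp] with x hx hx'
  rw [← hx']
  exact hx

/-- The operator on `L²` which multiplies Fourier transforms by a bounded function. -/
noncomputable def multiplier {m : Plane → ℂ} (hm : MemLp m ∞ volume) : L2Plane →L[ℂ] L2Plane :=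
  (FourierTransform.fourierCLM ℂ L2Plane).comp
    ((mulBdd hm).comp (FourierTransform.fourierInvCLM ℂ L2Plane))

theorem hat_multiplier {m : Plane → ℂ} (hm : MemLp m ∞ volume) (f : L2Plane) :
    hat (multiplier hm f) = mulBdd hm (hat f) :=
  hat_fourier _

theorem hat_multiplier_ae_eq {m : Plane → ℂ} (hm : MemLp m ∞ volume) (f : L2Plane) :
    hat (multiplier hm f) =ᵐ[volume] fun ξ => m ξ * hat f ξ := by
  rw [hat_multiplier]
  exact mulBdd_ae_eq hm _

/-- Density of Schwartz functions makes the extension unique, so the operator chosen in the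
definition may be replaced by any explicit one. This is how the abstract convolutions and
coefficient maps become multipliers. -/
theorem extendL2_eq {T : 𝓢(Plane, ℂ) → Plane → ℂ} {S : L2Plane →L[ℂ] L2Plane}
    (hS : ∀ g : 𝓢(Plane, ℂ), S (g.toLp 2) =ᵐ[volume] T g) : extendL2 T = S := by
  have h : ∃ S : L2Plane →L[ℂ] L2Plane,
    ∀ g : 𝓢(Plane, ℂ), S (g.toLp 2) =ᵐ[volume] T g := ⟨S, hS⟩
  have hd : DenseRange (SchwartzMap.toLpCLM ℂ (E := Plane) ℂ 2 volume) :=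
    SchwartzMap.denseRange_toLpCLM ENNReal.ofNat_ne_top
  rw [extendL2, dif_pos h]
  apply DFunLike.coe_injective
  apply hd.equalizer (h.choose.continuous) S.continuous
  funext g
  exact Lp.ext ((h.choose_spec g).trans (hS g).symm)

theorem hat_toLp (g : 𝓢(Plane, ℂ)) :
    hat (g.toLp 2) =ᵐ[volume] 𝓕⁻ (g : Plane → ℂ) := by
  rw [hat, SchwartzMap.toLp_fourierInv_eq, ← SchwartzMap.fourierInv_coe]
  exact SchwartzMap.coeFn_toLp _ _ _

theorem memLp_fourierInv_schwartz (g : 𝓢(Plane, ℂ)) (p : ℝ≥0∞) :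
    MemLp (𝓕⁻ (g : Plane → ℂ)) p volume := by
  rw [← SchwartzMap.fourierInv_coe]
  exact SchwartzMap.memLp _ _ _

theorem multiplier_toLp_ae_eq {m : Plane → ℂ} (hm : MemLp m ∞ volume) (g : 𝓢(Plane, ℂ)) :
    multiplier hm (g.toLp 2) =ᵐ[volume] 𝓕 fun ξ => m ξ * 𝓕⁻ (g : Plane → ℂ) ξ := by
  have h1 : MemLp (fun ξ => m ξ * 𝓕⁻ (g : Plane → ℂ) ξ) 1 volume :=
    (memLp_fourierInv_schwartz g 1).mul hm
  have h2 : MemLp (fun ξ => m ξ * 𝓕⁻ (g : Plane → ℂ) ξ) 2 volume :=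
    (memLp_fourierInv_schwartz g 2).mul hm
  have h3 : mulBdd hm (hat (g.toLp 2)) = h2.toLp _ := by
    apply Lp.ext
    filter_upwards [mulBdd_ae_eq hm (hat (g.toLp 2)), h2.coeFn_toLp, hat_toLp g] with x a b c
    rw [a, b, c]
  have h4 : multiplier hm (g.toLp 2) = 𝓕 (mulBdd hm (hat (g.toLp 2))) := rfl
  rw [h4, h3]
  exact fourier_toLp_ae_eq (memLp_one_iff_integrable.1 h1) h2

theorem invHat_apply {m : Plane → ℂ} (hm : MemLp m ∞ volume) (u : 𝓢(Plane, ℂ)) :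
    invHat m u = ∫ ξ, 𝓕 (u : Plane → ℂ) ξ * m ξ := by
  rw [invHat, dif_pos hm, TemperedDistribution.fourier_apply, Lp.toTemperedDistribution_apply]
  apply integral_congr_ae
  filter_upwards [hm.coeFn_toLp] with x hx
  rw [hx]
  rfl

/-- The Fourier transform of `y ↦ g (x - y)` is `𝓕⁻ g` times the character `e^{-2πi ξ·x}`, so
pairing with `m` gives the Fourier integral of `m · 𝓕⁻ g` at `x`. -/
theorem conv_invHat {m : Plane → ℂ} (hm : MemLp m ∞ volume) :
    conv (invHat m) = multiplier hm := by
  apply extendL2_eq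
  intro g
  filter_upwards [multiplier_toLp_ae_eq hm g] with x hx
  rw [hx, invHat_apply hm, Real.fourier_eq]
  apply integral_congr_ae
  refine Filter.Eventually.of_forall fun ξ => ?_
  have : 𝓕 (fun y => g (x - y)) ξ = Real.fourierChar (-inner ℝ ξ x) • 𝓕⁻ (g : Plane → ℂ) ξ := by
    rw [Real.fourier_eq, Real.fourierInv_eq,
      ← integral_sub_left_eq_self (fun y => Real.fourierChar (inner ℝ y ξ) • g y) volume x,
      Circle.smul_def, ← integral_smul]
    congr 1
    ext y
    rw [← Circle.smul_def, smul_smul, ← AddChar.map_add_eq_mul]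
    congr 2
    rw [inner_sub_left, real_inner_comm x ξ]
    ring
  have h2 : ((SchwartzMap.compSubConstCLM ℂ x
    (SchwartzMap.compCLMOfContinuousLinearEquiv ℂ (ContinuousLinearEquiv.neg ℝ) g) :
      𝓢(Plane, ℂ)) : Plane → ℂ) = fun y => g (x - y) := by
    ext y
    simp
  simp only [h2, this, Circle.smul_def, smul_eq_mul]
  ring

theorem MemLp.conj {m : Plane → ℂ} {p : ℝ≥0∞} (hm : MemLp m p volume) :
    MemLp (fun ξ => conj (m ξ)) p volume :=
  hm.star

/-- The computation is the one for convolutions, except that the window enters conjugated; hence the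
conjugate symbol. -/
theorem windowCoeff_invHat {m : Plane → ℂ} (hm : MemLp m ∞ volume) :
    windowCoeff (invHat m) = multiplier (MemLp.conj hm) := by
  apply extendL2_eq
  intro g
  filter_upwards [multiplier_toLp_ae_eq (MemLp.conj hm) g] with x hx
  rw [hx, invHat_apply hm, Real.fourier_eq, ← integral_conj]
  apply integral_congr_ae
  refine Filter.Eventually.of_forall fun ξ => ?_
  have : conj (𝓕 (fun y => conj (g (y + x))) ξ) =
      Real.fourierChar (-inner ℝ ξ x) • 𝓕⁻ (g : Plane → ℂ) ξ := by
    rw [Real.fourier_eq, Real.fourierInv_eq, ← integral_conj,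
      ← integral_add_right_eq_self (fun y => Real.fourierChar (inner ℝ y ξ) • g y) x,
      Circle.smul_def, ← integral_smul]
    congr 1
    ext y
    rw [← Circle.smul_def, smul_smul, ← AddChar.map_add_eq_mul, Circle.smul_def, Circle.smul_def,
      smul_eq_mul, smul_eq_mul, map_mul, Complex.conj_conj, ← Circle.coe_inv_eq_conj,
      ← AddChar.map_neg_eq_inv]
    congr 3
    rw [inner_add_left, real_inner_comm x ξ]
    ring
  have h2 : ((conjSchwartz (SchwartzMap.compSubConstCLM ℂ (-x) g) : 𝓢(Plane, ℂ)) : Plane → ℂ) =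
      fun y => conj (g (y + x)) := by
    ext y
    simp [conjSchwartz]
  simp only [h2, map_mul, this, Circle.smul_def, smul_eq_mul]
  ring

/-! ### Affine changes of variables -/

/-- Only the effect of `g` on Lebesgue measure matters: composition scales the `L²` norm by `k⁻¹`,
which the prefactor `k` cancels. -/
theorem eLpNorm_dilate {k : ℝ} {g : Plane → Plane} (hg : Measurable g)
    (hk : 0 < k) (hmap : Measure.map g volume = ENNReal.ofReal ((k ^ 2)⁻¹) • volume)
    (f : L2Plane) : eLpNorm (fun x => (k : ℂ) * f (g x)) 2 volume = ‖f‖ₑ := by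
  have h1 : eLpNorm (fun x => f (g x)) 2 volume = ENNReal.ofReal k⁻¹ * ‖f‖ₑ := by
    have := eLpNorm_map_measure (p := 2) (f := g) (g := f) (μ := volume)
      (Lp.stronglyMeasurable f).aestronglyMeasurable hg.aemeasurable
    rw [hmap, eLpNorm_smul_measure_of_ne_top (by norm_num)] at this
    change eLpNorm (f ∘ g) 2 volume = _
    rw [← this, Lp.enorm_def, smul_eq_mul]
    congr 1
    rw [ENNReal.ofReal_rpow_of_pos (by positivity)]
    congr 1
    rw [← inv_pow, ← Real.rpow_natCast, ← Real.rpow_mul (by positivity)]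
    norm_num
  have h2 := eLpNorm_const_smul (k : ℂ) (fun x => f (g x)) 2 volume
  have h3 : ((k : ℂ) • fun x => f (g x)) = fun x => (k : ℂ) * f (g x) := rfl
  rw [h3] at h2
  rw [h2, h1, ← mul_assoc, ← ofReal_norm (k : ℂ), Complex.norm_real, Real.norm_of_nonneg hk.le,
    ← ENNReal.ofReal_mul hk.le, mul_inv_cancel₀ hk.ne', ENNReal.ofReal_one, one_mul]

theorem memLp_dilate {k : ℝ} {g : Plane → Plane} (hg : Measurable g)
    (hk : 0 < k) (hmap : Measure.map g volume = ENNReal.ofReal ((k ^ 2)⁻¹) • volume)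
    (f : L2Plane) : MemLp (fun x => (k : ℂ) * f (g x)) 2 volume :=
  ⟨(((Lp.stronglyMeasurable f).comp_measurable hg).const_mul _).aestronglyMeasurable, by
    rw [eLpNorm_dilate hg hk hmap f]; exact enorm_lt_top⟩

/-- Composition with a map which scales Lebesgue measure by `k⁻²`, normalized to be an isometry of
`L²`. -/
noncomputable def dilate (k : ℝ) {g : Plane → Plane} (hg : Measurable g)
    (hk : 0 < k) (hmap : Measure.map g volume = ENNReal.ofReal ((k ^ 2)⁻¹) • volume) :
    L2Plane →L[ℂ] L2Plane :=
  have hac : Measure.QuasiMeasurePreserving g volume volume :=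
    ⟨hg, by rw [hmap]; exact Measure.smul_absolutelyContinuous⟩
  have hm := memLp_dilate hg hk hmap
  LinearMap.mkContinuous
    { toFun := fun f => (hm f).toLp _
      map_add' := fun f₁ f₂ => by
        apply Lp.ext
        filter_upwards [(hm (f₁ + f₂)).coeFn_toLp, (hm f₁).coeFn_toLp, (hm f₂).coeFn_toLp,
          Lp.coeFn_add ((hm f₁).toLp _) ((hm f₂).toLp _), hac.ae (Lp.coeFn_add f₁ f₂)]
          with x h1 h2 h3 h4 h5
        rw [h1, h4, Pi.add_apply, h2, h3, h5, Pi.add_apply, mul_add]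
      map_smul' := fun c f => by
        apply Lp.ext
        filter_upwards [(hm (c • f)).coeFn_toLp, (hm f).coeFn_toLp,
          Lp.coeFn_smul c ((hm f).toLp _), hac.ae (Lp.coeFn_smul c f)]
          with x h1 h2 h4 h5
        rw [h1, RingHom.id_apply, h4, Pi.smul_apply, h2, h5, Pi.smul_apply, smul_eq_mul,
          smul_eq_mul]
        ring } 1
    (fun f => by
      change ‖(hm f).toLp _‖ ≤ _
      rw [Lp.norm_toLp, eLpNorm_dilate hg hk hmap f, one_mul]
      simp)

theorem dilate_ae_eq {k : ℝ} {g : Plane → Plane} (hg : Measurable g)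
    (hk : 0 < k) (hmap : Measure.map g volume = ENNReal.ofReal ((k ^ 2)⁻¹) • volume)
    (f : L2Plane) : dilate k hg hk hmap f =ᵐ[volume] fun x => (k : ℂ) * f (g x) :=
  (memLp_dilate hg hk hmap f).coeFn_toLp

theorem quasiMeasurePreserving_of_map_eq {c : ℝ≥0∞} {g : Plane → Plane} (hg : Measurable g)
    (hmap : Measure.map g volume = c • volume) :
    Measure.QuasiMeasurePreserving g volume volume :=
  ⟨hg, by rw [hmap]; exact Measure.smul_absolutelyContinuous⟩

/-- The linear map with a given matrix, in coordinates. -/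
def planeMap (M : Matrix (Fin 2) (Fin 2) ℝ) (x : Plane) : Plane :=
  !₂[M 0 0 * x 0 + M 0 1 * x 1, M 1 0 * x 0 + M 1 1 * x 1]

theorem planeMap_eq_toLpLin (M : Matrix (Fin 2) (Fin 2) ℝ) :
    planeMap M = Matrix.toLpLin 2 2 M := by
  ext x i
  fin_cases i <;> simp [planeMap, Matrix.toLpLin_apply]

theorem continuous_planeMap (M : Matrix (Fin 2) (Fin 2) ℝ) : Continuous (planeMap M) := by
  rw [planeMap_eq_toLpLin]
  exact LinearMap.continuous_of_finiteDimensional _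

theorem map_planeMap {M : Matrix (Fin 2) (Fin 2) ℝ} (hM : M.det ≠ 0) :
    Measure.map (planeMap M) volume = ENNReal.ofReal |M.det⁻¹| • volume := by
  have h : LinearMap.det (Matrix.toLpLin 2 2 M : Plane →ₗ[ℝ] Plane) = M.det := by
    rw [Matrix.toLpLin_eq_toLin, LinearMap.det_toLin]
  rw [planeMap_eq_toLpLin, Measure.map_linearMap_addHaar_eq_smul_addHaar _ (by rwa [h]), h]

theorem plane_inner (x y : Plane) : inner ℝ x y = x 0 * y 0 + x 1 * y 1 := by
  simp [PiLp.inner_apply, Fin.sum_univ_two, mul_comm]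

theorem planeMap_inner {M M' : Matrix (Fin 2) (Fin 2) ℝ} (h : M.transpose * M' = 1) (x y : Plane) :
    inner ℝ (planeMap M x) (planeMap M' y) = inner ℝ x y := by
  have h00 := congrFun (congrFun h 0) 0
  have h01 := congrFun (congrFun h 0) 1
  have h10 := congrFun (congrFun h 1) 0
  have h11 := congrFun (congrFun h 1) 1
  simp [Matrix.mul_apply, Fin.sum_univ_two] at h00 h01 h10 h11
  simp only [plane_inner, planeMap, Matrix.cons_val_zero, Matrix.cons_val_one]
  linear_combination x 0 * y 0 * h00 + x 0 * y 1 * h01 + x 1 * y 0 * h10 + x 1 * y 1 * h11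

theorem map_planeMap_sub {M : Matrix (Fin 2) (Fin 2) ℝ} {k : ℝ} (hk : 0 < k)
    (hM : |M.det| = k ^ 2) (t : Plane) :
    Measure.map (fun x => planeMap M (x - t)) volume =
      ENNReal.ofReal ((k ^ 2)⁻¹) • volume := by
  have h0 : M.det ≠ 0 := by
    rw [← abs_pos, hM]; positivity
  have := Measure.map_map (μ := volume) (continuous_planeMap M).measurable
    (measurable_sub_const t)
  rw [(measurePreserving_sub_right volume t).map_eq, map_planeMap h0, abs_inv, hM] at this
  exact this.symm

theorem measurable_planeMap_sub (M : Matrix (Fin 2) (Fin 2) ℝ) (t : Plane) :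
    Measurable (fun x => planeMap M (x - t)) :=
  ((continuous_planeMap M).comp (continuous_id.sub continuous_const)).measurable

theorem memLp_fourierChar (t : Plane) :
    MemLp (fun ξ : Plane => (Real.fourierChar (inner ℝ t ξ) : ℂ)) ∞ volume := by
  refine memLp_top_of_bound (Continuous.aestronglyMeasurable ?_) 1 ?_
  · exact continuous_subtype_val.comp
      (Real.continuous_fourierChar.comp (continuous_const.inner continuous_id))
  · exact Filter.Eventually.of_forall fun ξ => (Circle.norm_coe _).le

theorem memLp_affine {M : Matrix (Fin 2) (Fin 2) ℝ} {k : ℝ} (hk : 0 < k)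
    (hM : |M.det| = k ^ 2) (t : Plane) (f : L2Plane) :
    MemLp (fun x => (k : ℂ) * f (planeMap M (x - t))) 2 volume :=
  (memLp_congr_ae (dilate_ae_eq (measurable_planeMap_sub M t) hk
    (map_planeMap_sub hk hM t) f)).1 (Lp.memLp _)

theorem fourierInv_affine {M M' : Matrix (Fin 2) (Fin 2) ℝ} {k : ℝ} (hk : 0 < k)
    (hM : |M.det| = k ^ 2) (hMM' : M.transpose * M' = 1) (t : Plane) {u : Plane → ℂ}
    (hu : Continuous u) (ξ : Plane) :
    𝓕⁻ (fun x => (k : ℂ) * u (planeMap M (x - t))) ξ =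
      (Real.fourierChar (inner ℝ t ξ) : ℂ) *
        (((k⁻¹ : ℝ) : ℂ) * 𝓕⁻ u (planeMap M' ξ)) := by
  have hg := measurable_planeMap_sub M t
  have hmap := map_planeMap_sub hk hM t
  rw [Real.fourierInv_eq, Real.fourierInv_eq]
  have h5 : ∀ x : Plane, Real.fourierChar (inner ℝ x ξ) • ((k : ℂ) * u (planeMap M (x - t))) =
      (fun y : Plane => (Real.fourierChar (inner ℝ t ξ) : ℂ) * ((k : ℂ) *
        (Real.fourierChar (inner ℝ y (planeMap M' ξ)) • u y))) (planeMap M (x - t)) := by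
    intro x
    have : inner ℝ x ξ = inner ℝ t ξ + inner ℝ (planeMap M (x - t)) (planeMap M' ξ) := by
      rw [planeMap_inner hMM', inner_sub_left]; ring
    simp only [Circle.smul_def, smul_eq_mul]
    rw [this, AddChar.map_add_eq_mul, Circle.coe_mul]
    ring
  simp_rw [h5]
  rw [← integral_map (φ := fun x => planeMap M (x - t)) (f := fun y : Plane =>
      (Real.fourierChar (inner ℝ t ξ) : ℂ) * ((k : ℂ) *
        (Real.fourierChar (inner ℝ y (planeMap M' ξ)) • u y))) hg.aemeasurable, hmap,
    integral_smul_measure, integral_const_mul, integral_const_mul,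
    ENNReal.toReal_ofReal (by positivity), Complex.real_smul]
  · have : (k : ℂ) ≠ 0 := by exact_mod_cast hk.ne'
    push_cast
    field_simp
  · refine (Continuous.aestronglyMeasurable ?_)
    have h6 : Continuous fun y : Plane => Real.fourierChar (inner ℝ y (planeMap M' ξ)) :=
      Real.continuous_fourierChar.comp (continuous_id.inner continuous_const)
    exact continuous_const.mul (continuous_const.mul (h6.smul hu))

/-- Both sides are continuous in `f` for the `L²` norm, so it suffices to compare them on Schwartz
functions, where the Fourier integral and a linear substitution apply. The matrix `M'` is the
inverse transpose of `M`, given by its defining equation so that no inverse has to be computed. -/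
theorem hat_affine {M M' : Matrix (Fin 2) (Fin 2) ℝ} {k : ℝ} (hk : 0 < k)
    (hM : |M.det| = k ^ 2) (hMM' : M.transpose * M' = 1) (t : Plane) {f h : L2Plane}
    (hh : h =ᵐ[volume] fun x => (k : ℂ) * f (planeMap M (x - t))) :
    hat h =ᵐ[volume] fun ξ => (Real.fourierChar (inner ℝ t ξ) : ℂ) *
      (((k⁻¹ : ℝ) : ℂ) * hat f (planeMap M' ξ)) := by
  have hk' : 0 < k⁻¹ := inv_pos.2 hk
  have hM' : |M'.det| = k⁻¹ ^ 2 := by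
    have := congrArg Matrix.det hMM'
    rw [Matrix.det_mul, Matrix.det_transpose, Matrix.det_one] at this
    have h2 := congrArg abs this
    rw [abs_mul, hM, abs_one] at h2
    field_simp
    linarith
  have hg' : Measurable (planeMap M') := (continuous_planeMap M').measurable
  have hmap' : Measure.map (planeMap M') volume = ENNReal.ofReal ((k⁻¹ ^ 2)⁻¹) • volume := by
    have := map_planeMap_sub hk' hM' 0
    simpa using this
  have hg := measurable_planeMap_sub M t
  have hmap := map_planeMap_sub hk hM t
  have e1 : h = dilate k hg hk hmap f := Lp.ext (hh.trans (dilate_ae_eq hg hk hmap f).symm)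
  have key : hat (dilate k hg hk hmap f) =
      mulBdd (memLp_fourierChar t) (dilate k⁻¹ hg' hk' hmap' (hat f)) := by
    have hd : DenseRange (SchwartzMap.toLpCLM ℂ (E := Plane) ℂ 2 volume) :=
      SchwartzMap.denseRange_toLpCLM ENNReal.ofNat_ne_top
    refine congrFun (hd.equalizer (g := fun f => hat (dilate k hg hk hmap f))
      (h := fun f => mulBdd (memLp_fourierChar t) (dilate k⁻¹ hg' hk' hmap' (hat f)))
      ?_ ?_ ?_) f
    · exact (FourierTransform.fourierInvCLM ℂ L2Plane).continuous.comp
        (dilate k hg hk hmap).continuous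
    · exact (mulBdd _).continuous.comp ((dilate k⁻¹ hg' hk' hmap').continuous.comp
        (FourierTransform.fourierInvCLM ℂ L2Plane).continuous)
    · funext u
      change hat (dilate k hg hk hmap (u.toLp 2)) =
        mulBdd (memLp_fourierChar t) (dilate k⁻¹ hg' hk' hmap' (hat (u.toLp 2)))
      have hi : Integrable (fun x => (k : ℂ) * u (planeMap M (x - t))) volume := by
        refine Integrable.const_mul ?_ _
        have : Integrable u (Measure.map (fun x => planeMap M (x - t)) volume) := by
          rw [hmap]
          exact u.integrable.smul_measure ENNReal.ofReal_ne_top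
        exact this.comp_measurable hg
      have hq := quasiMeasurePreserving_of_map_eq hg hmap
      have hae : dilate k hg hk hmap (u.toLp 2) =ᵐ[volume]
          fun x => (k : ℂ) * u (planeMap M (x - t)) := by
        filter_upwards [dilate_ae_eq hg hk hmap (u.toLp 2), hq.ae (u.coeFn_toLp 2 volume)]
          with x h1 h2
        rw [h1, h2]
      have hi2 : MemLp (fun x => (k : ℂ) * u (planeMap M (x - t))) 2 volume :=
        (memLp_congr_ae hae).1 (Lp.memLp _)
      have e2 : dilate k hg hk hmap (u.toLp 2) = hi2.toLp _ :=
        Lp.ext (hae.trans hi2.coeFn_toLp.symm)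
      rw [e2]
      apply Lp.ext
      have hq' := quasiMeasurePreserving_of_map_eq hg' hmap'
      filter_upwards [fourierInv_toLp_ae_eq hi hi2,
        mulBdd_ae_eq (memLp_fourierChar t) (dilate k⁻¹ hg' hk' hmap' (hat (u.toLp 2))),
        dilate_ae_eq hg' hk' hmap' (hat (u.toLp 2)), hq'.ae (hat_toLp u)] with ξ h1 h2 h3 h4
      rw [hat, h1, h2, h3, h4, fourierInv_affine hk hM hMM' t u.continuous]
  rw [e1, key]
  filter_upwards [mulBdd_ae_eq (memLp_fourierChar t) (dilate k⁻¹ hg' hk' hmap' (hat f)),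
    dilate_ae_eq hg' hk' hmap' (hat f)] with ξ h1 h2
  rw [h1, h2]

/-! ### The Fourier transforms of shearlets -/

/-- The transposed dilation and shear which acts on the Fourier transforms of shearlets. -/
noncomputable def shear (a s : ℝ) (ξ : Plane) : Plane := !₂[a * ξ 0, √a * (ξ 1 + s * ξ 0)]

/-- The family `sh a s t` has Fourier transforms
`a^{3/4} exp(2πi t·ξ) ψ̂(a ξ₁, a^{1/2} (ξ₂ + s ξ₁))`, after the change of coordinates `σ`. -/
def IsShearletFamily (ψ : L2Plane) (σ : Plane → Plane) (sh : ℝ → ℝ → Plane → L2Plane) : Prop :=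
  ∀ a s : ℝ, 0 < a → ∀ t : Plane, hat (sh a s t) =ᵐ[volume] fun ξ =>
    (Real.fourierChar (inner ℝ t ξ) : ℂ) *
      (((a ^ (3 / 4 : ℝ) : ℝ) : ℂ) * hat ψ (shear a s (σ ξ)))

theorem toL2_ae_eq {f : Plane → ℂ} (hf : MemLp f 2 volume) : toL2 f =ᵐ[volume] f := by
  rw [toL2, dif_pos hf]
  exact hf.coeFn_toLp

theorem abs_det_shear {a : ℝ} (ha : 0 < a) : a⁻¹ * (√a)⁻¹ = (a ^ (-(3 / 4 : ℝ))) ^ 2 := by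
  rw [← Real.rpow_natCast, ← Real.rpow_mul ha.le, Real.sqrt_eq_rpow, ← Real.rpow_neg_one,
    ← Real.rpow_neg ha.le, ← Real.rpow_add ha]
  norm_num

/-- The matrix of the dilation and shear in the definition of shearlets. -/
noncomputable def shearMatrix (a s : ℝ) : Matrix (Fin 2) (Fin 2) ℝ := !![a⁻¹, -s * a⁻¹; 0, (√a)⁻¹]

/-- The matrix of the dilation and shear in the definition of shearlets for the other cone. -/
noncomputable def shearMatrixNu (a s : ℝ) : Matrix (Fin 2) (Fin 2) ℝ := !![-s * a⁻¹, a⁻¹; (√a)⁻¹, 0]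

theorem abs_det_shearMatrix {a : ℝ} (ha : 0 < a) (s : ℝ) :
    |(shearMatrix a s).det| = (a ^ (-(3 / 4 : ℝ))) ^ 2 := by
  rw [← abs_det_shear ha, shearMatrix, Matrix.det_fin_two_of, mul_zero, sub_zero,
    abs_of_pos (by positivity)]

theorem abs_det_shearMatrixNu {a : ℝ} (ha : 0 < a) (s : ℝ) :
    |(shearMatrixNu a s).det| = (a ^ (-(3 / 4 : ℝ))) ^ 2 := by
  rw [← abs_det_shear ha, shearMatrixNu, Matrix.det_fin_two_of, mul_zero, zero_sub, abs_neg,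
    abs_of_pos (by positivity)]

theorem shearlet_ae_eq (ψ : L2Plane) {a : ℝ} (ha : 0 < a) (s : ℝ) (t : Plane) :
    shearlet ψ a s t =ᵐ[volume] fun x =>
      ((a ^ (-(3 / 4 : ℝ)) : ℝ) : ℂ) * ψ (planeMap (shearMatrix a s) (x - t)) := by
  have h := memLp_affine (Real.rpow_pos_of_pos ha _) (abs_det_shearMatrix ha s) t ψ
  have e : shearlet ψ a s t = toL2 fun x =>
      ((a ^ (-(3 / 4 : ℝ)) : ℝ) : ℂ) * ψ (planeMap (shearMatrix a s) (x - t)) := by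
    rw [shearlet]
    congr! 4 with x
    simp only [planeMap, shearMatrix]
    congr 1
    simp
    refine ⟨by ring, by ring⟩
  rw [e]
  exact toL2_ae_eq h

theorem shearletNu_ae_eq (ψ : L2Plane) {a : ℝ} (ha : 0 < a) (s : ℝ) (t : Plane) :
    shearletNu ψ a s t =ᵐ[volume] fun x =>
      ((a ^ (-(3 / 4 : ℝ)) : ℝ) : ℂ) * ψ (planeMap (shearMatrixNu a s) (x - t)) := by
  have h := memLp_affine (Real.rpow_pos_of_pos ha _) (abs_det_shearMatrixNu ha s) t ψ
  have e : shearletNu ψ a s t = toL2 fun x =>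
      ((a ^ (-(3 / 4 : ℝ)) : ℝ) : ℂ) * ψ (planeMap (shearMatrixNu a s) (x - t)) := by
    rw [shearletNu]
    congr! 4 with x
    simp only [planeMap, shearMatrixNu]
    congr 1
    simp
    refine ⟨by ring, by ring⟩
  rw [e]
  exact toL2_ae_eq h

/-- Here `M'` is the inverse transpose of the shear matrix. The transposition turns the shear `x₁ -
s x₂` into `ξ₂ + s ξ₁`; its sign is opposite to that in `shearletDelta`, which is harmless because
`[-2, 2]` is symmetric. -/
theorem isShearletFamily_shearlet (ψ : L2Plane) : IsShearletFamily ψ id (shearlet ψ) := by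
  intro a s ha t
  have h0 : √a ≠ 0 := (Real.sqrt_pos.2 ha).ne'
  have h := hat_affine (M' := !![a, 0; √a * s, √a]) (Real.rpow_pos_of_pos ha _)
    (abs_det_shearMatrix ha s)
    (by
      ext i j
      fin_cases i <;> fin_cases j <;>
        simp [shearMatrix, Matrix.mul_apply, Fin.sum_univ_two, ha.ne', h0])
    t (shearlet_ae_eq ψ ha s t)
  filter_upwards [h] with ξ hξ
  rw [hξ, ← Real.rpow_neg ha.le, neg_neg]
  congr 3
  simp only [planeMap, shear]
  congr 1
  simp
  ring

theorem isShearletFamily_shearletNu (ψ : L2Plane) :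
    IsShearletFamily ψ swap (shearletNu ψ) := by
  intro a s ha t
  have h0 : √a ≠ 0 := (Real.sqrt_pos.2 ha).ne'
  have h := hat_affine (M' := !![0, a; √a, √a * s]) (Real.rpow_pos_of_pos ha _)
    (abs_det_shearMatrixNu ha s)
    (by
      ext i j
      fin_cases i <;> fin_cases j <;>
        simp [shearMatrixNu, Matrix.mul_apply, Fin.sum_univ_two, ha.ne', h0])
    t (shearletNu_ae_eq ψ ha s t)
  filter_upwards [h] with ξ hξ
  rw [hξ, ← Real.rpow_neg ha.le, neg_neg]
  congr 3
  simp only [planeMap, shear, swap]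
  congr 1
  simp
  ring

/-! ### The frame operator of a shearlet family -/

theorem memLp_two_iff_lintegral {α : Type*} [MeasurableSpace α] {μ : Measure α} {f : α → ℂ}
    (hf : AEStronglyMeasurable f μ) : MemLp f 2 μ ↔ ∫⁻ x, ‖f x‖ₑ ^ 2 ∂μ < ⊤ := by
  have := eLpNorm_lt_top_iff_lintegral_rpow_enorm_lt_top (p := 2) (μ := μ) (f := f)
    (by norm_num) (by norm_num)
  simp only [ENNReal.toReal_ofNat, ENNReal.rpow_ofNat] at this
  rw [← this]
  exact ⟨fun h => h.2, fun h => ⟨hf, h⟩⟩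

theorem lintegral_enorm_sq (f : L2Plane) : ∫⁻ x, ‖f x‖ₑ ^ 2 = ‖f‖ₑ ^ 2 := by
  have := eLpNorm_nnreal_pow_eq_lintegral (p := 2) (μ := (volume : Measure Plane)) (f := f)
    (by norm_num)
  simp only [NNReal.coe_ofNat, ENNReal.rpow_ofNat] at this
  rw [← this, Lp.enorm_def]
  rfl

theorem inner_L2_eq_integral (f g : L2Plane) : inner ℂ f g = ∫ x, conj (f x) * g x := by
  rw [L2.inner_def]
  simp only [RCLike.inner_apply, mul_comm]

theorem norm_toLp_fourier {f : Plane → ℂ} (hf : Integrable f volume) (hf₂ : MemLp f 2 volume) :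
    ∫⁻ t, ‖𝓕 f t‖ₑ ^ 2 = ∫⁻ ξ, ‖f ξ‖ₑ ^ 2 := by
  have h1 : ∫⁻ t, ‖𝓕 f t‖ₑ ^ 2 = ‖(𝓕 (hf₂.toLp f) : L2Plane)‖ₑ ^ 2 := by
    rw [← lintegral_enorm_sq]
    apply lintegral_congr_ae
    filter_upwards [fourier_toLp_ae_eq hf hf₂] with x hx
    rw [hx]
  have h2 : ∫⁻ ξ, ‖f ξ‖ₑ ^ 2 = ‖hf₂.toLp f‖ₑ ^ 2 := by
    rw [← lintegral_enorm_sq]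
    apply lintegral_congr_ae
    filter_upwards [hf₂.coeFn_toLp] with x hx
    rw [hx]
  rw [h1, h2, ← ofReal_norm, ← ofReal_norm, Lp.norm_fourier_eq]

theorem integral_conj_fourier_mul_fourier {f g : Plane → ℂ} (hf : Integrable f volume)
    (hf₂ : MemLp f 2 volume) (hg : Integrable g volume) (hg₂ : MemLp g 2 volume) :
    ∫ t, 𝓕 f t * conj (𝓕 g t) = ∫ ξ, f ξ * conj (g ξ) := by
  have h := Lp.inner_fourier_eq (hg₂.toLp g) (hf₂.toLp f)
  rw [inner_L2_eq_integral, inner_L2_eq_integral] at h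
  have h1 : ∫ t, 𝓕 f t * conj (𝓕 g t) = ∫ t, conj ((𝓕 (hg₂.toLp g) : L2Plane) t) *
      (𝓕 (hf₂.toLp f) : L2Plane) t := by
    apply integral_congr_ae
    filter_upwards [fourier_toLp_ae_eq hf hf₂, fourier_toLp_ae_eq hg hg₂] with x hx hx'
    rw [hx, hx', mul_comm]
  have h2 : ∫ ξ, f ξ * conj (g ξ) = ∫ t, conj (hg₂.toLp g t) * hf₂.toLp f t := by
    apply integral_congr_ae
    filter_upwards [hf₂.coeFn_toLp, hg₂.coeFn_toLp] with x hx hx'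
    rw [hx, hx', mul_comm]
  rw [h1, h2, h]

/-- The measure `a⁻³ da ds` on the pairs `(s, a)`. -/
noncomputable def paramMeasure : Measure (ℝ × ℝ) :=
  (volume.restrict (Icc (-2 : ℝ) 2)).prod
    ((volume.restrict (Ioc (0 : ℝ) 1)).withDensity fun a => ENNReal.ofReal (a ^ (-3 : ℝ)))

instance : SFinite paramMeasure := by
  unfold paramMeasure; infer_instance

theorem shearletMeasure_eq : shearletMeasure = (volume : Measure Plane).prod paramMeasure := rfl

theorem ae_paramMeasure_pos : ∀ᵐ z ∂paramMeasure, 0 < z.2 := by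
  have h : ∀ᵐ a ∂((volume.restrict (Ioc (0 : ℝ) 1)).withDensity
      fun a => ENNReal.ofReal (a ^ (-3 : ℝ))), 0 < a :=
    (withDensity_absolutelyContinuous _ _).ae_le
      ((ae_restrict_mem measurableSet_Ioc).mono fun a ha => ha.1)
  exact Measure.quasiMeasurePreserving_snd.ae h

theorem ae_shearletMeasure_pos : ∀ᵐ z ∂shearletMeasure, 0 < z.2.2 :=
  Measure.quasiMeasurePreserving_snd.ae ae_paramMeasure_pos

/-- The Fourier transform of the shearlet at the origin, as a function of the pair `(s, a)`. -/
noncomputable def shearHat (ψ : L2Plane) (z : ℝ × ℝ) (ξ : Plane) : ℂ :=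
  ((z.2 ^ (3 / 4 : ℝ) : ℝ) : ℂ) * hat ψ (shear z.2 z.1 ξ)

/-- The function `Δ_ψ` as a Lebesgue integral with values in `[0, ∞]`. -/
noncomputable def lDelta (ψ : L2Plane) (ξ : Plane) : ℝ≥0∞ :=
  ∫⁻ z, ‖shearHat ψ z ξ‖ₑ ^ 2 ∂paramMeasure

theorem measurable_shear :
    Measurable (fun p : (ℝ × ℝ) × Plane => shear p.1.2 p.1.1 p.2) := by
  refine Continuous.measurable ?_
  unfold shear
  refine (PiLp.continuous_toLp 2 _).comp (continuous_pi fun i => ?_)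
  fin_cases i
  · simp only [Fin.zero_eta, Matrix.cons_val_zero]; fun_prop
  · simp only [Fin.mk_one, Matrix.cons_val_one, Matrix.cons_val_fin_one]; fun_prop

theorem measurable_shearHat (ψ : L2Plane) :
    Measurable (fun p : (ℝ × ℝ) × Plane => shearHat ψ p.1 p.2) := by
  unfold shearHat
  refine Measurable.mul ?_ ((stronglyMeasurable_hat ψ).measurable.comp measurable_shear)
  exact Complex.measurable_ofReal.comp (measurable_fst.snd.pow_const _)

theorem measurable_lDelta (ψ : L2Plane) : Measurable (lDelta ψ) :=
  Measurable.lintegral_prod_right' (f := fun p : Plane × (ℝ × ℝ) => ‖shearHat ψ p.2 p.1‖ₑ ^ 2)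
    (((measurable_shearHat ψ).comp measurable_swap).enorm.pow_const 2)

/-- The integrand of the shearlet coefficient of `f` at the origin, in the Fourier domain. -/
noncomputable def coeffKernel (ψ : L2Plane) (σ : Plane → Plane) (q : Plane → ℂ) (f : L2Plane)
    (z : ℝ × ℝ) (ξ : Plane) : ℂ :=
  conj (q ξ * shearHat ψ z (σ ξ)) * hat f ξ

section Kernel

variable {ψ : L2Plane} {σ : Plane → Plane} {sh : ℝ → ℝ → Plane → L2Plane} {q q' : Plane → ℂ}

theorem measurable_coeffKernel (hσ : Measurable σ) (hq : Measurable q) (f : L2Plane) :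
    Measurable (fun p : (ℝ × ℝ) × Plane => coeffKernel ψ σ q f p.1 p.2) := by
  unfold coeffKernel
  have h1 : Measurable (fun p : (ℝ × ℝ) × Plane => shearHat ψ p.1 (σ p.2)) :=
    (measurable_shearHat ψ).comp (measurable_fst.prodMk (hσ.comp measurable_snd))
  have h2 := (hq.comp (measurable_snd (α := ℝ × ℝ) (β := Plane))).mul h1
  exact (Complex.continuous_conj.measurable.comp h2).mul
    ((stronglyMeasurable_hat f).measurable.comp measurable_snd)

theorem hat_multiplier_shearlet (hsh : IsShearletFamily ψ σ sh) (hq : MemLp q ∞ volume)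
    {z : ℝ × ℝ} (hz : 0 < z.2) (t : Plane) :
    hat (multiplier hq (sh z.2 z.1 t)) =ᵐ[volume] fun ξ =>
      q ξ * ((Real.fourierChar (inner ℝ t ξ) : ℂ) * shearHat ψ z (σ ξ)) := by
  filter_upwards [hat_multiplier_ae_eq hq (sh z.2 z.1 t), hsh z.2 z.1 hz t] with ξ h1 h2
  rw [h1, h2]
  rfl

theorem integrable_coeffKernel (hsh : IsShearletFamily ψ σ sh) (hq : MemLp q ∞ volume)
    (f : L2Plane) {z : ℝ × ℝ} (hz : 0 < z.2) :
    Integrable (coeffKernel ψ σ q f z) volume := by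
  refine (L2.integrable_inner (𝕜 := ℂ) (hat (multiplier hq (sh z.2 z.1 0))) (hat f)).congr ?_
  filter_upwards [hat_multiplier_shearlet hsh hq hz 0] with ξ h
  rw [h, RCLike.inner_apply, coeffKernel]
  simp [mul_comm]

/-- By Parseval the translation parameter `t` survives only in a character, so the coefficient is a
Fourier integral in `t`. This is what makes Plancherel in `t` available. -/
theorem inner_multiplier_shearlet (hsh : IsShearletFamily ψ σ sh) (hq : MemLp q ∞ volume)
    (f : L2Plane) {z : ℝ × ℝ} (hz : 0 < z.2) (t : Plane) :
    inner ℂ (multiplier hq (sh z.2 z.1 t)) f = 𝓕 (coeffKernel ψ σ q f z) t := by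
  rw [inner_eq_integral_hat, Real.fourier_eq]
  apply integral_congr_ae
  filter_upwards [hat_multiplier_shearlet hsh hq hz t] with ξ h
  rw [h, coeffKernel, Circle.smul_def, smul_eq_mul, AddChar.map_neg_eq_inv,
    Circle.coe_inv_eq_conj, real_inner_comm]
  simp only [map_mul]
  ring

theorem stronglyMeasurable_fourier_coeffKernel (hσ : Measurable σ) (hq : Measurable q)
    (f : L2Plane) :
    StronglyMeasurable (fun p : Plane × (ℝ × ℝ) => 𝓕 (coeffKernel ψ σ q f p.2) p.1) := by
  have h : StronglyMeasurable (fun p : (Plane × (ℝ × ℝ)) × Plane =>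
      (Real.fourierChar (-inner ℝ p.2 p.1.1) : ℂ) * coeffKernel ψ σ q f p.1.2 p.2) := by
    have h1 : Continuous (fun p : (Plane × (ℝ × ℝ)) × Plane =>
        (Real.fourierChar (-inner ℝ p.2 p.1.1) : ℂ)) :=
      continuous_subtype_val.comp <| Real.continuous_fourierChar.comp (continuous_snd.inner continuous_fst.fst).neg
    exact (h1.measurable.mul ((measurable_coeffKernel hσ hq f).comp
      (measurable_fst.snd.prodMk measurable_snd))).stronglyMeasurable
  simp only [Real.fourier_eq, Circle.smul_def, smul_eq_mul]
  exact h.integral_prod_right'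

theorem lintegral_coeffKernel (f : L2Plane) (ξ : Plane) :
    ∫⁻ z, ‖coeffKernel ψ σ q f z ξ‖ₑ ^ 2 ∂paramMeasure =
      ‖q ξ‖ₑ ^ 2 * ‖hat f ξ‖ₑ ^ 2 * lDelta ψ (σ ξ) := by
  rw [lDelta, ← lintegral_const_mul]
  · congr 1
    ext z
    rw [coeffKernel, enorm_mul, RCLike.enorm_conj, enorm_mul]
    ring
  · exact (((measurable_shearHat ψ).comp (measurable_id.prodMk measurable_const)).enorm.pow_const 2)

theorem lintegral_lintegral_coeffKernel_lt_top (hq1 : ∀ ξ, ‖q ξ‖ ≤ 1)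
    {C : ℝ≥0∞} (hC : C ≠ ⊤) (hΔ : ∀ᵐ ξ : Plane, lDelta ψ (σ ξ) ≤ C) (f : L2Plane) :
    ∫⁻ ξ, ∫⁻ z, ‖coeffKernel ψ σ q f z ξ‖ₑ ^ 2 ∂paramMeasure < ⊤ := by
  calc ∫⁻ ξ, ∫⁻ z, ‖coeffKernel ψ σ q f z ξ‖ₑ ^ 2 ∂paramMeasure
      ≤ ∫⁻ ξ, C * ‖hat f ξ‖ₑ ^ 2 := by
        apply lintegral_mono_ae
        filter_upwards [hΔ] with ξ h
        rw [lintegral_coeffKernel, mul_comm C]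
        refine mul_le_mul' ?_ h
        have : ‖q ξ‖ₑ ≤ 1 := by
          rw [← ofReal_norm]
          exact ENNReal.ofReal_le_one.2 (hq1 ξ)
        calc ‖q ξ‖ₑ ^ 2 * ‖hat f ξ‖ₑ ^ 2 ≤ 1 ^ 2 * ‖hat f ξ‖ₑ ^ 2 := by gcongr
          _ = _ := by simp
    _ = C * ‖hat f‖ₑ ^ 2 := by
        rw [lintegral_const_mul _ ((stronglyMeasurable_hat f).measurable.enorm.pow_const 2),
          lintegral_enorm_sq]
    _ < ⊤ := ENNReal.mul_lt_top hC.lt_top (ENNReal.pow_lt_top enorm_lt_top)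

theorem lintegral_coeffKernel_swap (hσ : Measurable σ) (hq : Measurable q) (f : L2Plane) :
    ∫⁻ z, (∫⁻ ξ, ‖coeffKernel ψ σ q f z ξ‖ₑ ^ 2) ∂paramMeasure =
      ∫⁻ ξ, ∫⁻ z, ‖coeffKernel ψ σ q f z ξ‖ₑ ^ 2 ∂paramMeasure :=
  lintegral_lintegral_swap ((measurable_coeffKernel hσ hq f).enorm.pow_const 2).aemeasurable

theorem ae_memLp_coeffKernel (hσ : Measurable σ) (hq : Measurable q) (hq1 : ∀ ξ, ‖q ξ‖ ≤ 1)
    {C : ℝ≥0∞} (hC : C ≠ ⊤) (hΔ : ∀ᵐ ξ : Plane, lDelta ψ (σ ξ) ≤ C) (f : L2Plane) :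
    ∀ᵐ z ∂paramMeasure, MemLp (coeffKernel ψ σ q f z) 2 volume := by
  have h := lintegral_lintegral_coeffKernel_lt_top hq1 hC hΔ f
  rw [← lintegral_coeffKernel_swap hσ hq] at h
  have hm : Measurable fun z => ∫⁻ ξ, ‖coeffKernel ψ σ q f z ξ‖ₑ ^ 2 :=
    ((measurable_coeffKernel hσ hq f).enorm.pow_const 2).lintegral_prod_right'
  filter_upwards [ae_lt_top hm h.ne] with z hz
  refine (memLp_two_iff_lintegral ?_).2 hz
  exact ((measurable_coeffKernel hσ hq f).comp
    (measurable_const.prodMk measurable_id)).aestronglyMeasurable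

theorem memLp_coeffKernel_prod (hσ : Measurable σ) (hq : Measurable q) (hq1 : ∀ ξ, ‖q ξ‖ ≤ 1)
    {C : ℝ≥0∞} (hC : C ≠ ⊤) (hΔ : ∀ᵐ ξ : Plane, lDelta ψ (σ ξ) ≤ C) (f : L2Plane) :
    MemLp (fun p : (ℝ × ℝ) × Plane => coeffKernel ψ σ q f p.1 p.2) 2
      (paramMeasure.prod volume) := by
  refine (memLp_two_iff_lintegral (measurable_coeffKernel hσ hq f).aestronglyMeasurable).2 ?_
  rw [lintegral_prod _ ((measurable_coeffKernel hσ hq f).enorm.pow_const 2).aemeasurable]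
  change ∫⁻ z, (∫⁻ ξ, ‖coeffKernel ψ σ q f z ξ‖ₑ ^ 2) ∂paramMeasure < ⊤
  rw [lintegral_coeffKernel_swap hσ hq]
  exact lintegral_lintegral_coeffKernel_lt_top hq1 hC hΔ f

/-- Tonelli puts the `t` integral inside, Plancherel replaces it by an integral over `ξ` for almost
every `(s, a)`, and a second exchange produces `|q|² |f̂|² Δ_ψ`, which the bound on `Δ_ψ` makes
integrable. -/
theorem memLp_fourier_coeffKernel (hsh : IsShearletFamily ψ σ sh) (hσ : Measurable σ)
    (hqb : MemLp q ∞ volume) (hq : Measurable q) (hq1 : ∀ ξ, ‖q ξ‖ ≤ 1)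
    {C : ℝ≥0∞} (hC : C ≠ ⊤) (hΔ : ∀ᵐ ξ : Plane, lDelta ψ (σ ξ) ≤ C) (f : L2Plane) :
    MemLp (fun p : Plane × (ℝ × ℝ) => 𝓕 (coeffKernel ψ σ q f p.2) p.1) 2 shearletMeasure := by
  have hm := stronglyMeasurable_fourier_coeffKernel (ψ := ψ) hσ hq f
  refine (memLp_two_iff_lintegral hm.aestronglyMeasurable).2 ?_
  rw [shearletMeasure_eq, lintegral_prod_symm _ (hm.measurable.enorm.pow_const 2).aemeasurable]
  have h : ∫⁻ z, (∫⁻ t, ‖𝓕 (coeffKernel ψ σ q f z) t‖ₑ ^ 2) ∂paramMeasure =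
      ∫⁻ z, (∫⁻ ξ, ‖coeffKernel ψ σ q f z ξ‖ₑ ^ 2) ∂paramMeasure := by
    apply lintegral_congr_ae
    filter_upwards [ae_paramMeasure_pos, ae_memLp_coeffKernel hσ hq hq1 hC hΔ f] with z hz h2
    exact norm_toLp_fourier (integrable_coeffKernel hsh hqb f hz) h2
  change ∫⁻ z, (∫⁻ t, ‖𝓕 (coeffKernel ψ σ q f z) t‖ₑ ^ 2) ∂paramMeasure < ⊤
  rw [h, lintegral_coeffKernel_swap hσ hq]
  exact lintegral_lintegral_coeffKernel_lt_top hq1 hC hΔ f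

theorem integral_coeffKernel_mul_conj {ξ : Plane} (f g : L2Plane) :
    ∫ z, coeffKernel ψ σ q f z ξ * conj (coeffKernel ψ σ q' g z ξ) ∂paramMeasure =
      conj (q ξ) * q' ξ * ((lDelta ψ (σ ξ)).toReal : ℂ) * (hat f ξ * conj (hat g ξ)) := by
  have h1 : ∀ z, coeffKernel ψ σ q f z ξ * conj (coeffKernel ψ σ q' g z ξ) =
      conj (q ξ) * q' ξ * (hat f ξ * conj (hat g ξ)) * ((‖shearHat ψ z (σ ξ)‖ ^ 2 : ℝ) : ℂ) := by
    intro z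
    rw [← Complex.normSq_eq_norm_sq, Complex.normSq_eq_conj_mul_self]
    simp only [coeffKernel, map_mul, Complex.conj_conj]
    ring
  simp_rw [h1]
  rw [integral_const_mul, integral_complex_ofReal, integral_eq_lintegral_of_nonneg_ae]
  · have : ∫⁻ z, ENNReal.ofReal (‖shearHat ψ z (σ ξ)‖ ^ 2) ∂paramMeasure = lDelta ψ (σ ξ) := by
      rw [lDelta]
      congr 1
      ext z
      rw [ENNReal.ofReal_pow (norm_nonneg _), ofReal_norm]
    rw [this]
    ring
  · exact Filter.Eventually.of_forall fun z => by positivity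
  · exact (((measurable_shearHat ψ).comp
      (measurable_id.prodMk measurable_const)).norm.pow_const 2).aestronglyMeasurable

/-- Polarized Plancherel in `t`, followed by Fubini. With `q = q'` and `f = g` it serves the frame
identity, with `q = 1` and `q' = p̂ᵢ` the reconstruction; the coordinate change `σ` covers both
cones at once. -/
theorem integral_shearlet_coeff (hsh : IsShearletFamily ψ σ sh) (hσ : Measurable σ)
    (hqb : MemLp q ∞ volume) (hq : Measurable q) (hq1 : ∀ ξ, ‖q ξ‖ ≤ 1)
    (hqb' : MemLp q' ∞ volume) (hq' : Measurable q') (hq1' : ∀ ξ, ‖q' ξ‖ ≤ 1)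
    {C : ℝ≥0∞} (hC : C ≠ ⊤) (hΔ : ∀ᵐ ξ : Plane, lDelta ψ (σ ξ) ≤ C) (f g : L2Plane) :
    Integrable (fun z : Plane × ℝ × ℝ => inner ℂ (multiplier hqb (sh z.2.2 z.2.1 z.1)) f *
      conj (inner ℂ (multiplier hqb' (sh z.2.2 z.2.1 z.1)) g)) shearletMeasure ∧
    ∫ z : Plane × ℝ × ℝ, inner ℂ (multiplier hqb (sh z.2.2 z.2.1 z.1)) f *
      conj (inner ℂ (multiplier hqb' (sh z.2.2 z.2.1 z.1)) g) ∂shearletMeasure =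
    ∫ ξ, conj (q ξ) * q' ξ * ((lDelta ψ (σ ξ)).toReal : ℂ) * (hat f ξ * conj (hat g ξ)) := by
  have hae : (fun p : Plane × ℝ × ℝ => 𝓕 (coeffKernel ψ σ q f p.2) p.1 *
      conj (𝓕 (coeffKernel ψ σ q' g p.2) p.1)) =ᵐ[shearletMeasure]
      fun z : Plane × ℝ × ℝ => inner ℂ (multiplier hqb (sh z.2.2 z.2.1 z.1)) f *
      conj (inner ℂ (multiplier hqb' (sh z.2.2 z.2.1 z.1)) g) := by
    filter_upwards [ae_shearletMeasure_pos] with p hp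
    rw [inner_multiplier_shearlet hsh hqb f hp, inner_multiplier_shearlet hsh hqb' g hp]
  have hint : Integrable (fun p : Plane × ℝ × ℝ => 𝓕 (coeffKernel ψ σ q f p.2) p.1 *
      conj (𝓕 (coeffKernel ψ σ q' g p.2) p.1)) shearletMeasure :=
    (memLp_fourier_coeffKernel hsh hσ hqb hq hq1 hC hΔ f).integrable_mul
      (memLp_fourier_coeffKernel hsh hσ hqb' hq' hq1' hC hΔ g).star
  refine ⟨hint.congr hae, ?_⟩
  rw [← integral_congr_ae hae, shearletMeasure_eq, integral_prod_symm (ν := paramMeasure) _ hint]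
  have h1 : ∫ z, (∫ t, 𝓕 (coeffKernel ψ σ q f z) t * conj (𝓕 (coeffKernel ψ σ q' g z) t))
      ∂paramMeasure = ∫ z, (∫ ξ, coeffKernel ψ σ q f z ξ * conj (coeffKernel ψ σ q' g z ξ))
      ∂paramMeasure := by
    apply integral_congr_ae
    filter_upwards [ae_paramMeasure_pos, ae_memLp_coeffKernel hσ hq hq1 hC hΔ f,
      ae_memLp_coeffKernel hσ hq' hq1' hC hΔ g] with z hz h2 h3
    exact integral_conj_fourier_mul_fourier (integrable_coeffKernel hsh hqb f hz) h2
      (integrable_coeffKernel hsh hqb' g hz) h3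
  rw [h1, integral_integral_swap]
  · congr 1
    ext ξ
    exact integral_coeffKernel_mul_conj f g
  · exact (memLp_coeffKernel_prod hσ hq hq1 hC hΔ f).integrable_mul
      (memLp_coeffKernel_prod hσ hq' hq1' hC hΔ g).star

end Kernel

/-! ### The change of variables behind the function `Δ_ψ` -/

theorem lintegral_comp_add_mul {f : ℝ → ℝ≥0∞} (hf : Measurable f) (b : ℝ) {c : ℝ} (hc : c ≠ 0) :
    ∫⁻ s, f (b + c * s) = ENNReal.ofReal |c|⁻¹ * ∫⁻ s, f s := by
  have h := lintegral_map (μ := volume) (f := fun u => f (b + u)) (g := fun s : ℝ => c * s)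
    (hf.comp (measurable_const_add b)) (measurable_const_mul c)
  rw [← h, Real.map_volume_mul_left hc, lintegral_smul_measure, lintegral_add_left_eq_self,
    abs_inv, smul_eq_mul]

theorem setLIntegral_comp_mul {f : ℝ → ℝ≥0∞} (hf : Measurable f) {c : ℝ} (hc : c ≠ 0)
    {S : Set ℝ} (hS : MeasurableSet S) :
    ∫⁻ a in {a | c * a ∈ S}, f (c * a) = ENNReal.ofReal |c|⁻¹ * ∫⁻ u in S, f u := by
  have h := lintegral_comp_add_mul (hf.indicator hS) 0 hc
  rw [lintegral_indicator hS] at h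
  have hS' : MeasurableSet {a | c * a ∈ S} := (measurable_const_mul c) hS
  rw [← h, ← lintegral_indicator hS']
  congr 1
  ext a
  rw [zero_add]
  rfl

theorem lintegral_plane {F : Plane → ℝ≥0∞} (hF : Measurable F) :
    ∫⁻ η, F η = ∫⁻ u : ℝ, ∫⁻ v : ℝ, F !₂[u, v] := by
  have hm : Measurable fun p : ℝ × ℝ => F !₂[p.1, p.2] := by
    refine hF.comp (Continuous.measurable ?_)
    refine (PiLp.continuous_toLp 2 _).comp (continuous_pi fun i => ?_)
    fin_cases i
    · exact continuous_fst
    · exact continuous_snd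
  have h1 := (EuclideanSpace.volume_preserving_symm_measurableEquiv_toLp (Fin 2))
  have h2 := (volume_preserving_finTwoArrow ℝ).comp h1
  have h3 := h2.lintegral_comp hm
  rw [Measure.volume_eq_prod, lintegral_prod _ hm.aemeasurable] at h3
  rw [← h3]
  congr 1
  ext η
  congr 1
  ext i
  fin_cases i <;> rfl

theorem measurable_vec_right (u : ℝ) : Measurable fun v : ℝ => (!₂[u, v] : Plane) := by
  refine Continuous.measurable ((PiLp.continuous_toLp 2 _).comp (continuous_pi fun i => ?_))
  fin_cases i
  · exact continuous_const
  · exact continuous_id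

theorem measurable_vec : Measurable fun p : ℝ × ℝ => (!₂[p.1, p.2] : Plane) := by
  refine Continuous.measurable ((PiLp.continuous_toLp 2 _).comp (continuous_pi fun i => ?_))
  fin_cases i
  · exact continuous_fst
  · exact continuous_snd

theorem measurable_coord (i : Fin 2) : Measurable fun η : Plane => η i :=
  (EuclideanSpace.proj (𝕜 := ℝ) i).continuous.measurable

theorem setLIntegral_plane {F : Plane → ℝ≥0∞} (hF : Measurable F) {S : Set ℝ}
    (hS : MeasurableSet S) :
    ∫⁻ η in {η : Plane | η 0 ∈ S}, F η = ∫⁻ u in S, ∫⁻ v : ℝ, F !₂[u, v] := by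
  have hS' : MeasurableSet {η : Plane | η 0 ∈ S} := measurable_coord 0 hS
  rw [← lintegral_indicator hS', lintegral_plane (hF.indicator hS'), ← lintegral_indicator hS]
  congr 1
  ext u
  by_cases hu : u ∈ S <;> simp [Set.indicator, hu]

theorem shear_eq (a s : ℝ) (ξ : Plane) :
    shear a s ξ = !₂[ξ 0 * a, √a * ξ 1 + (√a * ξ 0) * s] := by
  simp only [shear]
  congr 1
  simp
  constructor <;> ring

/-- The substitution `η = (aξ₁, √a(ξ₂ + sξ₁))` has Jacobian `√a ξ₁²`, and `a^{-3/2} / (√a ξ₁²) =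
η₁^{-2}`. The set `S` selects a range of scales: the half line for the full integral, `a > 1` for
the coarse scales. Its sign condition forces `a > 0`. -/
theorem lintegral_shear {F : Plane → ℝ≥0∞} (hF : Measurable F) {ξ : Plane} (hξ : ξ 0 ≠ 0)
    {S : Set ℝ} (hS : MeasurableSet S) (hpos : ∀ u ∈ S, 0 < u * ξ 0) :
    ∫⁻ a : ℝ in {a : ℝ | ξ 0 * a ∈ S}, ∫⁻ s, ENNReal.ofReal (a ^ (-(3 / 2 : ℝ))) * F (shear a s ξ) =
      ∫⁻ η in {η : Plane | η 0 ∈ S}, ENNReal.ofReal ((η 0 ^ 2)⁻¹) * F η := by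
  set H : ℝ → ℝ≥0∞ := fun u => ∫⁻ v : ℝ, F !₂[u, v] with hH
  have hHm : Measurable H := (hF.comp measurable_vec).lintegral_prod_right'
  have hKm : Measurable fun u : ℝ => ENNReal.ofReal ((u ^ 2)⁻¹) * H u :=
    ((measurable_id.pow_const 2).inv.ennreal_ofReal).mul hHm
  have hS' : MeasurableSet {a : ℝ | ξ 0 * a ∈ S} := measurable_const_mul (ξ 0) hS
  have h1 : ∀ a ∈ {a : ℝ | ξ 0 * a ∈ S},
      ∫⁻ s, ENNReal.ofReal (a ^ (-(3 / 2 : ℝ))) * F (shear a s ξ) =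
        ENNReal.ofReal |ξ 0| * (ENNReal.ofReal (((ξ 0 * a) ^ 2)⁻¹) * H (ξ 0 * a)) := by
    intro a ha
    have ha0 : 0 < a := by
      have := hpos _ ha
      have h2 : 0 < ξ 0 ^ 2 := by positivity
      nlinarith
    have hc : √a * ξ 0 ≠ 0 := mul_ne_zero (Real.sqrt_pos.2 ha0).ne' hξ
    have hv : Measurable fun v => F !₂[ξ 0 * a, v] := hF.comp (measurable_vec_right _)
    have h3 := lintegral_comp_add_mul hv (√a * ξ 1) hc
    simp only [shear_eq]
    have hcm : Measurable fun s => F !₂[ξ 0 * a, √a * ξ 1 + (√a * ξ 0) * s] :=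
      hv.comp ((measurable_const_mul _).const_add _)
    rw [lintegral_const_mul _ hcm, h3,
      ← mul_assoc, ← mul_assoc, ← ENNReal.ofReal_mul (by positivity),
      ← ENNReal.ofReal_mul (by positivity)]
    -- What remains is the identity `a^{-3/2} / (√a |ξ₁|) = |ξ₁| / (aξ₁)²`.
    congr 2
    rw [abs_mul, abs_of_pos (Real.sqrt_pos.2 ha0), Real.sqrt_eq_rpow, mul_inv,
      ← Real.rpow_neg ha0.le, ← mul_assoc, ← Real.rpow_add ha0, mul_pow, ← sq_abs (ξ 0),
      show (-(3 / 2) + -(1 / 2) : ℝ) = -2 by norm_num, Real.rpow_neg ha0.le]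
    have : |ξ 0| ≠ 0 := abs_ne_zero.2 hξ
    norm_cast
    field_simp
  have hcm : Measurable fun a : ℝ => ENNReal.ofReal (((ξ 0 * a) ^ 2)⁻¹) * H (ξ 0 * a) :=
    hKm.comp (measurable_const_mul _)
  have hFm : Measurable fun η : Plane => ENNReal.ofReal ((η 0 ^ 2)⁻¹) * F η :=
    ((measurable_coord 0).pow_const 2).inv.ennreal_ofReal.mul hF
  rw [setLIntegral_congr_fun hS' h1, lintegral_const_mul _ hcm,
    setLIntegral_comp_mul hKm hξ hS, ← mul_assoc, ← ENNReal.ofReal_mul (abs_nonneg _),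
    mul_inv_cancel₀ (abs_ne_zero.2 hξ), ENNReal.ofReal_one, one_mul,
    setLIntegral_plane hFm hS]
  congr 1
  ext u
  exact (lintegral_const_mul _
    (show Measurable fun v => F !₂[u, v] from hF.comp (measurable_vec_right u))).symm

/-- The half line of the numbers with the sign of `c`. -/
theorem setOf_mul_mem_halfLine {c : ℝ} (hc : c ≠ 0) :
    {a : ℝ | c * a ∈ {u : ℝ | 0 < u * c}} = Ioi 0 := by
  ext a
  have : 0 < c ^ 2 := by positivity
  simp only [mem_ofPred_eq, mem_Ioi]
  rw [show c * a * c = c ^ 2 * a by ring]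
  exact ⟨fun h => pos_of_mul_pos_right h this.le, fun h => mul_pos this h⟩

theorem measurableSet_halfLine (c : ℝ) : MeasurableSet {u : ℝ | 0 < u * c} :=
  measurableSet_lt measurable_const (measurable_id.mul_const c)

/-- Applying the change of variables to the indicator of a null set shows that `(a, s) ↦ shear a s
ξ` pulls null sets back to null sets. Bounds known almost everywhere for `ψ̂` can then be used under
the integral for each individual `ξ` off the axis. -/
theorem ae_ae_shear {P : Plane → Prop} (hP : ∀ᵐ η, P η) {ξ : Plane} (hξ : ξ 0 ≠ 0) :
    ∀ᵐ a ∂(volume.restrict (Ioi (0 : ℝ))), ∀ᵐ s : ℝ, P (shear a s ξ) := by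
  -- The exceptional set need not be measurable; a measurable hull of it is still null.
  set E := toMeasurable volume {η | ¬ P η} with hE
  have hEm : MeasurableSet E := measurableSet_toMeasurable _ _
  have hE0 : volume E = 0 := by rw [hE, measure_toMeasurable]; exact hP
  have hF : Measurable (E.indicator (fun _ => (1 : ℝ≥0∞))) := measurable_one.indicator hEm
  have h := lintegral_shear hF hξ (measurableSet_halfLine (ξ 0)) (fun u hu => hu)
  rw [setOf_mul_mem_halfLine hξ] at h
  have h0 : ∫⁻ η in {η : Plane | η 0 ∈ {u : ℝ | 0 < u * ξ 0}}, ENNReal.ofReal ((η 0 ^ 2)⁻¹) *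
      E.indicator (fun _ => (1 : ℝ≥0∞)) η = 0 := by
    rw [lintegral_eq_zero_iff' (by
      exact ((((measurable_coord 0).pow_const 2).inv.ennreal_ofReal).mul hF).aemeasurable)]
    apply ae_restrict_of_ae
    filter_upwards [measure_eq_zero_iff_ae_notMem.1 hE0] with η hη
    simp [hη]
  rw [h0] at h
  have hjm : Measurable fun p : ℝ × ℝ => ENNReal.ofReal (p.1 ^ (-(3 / 2 : ℝ))) *
      E.indicator (fun _ => (1 : ℝ≥0∞)) (shear p.1 p.2 ξ) := by
    refine (measurable_fst.pow_const _).ennreal_ofReal.mul (hF.comp ?_)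
    exact measurable_shear.comp (measurable_swap.prodMk measurable_const)
  rw [lintegral_eq_zero_iff hjm.lintegral_prod_right'] at h
  filter_upwards [h, ae_restrict_mem measurableSet_Ioi] with a ha ha0
  simp only [Pi.zero_apply] at ha
  have hjm' : Measurable fun s : ℝ => ENNReal.ofReal (a ^ (-(3 / 2 : ℝ))) *
      E.indicator (fun _ => (1 : ℝ≥0∞)) (shear a s ξ) := hjm.comp measurable_prodMk_left
  rw [lintegral_eq_zero_iff hjm'] at ha
  filter_upwards [ha] with s hs
  by_contra hn
  have hm : shear a s ξ ∈ E := subset_toMeasurable _ _ hn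
  have : 0 < a ^ (-(3 / 2 : ℝ)) := Real.rpow_pos_of_pos ha0 _
  simp [hm] at hs
  linarith

/-! ### The function `Δ_ψ` and its upper bound -/

/-- The integrand of `Δ_ψ`, with the opposite sign of `s`. -/
noncomputable def deltaIntegrand (ψ : L2Plane) (ξ : Plane) (a s : ℝ) : ℝ≥0∞ :=
  ENNReal.ofReal (a ^ (-(3 / 2 : ℝ))) * ‖hat ψ (shear a s ξ)‖ₑ ^ 2

theorem measurable_normSq_hat (ψ : L2Plane) : Measurable fun η => ‖hat ψ η‖ₑ ^ 2 :=
  (stronglyMeasurable_hat ψ).measurable.enorm.pow_const 2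

theorem measurable_deltaIntegrand (ψ : L2Plane) (ξ : Plane) :
    Measurable fun p : ℝ × ℝ => deltaIntegrand ψ ξ p.1 p.2 := by
  refine (measurable_fst.pow_const _).ennreal_ofReal.mul ((measurable_normSq_hat ψ).comp ?_)
  exact measurable_shear.comp (measurable_swap.prodMk measurable_const)

theorem lDelta_eq (ψ : L2Plane) (ξ : Plane) :
    lDelta ψ ξ = ∫⁻ s in Icc (-2 : ℝ) 2, ∫⁻ a in Ioc (0 : ℝ) 1, deltaIntegrand ψ ξ a s := by
  have hm : Measurable fun z : ℝ × ℝ => ‖shearHat ψ z ξ‖ₑ ^ 2 :=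
    ((measurable_shearHat ψ).comp (measurable_id.prodMk measurable_const)).enorm.pow_const 2
  have hw : Measurable fun a : ℝ => ENNReal.ofReal (a ^ (-3 : ℝ)) :=
    (measurable_id.pow_const _).ennreal_ofReal
  rw [lDelta, paramMeasure, lintegral_prod _ hm.aemeasurable]
  congr 1
  ext s
  rw [lintegral_withDensity_eq_lintegral_mul (g := fun a => ‖shearHat ψ (s, a) ξ‖ₑ ^ 2) _ hw
    (hm.comp measurable_prodMk_left)]
  apply setLIntegral_congr_fun measurableSet_Ioc
  intro a ha
  have ha0 : 0 < a := ha.1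
  simp only [Pi.mul_apply, shearHat, deltaIntegrand, enorm_mul, mul_pow]
  rw [← mul_assoc, ← ofReal_norm (((a ^ (3 / 4 : ℝ) : ℝ)) : ℂ), Complex.norm_real,
    Real.norm_of_nonneg (by positivity), ← ENNReal.ofReal_pow (by positivity),
    ← ENNReal.ofReal_mul (by positivity), ← Real.rpow_natCast, ← Real.rpow_mul ha0.le,
    ← Real.rpow_add ha0]
  norm_num

theorem lDelta_eq_swap (ψ : L2Plane) (ξ : Plane) :
    lDelta ψ ξ = ∫⁻ a in Ioc (0 : ℝ) 1, ∫⁻ s in Icc (-2 : ℝ) 2, deltaIntegrand ψ ξ a s := by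
  rw [lDelta_eq, lintegral_lintegral_swap]
  exact ((measurable_deltaIntegrand ψ ξ).comp measurable_swap).aemeasurable

/-- The reflection `s ↦ -s` reconciles the two sign conventions. Finiteness is needed because an
iterated Bochner integral takes the default value `0` where it diverges. -/
theorem shearletDelta_eq_toReal (ψ : L2Plane) {ξ : Plane} (hξ : lDelta ψ ξ ≠ ⊤) :
    shearletDelta ψ ξ = (lDelta ψ ξ).toReal := by
  have hm := measurable_deltaIntegrand ψ ξ
  have hflip : lDelta ψ ξ =
      ∫⁻ s in Icc (-2 : ℝ) 2, ∫⁻ a in Ioc (0 : ℝ) 1, deltaIntegrand ψ ξ a (-s) := by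
    rw [lDelta_eq, ← lintegral_indicator measurableSet_Icc,
      ← lintegral_indicator measurableSet_Icc, ← lintegral_neg_eq_self]
    congr 1
    ext s
    have : -s ∈ Icc (-2 : ℝ) 2 ↔ s ∈ Icc (-2 : ℝ) 2 := by
      simp only [mem_Icc]; constructor <;> rintro ⟨h1, h2⟩ <;> constructor <;> linarith
    by_cases hs : s ∈ Icc (-2 : ℝ) 2
    · rw [indicator_of_mem hs, indicator_of_mem (this.2 hs)]
    · rw [indicator_of_notMem hs, indicator_of_notMem (fun h => hs (this.1 h))]
  have hm' : Measurable fun s => ∫⁻ a in Ioc (0 : ℝ) 1, deltaIntegrand ψ ξ a (-s) :=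
    (hm.comp (measurable_snd.prodMk measurable_fst.neg)).lintegral_prod_right'
  have hin : ∀ s, ∫ a in Ioc (0 : ℝ) 1,
      ‖hat ψ !₂[a * ξ 0, √a * (ξ 1 - s * ξ 0)]‖ ^ 2 * a ^ (-(3 / 2 : ℝ)) =
      (∫⁻ a in Ioc (0 : ℝ) 1, deltaIntegrand ψ ξ a (-s)).toReal := by
    intro s
    have he : ∀ a : ℝ, (!₂[a * ξ 0, √a * (ξ 1 - s * ξ 0)] : Plane) = shear a (-s) ξ := by
      intro a; rw [shear]; congr 4; ring
    simp_rw [he]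
    rw [integral_eq_lintegral_of_nonneg_ae]
    · congr 1
      apply setLIntegral_congr_fun measurableSet_Ioc
      intro a ha
      simp only [deltaIntegrand]
      rw [ENNReal.ofReal_mul (by positivity), ENNReal.ofReal_pow (norm_nonneg _), ofReal_norm,
        mul_comm]
    · filter_upwards [ae_restrict_mem measurableSet_Ioc] with a ha
      have : 0 < a := ha.1
      simp only [Pi.zero_apply]
      positivity
    · refine ((((stronglyMeasurable_hat ψ).measurable.comp ?_).norm.pow_const 2).mul
        (measurable_id.pow_const _)).aestronglyMeasurable
      exact measurable_shear.comp
        ((measurable_const.prodMk measurable_id).prodMk measurable_const)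
  rw [shearletDelta]
  simp_rw [hin]
  rw [integral_toReal hm'.aemeasurable, ← hflip]
  exact ae_lt_top hm' (by rw [← hflip]; exact hξ)

/-- The weight `|ξ₁|^{-2}` is at most `|ξ₁|^{-2M}` where `|ξ₁| ≤ 1` and at most `1` elsewhere, so
the moment integral and the `L²` norm together dominate. -/
theorem integrable_admissible {M : ℕ} (hM : 1 ≤ M) {ψ : L2Plane} (h : HasVanishingMoments M ψ) :
    Integrable (fun ξ : Plane => ‖hat ψ ξ‖ ^ 2 / |ξ 0| ^ 2) volume := by
  have h2 : Integrable (fun ξ : Plane => ‖hat ψ ξ‖ ^ 2) volume :=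
    (memLp_two_iff_integrable_sq_norm (stronglyMeasurable_hat ψ).aestronglyMeasurable).1
      (Lp.memLp _)
  refine (h.add h2).mono' ?_ ?_
  · exact ((((stronglyMeasurable_hat ψ).measurable.norm.pow_const 2)).div
      ((measurable_coord 0).abs.pow_const 2)).aestronglyMeasurable
  · refine Filter.Eventually.of_forall fun ξ => ?_
    rw [Real.norm_of_nonneg (by positivity), Pi.add_apply]
    rcases le_total 1 |ξ 0| with h1 | h1
    · have : ‖hat ψ ξ‖ ^ 2 / |ξ 0| ^ 2 ≤ ‖hat ψ ξ‖ ^ 2 :=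
        div_le_self (by positivity) (one_le_pow₀ h1)
      have : 0 ≤ ‖hat ψ ξ‖ ^ 2 / |ξ 0| ^ (2 * M) := by positivity
      linarith
    · rcases (abs_nonneg (ξ 0)).eq_or_lt with h0 | h0
      -- On the line `ξ₁ = 0` the quotient has the default value `0` of division by zero.
      · rw [← h0]
        simp only [ne_eq, OfNat.ofNat_ne_zero, not_false_eq_true, zero_pow, div_zero]
        positivity
      · have : ‖hat ψ ξ‖ ^ 2 / |ξ 0| ^ 2 ≤ ‖hat ψ ξ‖ ^ 2 / |ξ 0| ^ (2 * M) := by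
          apply div_le_div_of_nonneg_left (by positivity) (by positivity)
          exact pow_le_pow_of_le_one (abs_nonneg _) h1 (by omega)
        have : 0 ≤ ‖hat ψ ξ‖ ^ 2 := by positivity
        linarith

theorem ofReal_setIntegral_admissible {ψ : L2Plane}
    (h : Integrable (fun ξ : Plane => ‖hat ψ ξ‖ ^ 2 / |ξ 0| ^ 2) volume) (S : Set Plane) :
    ENNReal.ofReal (∫ ξ in S, ‖hat ψ ξ‖ ^ 2 / |ξ 0| ^ 2) =
      ∫⁻ η in S, ENNReal.ofReal ((η 0 ^ 2)⁻¹) * ‖hat ψ η‖ₑ ^ 2 := by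
  rw [ofReal_integral_eq_lintegral_ofReal h.integrableOn
    (Filter.Eventually.of_forall fun ξ => by positivity)]
  congr 1
  ext η
  rw [div_eq_inv_mul, ENNReal.ofReal_mul (by positivity), ENNReal.ofReal_pow (norm_nonneg _),
    ofReal_norm, sq_abs]

/-- The integral of `deltaIntegrand` over all dilations and shears is `C_ψ`. -/
theorem lintegral_deltaIntegrand {ψ : L2Plane}
    (h : Integrable (fun ξ : Plane => ‖hat ψ ξ‖ ^ 2 / |ξ 0| ^ 2) volume)
    (hsymm : constPos ψ = constNeg ψ) {ξ : Plane} (hξ : ξ 0 ≠ 0) :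
    ∫⁻ a in Ioi (0 : ℝ), ∫⁻ s, deltaIntegrand ψ ξ a s = ENNReal.ofReal (constPos ψ) := by
  have h1 := lintegral_shear (measurable_normSq_hat ψ) hξ (measurableSet_halfLine (ξ 0))
    (fun u hu => hu)
  rw [setOf_mul_mem_halfLine hξ, ← ofReal_setIntegral_admissible h] at h1
  refine h1.trans ?_
  congr 1
  rcases hξ.lt_or_gt with h0 | h0
  · rw [hsymm, constNeg]
    congr 2
    ext η
    simp only [mem_ofPred_eq]
    exact ⟨fun hη => by by_contra hn; nlinarith, fun hη => mul_pos_of_neg_of_neg hη h0⟩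
  · rw [constPos]
    congr 2
    ext η
    simp only [mem_ofPred_eq]
    exact ⟨fun hη => pos_of_mul_pos_left hη h0.le, fun hη => mul_pos hη h0⟩

theorem lDelta_le {ψ : L2Plane}
    (h : Integrable (fun ξ : Plane => ‖hat ψ ξ‖ ^ 2 / |ξ 0| ^ 2) volume)
    (hsymm : constPos ψ = constNeg ψ) {ξ : Plane} (hξ : ξ 0 ≠ 0) :
    lDelta ψ ξ ≤ ENNReal.ofReal (constPos ψ) := by
  rw [← lintegral_deltaIntegrand h hsymm hξ, lDelta_eq_swap]
  calc _ ≤ ∫⁻ a in Ioc (0 : ℝ) 1, ∫⁻ s, deltaIntegrand ψ ξ a s :=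
        lintegral_mono fun a => setLIntegral_le_lintegral _ _
    _ ≤ _ := lintegral_mono_set Ioc_subset_Ioi_self

theorem constPos_nonneg (ψ : L2Plane) : 0 ≤ constPos ψ :=
  integral_nonneg fun _ => by positivity

/-- If the constant were zero, the symmetry hypothesis would make `ψ̂` vanish on both open half
planes, hence almost everywhere. -/
theorem constPos_pos {ψ : L2Plane} (hψ : ψ ≠ 0)
    (h : Integrable (fun ξ : Plane => ‖hat ψ ξ‖ ^ 2 / |ξ 0| ^ 2) volume)
    (hsymm : constPos ψ = constNeg ψ) (h0 : ∀ᵐ η : Plane, η 0 ≠ 0) : 0 < constPos ψ := by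
  refine (constPos_nonneg ψ).lt_of_ne fun hz => hψ ?_
  have hp : ∫ ξ in {ξ : Plane | 0 < ξ 0}, ‖hat ψ ξ‖ ^ 2 / |ξ 0| ^ 2 = 0 := hz.symm
  have hn : ∫ ξ in {ξ : Plane | ξ 0 < 0}, ‖hat ψ ξ‖ ^ 2 / |ξ 0| ^ 2 = 0 := (hz.trans hsymm).symm
  rw [integral_eq_zero_iff_of_nonneg (fun _ => by positivity) h.integrableOn] at hp hn
  have hp' := ae_imp_of_ae_restrict hp
  have hn' := ae_imp_of_ae_restrict hn
  apply hat_injective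
  apply Lp.ext
  have hz0 : hat (0 : L2Plane) = 0 := (FourierTransform.fourierInvCLM ℂ L2Plane).map_zero
  rw [hz0]
  filter_upwards [hp', hn', h0, Lp.coeFn_zero ℂ 2 (volume : Measure Plane)] with η h1 h2 h3 h4
  rw [h4]
  have : ‖hat ψ η‖ ^ 2 / |η 0| ^ 2 = 0 := by
    rcases h3.lt_or_gt with h | h
    · exact h2 h
    · exact h1 h
  simpa [h3] using this

theorem ae_coord_ne_zero (i : Fin 2) : ∀ᵐ η : Plane, η i ≠ 0 := by
  have h : (LinearMap.ker (EuclideanSpace.proj (𝕜 := ℝ) i : Plane →L[ℝ] ℝ).toLinearMap) ≠ ⊤ := by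
    intro h
    have : (EuclideanSpace.single i 1 : Plane) ∈
      LinearMap.ker (EuclideanSpace.proj (𝕜 := ℝ) i : Plane →L[ℝ] ℝ).toLinearMap := by
        rw [h]; trivial
    simp at this
  have h2 := Measure.addHaar_submodule (volume : Measure Plane) _ h
  exact measure_eq_zero_iff_ae_notMem.1 h2

/-! ### Vanishing moments -/

/-- Each derivative becomes multiplication by `-2πi ξ₁`, moved onto the test function. Only the
pointwise values of the new test function are recorded, since those suffice to compare integrals. -/
theorem fourierInv_iteratedPartial (M : ℕ) (T : 𝓢'(Plane, ℂ)) (u : 𝓢(Plane, ℂ)) :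
    ∃ v : 𝓢(Plane, ℂ), (∀ ξ, v ξ = (-(2 * Real.pi * Complex.I) * ξ 0) ^ M * u ξ) ∧
      𝓕⁻ (∂^{fun _ : Fin M => (EuclideanSpace.single 0 1 : Plane)} T) u = 𝓕⁻ T v := by
  induction M generalizing u with
  | zero => exact ⟨u, by simp, by simp⟩
  | succ M ih =>
    rw [LineDeriv.iteratedLineDerivOp_succ_left]
    set S := ∂^{fun _ : Fin M => (EuclideanSpace.single 0 1 : Plane)} T with hS
    have hg : Function.HasTemperateGrowth (fun x : Plane =>
        ((inner ℝ x (EuclideanSpace.single 0 1 : Plane) : ℝ) : ℂ)) := by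
      fun_prop
    obtain ⟨v, hv, hv'⟩ := ih (-(2 * Real.pi * Complex.I) •
      SchwartzMap.smulLeftCLM ℂ (fun x : Plane =>
        ((inner ℝ x (EuclideanSpace.single 0 1 : Plane) : ℝ) : ℂ)) u)
    refine ⟨v, fun ξ => ?_, ?_⟩
    · rw [hv, smul_apply, SchwartzMap.smulLeftCLM_apply_apply hg]
      simp [plane_inner]
      ring
    · rw [← hv']
      change 𝓕⁻ (∂_{(EuclideanSpace.single 0 1 : Plane)} S) u = _
      rw [TemperedDistribution.fourierInv_lineDerivOp_eq]
      simp only [map_smul, smul_apply]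
      rfl

theorem hat_eq_of_isIteratedPartial {M : ℕ} {θ ψ : L2Plane} (h : IsIteratedPartial M θ ψ) :
    hat ψ =ᵐ[volume] fun ξ => (-(2 * Real.pi * Complex.I) * ξ 0) ^ M * hat θ ξ := by
  have hc : Continuous fun ξ : Plane => (-(2 * Real.pi * Complex.I) * (ξ 0 : ℂ)) ^ M := by
    have : Continuous fun ξ : Plane => ξ 0 := (EuclideanSpace.proj (𝕜 := ℝ) 0).continuous
    fun_prop
  apply ae_eq_of_integral_schwartz_mul (L2Plane.locallyIntegrable _)
  · exact (L2Plane.locallyIntegrable (hat θ)).continuous_mul hc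
  intro u
  obtain ⟨v, hv, hv'⟩ := fourierInv_iteratedPartial M (Lp.toTemperedDistribution θ) u
  rw [← h, Lp.fourierInv_toTemperedDistribution_eq, Lp.fourierInv_toTemperedDistribution_eq,
    Lp.toTemperedDistribution_apply, Lp.toTemperedDistribution_apply] at hv'
  refine hv'.trans ?_
  congr 1
  ext ξ
  rw [hv, smul_eq_mul, hat]
  ring

theorem norm_hat_le_of_isIteratedPartial {M : ℕ} {θ ψ : L2Plane} {L : ℝ}
    (h : IsIteratedPartial M θ ψ) (hL : ∃ K : ℝ, ∀ᵐ ξ : Plane, ‖hat θ ξ‖ ≤ K * |ξ 1| ^ (-L)) :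
    ∃ K : ℝ, 0 ≤ K ∧ ∀ᵐ ξ : Plane, ‖hat ψ ξ‖ ≤ K * |ξ 0| ^ M * |ξ 1| ^ (-L) := by
  obtain ⟨K, hK⟩ := hL
  refine ⟨(2 * Real.pi) ^ M * |K|, by positivity, ?_⟩
  filter_upwards [hK, hat_eq_of_isIteratedPartial h] with ξ h1 h2
  rw [h2, norm_mul, norm_pow, norm_mul, norm_neg, norm_mul, norm_mul, Complex.norm_I,
    Complex.norm_real, Complex.norm_real, Real.norm_eq_abs, Real.norm_eq_abs,
    abs_of_pos Real.pi_pos, Complex.norm_ofNat, mul_one, mul_pow]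
  have h3 : ‖hat θ ξ‖ ≤ |K| * |ξ 1| ^ (-L) :=
    h1.trans (mul_le_mul_of_nonneg_right (le_abs_self K) (by positivity))
  calc _ ≤ (2 * Real.pi) ^ M * |ξ 0| ^ M * (|K| * |ξ 1| ^ (-L)) := by gcongr
    _ = _ := by ring

/-! ### Decay of `C_ψ - Δ_ψ` -/

theorem lintegral_abs_rpow_tail_le {p c : ℝ} (hp : 1 < p) (hc : 0 < c) :
    ∫⁻ v in {v : ℝ | c < |v|}, ENNReal.ofReal (|v| ^ (-p)) ≤
      ENNReal.ofReal (2 * c ^ (1 - p) / (p - 1)) := by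
  have h1 : ∫⁻ v in Ioi c, ENNReal.ofReal (|v| ^ (-p)) =
      ENNReal.ofReal (c ^ (1 - p) / (p - 1)) := by
    have e : ∫⁻ v in Ioi c, ENNReal.ofReal (|v| ^ (-p)) =
        ∫⁻ v in Ioi c, ENNReal.ofReal (v ^ (-p)) := by
      apply setLIntegral_congr_fun measurableSet_Ioi
      intro v hv
      simp only
      rw [abs_of_pos (hc.trans hv)]
    rw [e, ← ofReal_integral_eq_lintegral_ofReal (integrableOn_Ioi_rpow_of_lt (by linarith) hc),
      integral_Ioi_rpow_of_lt (by linarith) hc]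
    · congr 1
      rw [show -p + 1 = -(p - 1) by ring, neg_div_neg_eq, neg_sub]
    · filter_upwards [ae_restrict_mem measurableSet_Ioi] with v hv
      exact Real.rpow_nonneg (hc.trans hv).le _
  have h2 : ∫⁻ v in Iio (-c), ENNReal.ofReal (|v| ^ (-p)) =
      ∫⁻ v in Ioi c, ENNReal.ofReal (|v| ^ (-p)) := by
    rw [← lintegral_indicator measurableSet_Iio, ← lintegral_indicator measurableSet_Ioi,
      ← lintegral_neg_eq_self]
    congr 1
    ext v
    simp only [indicator, mem_Iio, mem_Ioi, neg_lt_neg_iff, abs_neg]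
  have hs : {v : ℝ | c < |v|} = Ioi c ∪ Iio (-c) := by
    ext v
    simp only [mem_ofPred_eq, mem_union, mem_Ioi, mem_Iio, lt_abs, lt_neg]
  rw [hs]
  refine (lintegral_union_le _ _ _).trans ?_
  have : 0 < p - 1 := by linarith
  rw [h2, h1, ← ENNReal.ofReal_add (by positivity) (by positivity)]
  apply le_of_eq
  congr 1
  ring

/-- Inserting the lower bound for `w` separates the variables: powers of `r`, `a` and `s` factor, so
that the double integral over scales and steep shears becomes a product. -/
theorem shear_bound {a r s w K L : ℝ} {M : ℕ} (ha : 0 < a) (hr : 0 < r) (hs : 0 < |s|)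
    (hL : 0 ≤ L) (hw : |s| * r / 4 ≤ w) (hK : 0 ≤ K) :
    a ^ (-(3 / 2 : ℝ)) * (K * (a * r) ^ M * (√a * w) ^ (-L)) ^ 2 ≤
      (K ^ 2 * (4 : ℝ) ^ (2 * L) * r ^ (2 * M - 2 * L)) *
        (a ^ (2 * M - L - 3 / 2) * |s| ^ (-(2 * L))) := by
  have h1 : (√a * w) ^ (-L) ≤ (√a * (|s| * r / 4)) ^ (-L) :=
    Real.rpow_le_rpow_of_nonpos (by positivity) (by gcongr) (by linarith)
  have h0 : 0 ≤ w := le_trans (by positivity) hw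
  calc a ^ (-(3 / 2 : ℝ)) * (K * (a * r) ^ M * (√a * w) ^ (-L)) ^ 2
      ≤ a ^ (-(3 / 2 : ℝ)) * (K * (a * r) ^ M * (√a * (|s| * r / 4)) ^ (-L)) ^ 2 := by
        gcongr
    _ = _ := by
        have e1 : ((√a * (|s| * r / 4)) ^ (-L)) ^ 2 =
            a ^ (-L) * (|s| ^ (-(2 * L)) * r ^ (-(2 * L)) * (4 : ℝ) ^ (2 * L)) := by
          rw [← Real.rpow_natCast, ← Real.rpow_mul (by positivity),
            Real.mul_rpow (by positivity) (by positivity),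
            Real.div_rpow (by positivity) (by positivity),
            Real.mul_rpow (by positivity) (by positivity), Real.sqrt_eq_rpow,
            ← Real.rpow_mul ha.le]
          have e2 : -L * ((2 : ℕ) : ℝ) = -(2 * L) := by push_cast; ring
          rw [e2, Real.rpow_neg (by norm_num : (0 : ℝ) ≤ 4), div_inv_eq_mul]
          congr 2
          ring
        have e3 : ((a * r) ^ M) ^ 2 = a ^ (2 * M : ℝ) * r ^ (2 * M : ℝ) := by
          rw [← Real.mul_rpow ha.le hr.le, ← pow_mul, ← Real.rpow_natCast]
          congr 1
          push_cast
          ring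
        rw [mul_pow, mul_pow, e1, e3, show (2 * M - 2 * L : ℝ) = 2 * M + -(2 * L) by ring,
          Real.rpow_add hr, show (2 * M - L - 3 / 2 : ℝ) = -(3 / 2) + 2 * M + -L by ring,
          Real.rpow_add ha, Real.rpow_add ha]
        ring

/-- The parameter domain `a > 0`, `s ∈ ℝ` of the full integral is covered by the domain of `Δ_ψ`,
the steep shears at fine scales, and the coarse scales `a > 1`; the last are rewritten in the
variable `η` and enlarged to both signs of `η₁`. -/
theorem ofReal_constPos_le {ψ : L2Plane}
    (h : Integrable (fun ξ : Plane => ‖hat ψ ξ‖ ^ 2 / |ξ 0| ^ 2) volume)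
    (hsymm : constPos ψ = constNeg ψ) {ξ : Plane} (hξ : ξ 0 ≠ 0) :
    ENNReal.ofReal (constPos ψ) ≤ lDelta ψ ξ +
      ((∫⁻ a in Ioc (0 : ℝ) 1, ∫⁻ s in {s : ℝ | 2 < |s|}, deltaIntegrand ψ ξ a s) +
        ∫⁻ η in {η : Plane | |ξ 0| < |η 0|},
          ENNReal.ofReal ((η 0 ^ 2)⁻¹) * ‖hat ψ η‖ₑ ^ 2) := by
  rw [← lintegral_deltaIntegrand h hsymm hξ, ← Ioc_union_Ioi_eq_Ioi zero_le_one, ← add_assoc]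
  refine (lintegral_union_le _ _ _).trans (add_le_add ?_ ?_)
  · rw [lDelta_eq_swap, ← lintegral_add_left]
    · apply lintegral_mono
      intro a
      have hu : (univ : Set ℝ) = Icc (-2) 2 ∪ {s : ℝ | 2 < |s|} := by
        ext s
        simp only [mem_univ, mem_union, mem_Icc, mem_ofPred_eq, true_iff, ← abs_le]
        exact le_or_gt _ _
      simp only
      rw [← setLIntegral_univ, hu]
      exact lintegral_union_le _ _ _
    · exact (measurable_deltaIntegrand ψ ξ).lintegral_prod_right'
  · have hS : MeasurableSet {u : ℝ | ξ 0 ^ 2 < u * ξ 0} :=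
      measurableSet_lt measurable_const (measurable_id.mul_const _)
    have h2 : 0 < ξ 0 ^ 2 := by positivity
    have h1 := lintegral_shear (measurable_normSq_hat ψ) hξ hS (fun u hu => h2.trans hu)
    have e : {a : ℝ | ξ 0 * a ∈ {u : ℝ | ξ 0 ^ 2 < u * ξ 0}} = Ioi 1 := by
      ext a
      simp only [mem_ofPred_eq, mem_Ioi]
      rw [show ξ 0 * a * ξ 0 = ξ 0 ^ 2 * a by ring]
      exact lt_mul_iff_one_lt_right h2
    rw [e] at h1
    refine h1.le.trans (lintegral_mono_set ?_)
    intro η hη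
    simp only [mem_ofPred_eq] at hη ⊢
    rw [← sq_lt_sq]
    nlinarith [sq_nonneg (η 0 - ξ 0)]

theorem lintegral_steep_le {ψ : L2Plane} {M : ℕ} {K L : ℝ} (hK : 0 ≤ K) (hML : (M : ℝ) < L)
    (hM : 1 ≤ M)
    (hψ : ∀ᵐ ξ : Plane, ‖hat ψ ξ‖ ≤ K * |ξ 0| ^ M * |ξ 1| ^ (-L)) {ξ : Plane}
    (hξ : ξ 0 ≠ 0) (hξ' : |ξ 1| ≤ 3 / 2 * |ξ 0|) :
    ∫⁻ a in Ioc (0 : ℝ) 1, ∫⁻ s in {s : ℝ | 2 < |s|}, deltaIntegrand ψ ξ a s ≤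
      ENNReal.ofReal (K ^ 2 * (4 : ℝ) ^ (2 * L) * |ξ 0| ^ (2 * M - 2 * L)) *
        ((∫⁻ a in Ioc (0 : ℝ) 1, ENNReal.ofReal (a ^ (2 * M - L - 3 / 2))) *
          ∫⁻ s in {s : ℝ | 2 < |s|}, ENNReal.ofReal (|s| ^ (-(2 * L)))) := by
  have hr : 0 < |ξ 0| := abs_pos.2 hξ
  have hM' : (1 : ℝ) ≤ M := by exact_mod_cast hM
  have hm1 : Measurable fun a : ℝ => ENNReal.ofReal (a ^ (2 * M - L - 3 / 2)) :=
    (measurable_id.pow_const _).ennreal_ofReal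
  have hm2 : Measurable fun s : ℝ => ENNReal.ofReal (|s| ^ (-(2 * L))) :=
    (measurable_id.abs.pow_const _).ennreal_ofReal
  rw [← lintegral_mul_const _ hm1, ← lintegral_const_mul _ (hm1.mul_const _)]
  apply lintegral_mono_ae
  have hae := ae_ae_shear hψ hξ
  filter_upwards [ae_mono (Measure.restrict_mono Ioc_subset_Ioi_self le_rfl) hae,
    ae_restrict_mem measurableSet_Ioc] with a ha ha0
  have ha0 : 0 < a := ha0.1
  rw [← lintegral_const_mul _ hm2, ← lintegral_const_mul _ (hm2.const_mul _)]
  apply setLIntegral_mono_ae ((hm2.const_mul _).const_mul _).aemeasurable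
  filter_upwards [ha] with s hs hs2
  have hs2 : 2 < |s| := hs2
  -- Since `|ξ₂| ≤ (3/2)|ξ₁|` and `|s| > 2`, one has `|s| - 3/2 ≥ |s| / 4`. Any slope strictly
  -- between `1` and `2` could replace `3/2`, with other constants.
  have hw : |s| * |ξ 0| / 4 ≤ |ξ 1 + s * ξ 0| := by
    have h1 : |s * ξ 0| - |ξ 1| ≤ |ξ 1 + s * ξ 0| := by
      have := abs_sub_abs_le_abs_sub (s * ξ 0) (-ξ 1)
      rw [abs_neg, sub_neg_eq_add, add_comm (s * ξ 0)] at this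
      exact this
    rw [abs_mul] at h1
    nlinarith
  have h1 := shear_bound (M := M) ha0 hr (by linarith : 0 < |s|) (by linarith : 0 ≤ L) hw hK
  rw [← ENNReal.ofReal_mul (by positivity), ← ENNReal.ofReal_mul (by positivity)]
  refine le_trans ?_ (ENNReal.ofReal_le_ofReal h1)
  rw [deltaIntegrand, ENNReal.ofReal_mul (by positivity), ENNReal.ofReal_pow (by positivity)]
  gcongr
  rw [← ofReal_norm]
  apply ENNReal.ofReal_le_ofReal
  refine hs.trans (le_of_eq ?_)
  simp [shear, abs_mul, abs_of_pos ha0, abs_of_nonneg (Real.sqrt_nonneg a)]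

/-- The assumption `L₂ < 2M - 1/2` says exactly that `2M - L₂ - 3/2 > -1`, the condition for
integrability at `a = 0`. The shear integral converges since `2 L₂ > 1`. -/
theorem lintegral_steep_const_ne_top {M : ℕ} {L : ℝ} (hM : 1 ≤ M) (hML : (M : ℝ) < L)
    (hLM : L < 2 * (M : ℝ) - 1 / 2) :
    ((∫⁻ a in Ioc (0 : ℝ) 1, ENNReal.ofReal (a ^ (2 * M - L - 3 / 2))) *
      ∫⁻ s in {s : ℝ | 2 < |s|}, ENNReal.ofReal (|s| ^ (-(2 * L)))) ≠ ⊤ := by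
  have hM' : (1 : ℝ) ≤ M := by exact_mod_cast hM
  apply ENNReal.mul_ne_top
  · have h := (intervalIntegral.intervalIntegrable_rpow' (a := 0) (b := 1)
      (r := 2 * M - L - 3 / 2) (by linarith)).1
    rw [← ofReal_integral_eq_lintegral_ofReal h]
    · exact ENNReal.ofReal_ne_top
    · filter_upwards [ae_restrict_mem measurableSet_Ioc] with a ha
      exact Real.rpow_nonneg ha.1.le _
  · exact ne_top_of_le_ne_top ENNReal.ofReal_ne_top
      (lintegral_abs_rpow_tail_le (by linarith) two_pos)

/-- Neither bound for `ψ̂` suffices alone on a vertical line: the one in `ξ₁` is not integrable in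
`v`, the one in `ξ₂` is singular at `v = 0`. Switching at `|v| = |u|` makes both pieces of order
`|u|^{1-2L}`. -/
theorem lintegral_vertical_le {M : ℕ} {L L' u : ℝ} (hM : 1 ≤ M) (hL' : (M : ℝ) + L ≤ L')
    (hL : 0 < L) (hu : 1 ≤ |u|) :
    ∫⁻ v : ℝ, (if |v| ≤ |u| then ENNReal.ofReal (|u| ^ (-(2 * L)))
      else ENNReal.ofReal (|u| ^ (2 * M : ℝ)) * ENNReal.ofReal (|v| ^ (-(2 * L')))) ≤
      ENNReal.ofReal (4 * |u| ^ (1 - 2 * L)) := by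
  have hu0 : 0 < |u| := by linarith
  have hM' : (1 : ℝ) ≤ M := by exact_mod_cast hM
  have hS : MeasurableSet {v : ℝ | |v| ≤ |u|} := measurableSet_le measurable_id.abs measurable_const
  have hm2 : Measurable fun s : ℝ => ENNReal.ofReal (|s| ^ (-(2 * L'))) :=
    (measurable_id.abs.pow_const _).ennreal_ofReal
  rw [← lintegral_add_compl _ hS]
  have h1 : ∫⁻ v in {v : ℝ | |v| ≤ |u|}, (if |v| ≤ |u| then ENNReal.ofReal (|u| ^ (-(2 * L)))
      else ENNReal.ofReal (|u| ^ (2 * M : ℝ)) * ENNReal.ofReal (|v| ^ (-(2 * L')))) =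
      ENNReal.ofReal (2 * |u| ^ (1 - 2 * L)) := by
    refine (setLIntegral_congr_fun (g := fun _ => ENNReal.ofReal (|u| ^ (-(2 * L)))) hS
      (fun v hv => if_pos hv)).trans ?_
    rw [setLIntegral_const]
    have : {v : ℝ | |v| ≤ |u|} = Icc (-|u|) |u| := by ext v; simp [abs_le]
    rw [this, Real.volume_Icc, ← ENNReal.ofReal_mul (by positivity)]
    congr 1
    rw [show 1 - 2 * L = -(2 * L) + 1 by ring, Real.rpow_add_one hu0.ne']
    ring
  have h2 : ∫⁻ v in {v : ℝ | |v| ≤ |u|}ᶜ, (if |v| ≤ |u| then ENNReal.ofReal (|u| ^ (-(2 * L)))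
      else ENNReal.ofReal (|u| ^ (2 * M : ℝ)) * ENNReal.ofReal (|v| ^ (-(2 * L')))) ≤
      ENNReal.ofReal (2 * |u| ^ (1 - 2 * L)) := by
    refine (setLIntegral_congr_fun (g := fun v => ENNReal.ofReal (|u| ^ (2 * M : ℝ)) *
      ENNReal.ofReal (|v| ^ (-(2 * L')))) hS.compl (fun v hv => if_neg hv)).trans_le ?_
    rw [lintegral_const_mul _ hm2]
    have : {v : ℝ | |v| ≤ |u|}ᶜ = {v : ℝ | |u| < |v|} := by ext v; simp
    rw [this]
    calc _ ≤ ENNReal.ofReal (|u| ^ (2 * M : ℝ)) *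
          ENNReal.ofReal (2 * |u| ^ (1 - 2 * L') / (2 * L' - 1)) := by
          gcongr
          exact lintegral_abs_rpow_tail_le (by linarith) hu0
      _ ≤ _ := by
          rw [← ENNReal.ofReal_mul (by positivity)]
          apply ENNReal.ofReal_le_ofReal
          have e1 : 2 * |u| ^ (1 - 2 * L') / (2 * L' - 1) ≤ 2 * |u| ^ (1 - 2 * L') :=
            div_le_self (by positivity) (by linarith)
          calc _ ≤ |u| ^ (2 * M : ℝ) * (2 * |u| ^ (1 - 2 * L')) := by gcongr
            _ = 2 * |u| ^ (2 * M + (1 - 2 * L')) := by rw [Real.rpow_add hu0]; ring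
            -- The exponents compare because `M + L ≤ L'`, and `|u| ≥ 1` makes powers monotone in
            -- the exponent.
            _ ≤ _ := by
              have := Real.rpow_le_rpow_of_exponent_le hu
                (by linarith : 2 * M + (1 - 2 * L') ≤ 1 - 2 * L)
              linarith
  refine (add_le_add h1.le h2).trans ?_
  rw [← ENNReal.ofReal_add (by positivity) (by positivity)]
  apply ENNReal.ofReal_le_ofReal
  linarith

/-- The vertical integrals contribute `|u|^{1-2L}`, the weight `u^{-2}`; the remaining tail integral
of `|u|^{-2L-1}` is of order `r^{-2L} / L`, which is where `L > 0` enters. -/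
theorem lintegral_coarse_le {ψ : L2Plane} {M : ℕ} {K L L' r : ℝ} (hM : 1 ≤ M)
    (hL' : (M : ℝ) + L ≤ L') (hL : 0 < L) (hr : 1 ≤ r)
    (h : ∀ᵐ η : Plane, r < |η 0| → ‖hat ψ η‖ ≤ K * |η 0| ^ (-L))
    (h' : ∀ᵐ η : Plane, ‖hat ψ η‖ ≤ K * |η 0| ^ M * |η 1| ^ (-L')) :
    ∫⁻ η in {η : Plane | r < |η 0|}, ENNReal.ofReal ((η 0 ^ 2)⁻¹) * ‖hat ψ η‖ₑ ^ 2 ≤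
      ENNReal.ofReal (K ^ 2 * 4 * (r ^ (-(2 * L)) / L)) := by
  set B : Plane → ℝ≥0∞ := fun η => ENNReal.ofReal (K ^ 2) * (ENNReal.ofReal ((η 0 ^ 2)⁻¹) *
    (if |η 1| ≤ |η 0| then ENNReal.ofReal (|η 0| ^ (-(2 * L)))
      else ENNReal.ofReal (|η 0| ^ (2 * M : ℝ)) * ENNReal.ofReal (|η 1| ^ (-(2 * L'))))) with hB
  have hBm : Measurable B := by
    have m0 := measurable_coord 0
    have m1 := measurable_coord 1
    refine Measurable.const_mul (Measurable.mul (m0.pow_const 2).inv.ennreal_ofReal ?_) _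
    refine Measurable.ite (measurableSet_le m1.abs m0.abs)
      (m0.abs.pow_const _).ennreal_ofReal ?_
    exact (m0.abs.pow_const _).ennreal_ofReal.mul (m1.abs.pow_const _).ennreal_ofReal
  have hS : MeasurableSet {u : ℝ | r < |u|} := measurableSet_lt measurable_const measurable_id.abs
  have hm2 : Measurable fun u : ℝ => ENNReal.ofReal (|u| ^ (-(2 * L + 1))) :=
    (measurable_id.abs.pow_const _).ennreal_ofReal
  calc ∫⁻ η in {η : Plane | r < |η 0|}, ENNReal.ofReal ((η 0 ^ 2)⁻¹) * ‖hat ψ η‖ₑ ^ 2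
      ≤ ∫⁻ η in {η : Plane | η 0 ∈ {u : ℝ | r < |u|}}, B η := by
        apply setLIntegral_mono_ae hBm.aemeasurable
        filter_upwards [h, h'] with η h1 h2 hη
        have hη : r < |η 0| := hη
        simp only [hB]
        rw [mul_left_comm]
        gcongr
        rw [← ofReal_norm, ← ENNReal.ofReal_pow (norm_nonneg _)]
        split_ifs with hc
        · rw [← ENNReal.ofReal_mul (by positivity)]
          apply ENNReal.ofReal_le_ofReal
          calc ‖hat ψ η‖ ^ 2 ≤ (K * |η 0| ^ (-L)) ^ 2 := by gcongr; exact h1 hη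
            _ = _ := by
              rw [mul_pow, ← Real.rpow_natCast (_ ^ (-L)), ← Real.rpow_mul (abs_nonneg _)]
              congr 2
              push_cast
              ring
        · rw [← ENNReal.ofReal_mul (by positivity), ← ENNReal.ofReal_mul (by positivity)]
          apply ENNReal.ofReal_le_ofReal
          calc ‖hat ψ η‖ ^ 2 ≤ (K * |η 0| ^ M * |η 1| ^ (-L')) ^ 2 := by gcongr
            _ = _ := by
              rw [mul_pow, mul_pow, ← Real.rpow_natCast (_ ^ (-L')),
                ← Real.rpow_mul (abs_nonneg _), ← pow_mul, ← Real.rpow_natCast |η 0|, mul_assoc]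
              congr 3
              · push_cast; ring
              · push_cast; ring
    _ = ∫⁻ u in {u : ℝ | r < |u|}, ∫⁻ v : ℝ, B !₂[u, v] := setLIntegral_plane hBm hS
    _ ≤ ∫⁻ u in {u : ℝ | r < |u|},
          ENNReal.ofReal (K ^ 2 * 4) * ENNReal.ofReal (|u| ^ (-(2 * L + 1))) := by
        apply setLIntegral_mono (hm2.const_mul _)
        intro u hu
        have hu : r < |u| := hu
        have hu0 : 0 < |u| := by linarith
        have hm3 : Measurable fun v : ℝ => (if |v| ≤ |u| then ENNReal.ofReal (|u| ^ (-(2 * L)))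
            else ENNReal.ofReal (|u| ^ (2 * M : ℝ)) * ENNReal.ofReal (|v| ^ (-(2 * L')))) :=
          Measurable.ite (measurableSet_le measurable_id.abs measurable_const) measurable_const
            ((measurable_id.abs.pow_const _).ennreal_ofReal.const_mul _)
        have e : ∀ v : ℝ, B !₂[u, v] = ENNReal.ofReal (K ^ 2) * (ENNReal.ofReal ((u ^ 2)⁻¹) *
            (if |v| ≤ |u| then ENNReal.ofReal (|u| ^ (-(2 * L)))
            else ENNReal.ofReal (|u| ^ (2 * M : ℝ)) * ENNReal.ofReal (|v| ^ (-(2 * L'))))) :=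
          fun v => rfl
        simp_rw [e]
        rw [lintegral_const_mul _ (hm3.const_mul _), lintegral_const_mul _ hm3]
        calc _ ≤ ENNReal.ofReal (K ^ 2) * (ENNReal.ofReal ((u ^ 2)⁻¹) *
              ENNReal.ofReal (4 * |u| ^ (1 - 2 * L))) := by
              gcongr
              exact lintegral_vertical_le hM hL' hL (by linarith)
          _ = _ := by
              rw [← ENNReal.ofReal_mul (by positivity), ← ENNReal.ofReal_mul (by positivity),
                ← ENNReal.ofReal_mul (by positivity)]
              congr 1
              rw [show -(2 * L + 1) = (1 - 2 * L) - (2 : ℕ) by push_cast; ring,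
                Real.rpow_sub_natCast hu0.ne', sq_abs]
              ring
    _ ≤ ENNReal.ofReal (K ^ 2 * 4) *
          ENNReal.ofReal (2 * r ^ (1 - (2 * L + 1)) / (2 * L + 1 - 1)) := by
        rw [lintegral_const_mul _ hm2]
        gcongr
        exact lintegral_abs_rpow_tail_le (by linarith) (by linarith)
    _ = _ := by
        rw [← ENNReal.ofReal_mul (by positivity)]
        congr 2
        rw [show 1 - (2 * L + 1) = -(2 * L) by ring]
        field_simp
        ring

/-- Steep shears decay like `|ξ₁|^{-2(L₂-M)}` and coarse scales like `|ξ₁|^{-2L}`; taking `L` to be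
the minimum of `L₂ - M` and `L₁` lets both pieces of the coarse estimate share one exponent. -/
theorem exists_constPos_sub_lDelta_le {ψ : L2Plane} {M : ℕ} {L₁ L₂ : ℝ}
    (h : Integrable (fun ξ : Plane => ‖hat ψ ξ‖ ^ 2 / |ξ 0| ^ 2) volume)
    (hsymm : constPos ψ = constNeg ψ)
    (hL₁ : ∃ K R : ℝ, ∀ᵐ ξ : Plane, R ≤ |ξ 0| → ‖hat ψ ξ‖ ≤ K * |ξ 0| ^ (-L₁))
    (hL₂ : ∃ K : ℝ, 0 ≤ K ∧ ∀ᵐ ξ : Plane, ‖hat ψ ξ‖ ≤ K * |ξ 0| ^ M * |ξ 1| ^ (-L₂))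
    (hM : 1 ≤ M) (hML : (M : ℝ) < L₂) (hLM : L₂ < 2 * (M : ℝ) - 1 / 2)
    (hL : 0 < min (L₂ - M) L₁) :
    ∃ K R : ℝ, 0 ≤ K ∧ ∀ ξ : Plane, R ≤ |ξ 0| → |ξ 1| ≤ 3 / 2 * |ξ 0| →
      constPos ψ - (lDelta ψ ξ).toReal ≤ K * |ξ 0| ^ (-(2 * min (L₂ - M) L₁)) := by
  set L := min (L₂ - M) L₁ with hLdef
  obtain ⟨K₁, R, h1⟩ := hL₁
  obtain ⟨K₂, hK₂, h2⟩ := hL₂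
  set A := ((∫⁻ a in Ioc (0 : ℝ) 1, ENNReal.ofReal (a ^ (2 * M - L₂ - 3 / 2))) *
    ∫⁻ s in {s : ℝ | 2 < |s|}, ENNReal.ofReal (|s| ^ (-(2 * L₂)))) with hA
  have hAt : A ≠ ⊤ := lintegral_steep_const_ne_top hM hML hLM
  set K := max |K₁| K₂ with hK
  have hLL₁ : L ≤ L₁ := min_le_right _ _
  have hLL₂ : L ≤ L₂ - M := min_le_left _ _
  refine ⟨K₂ ^ 2 * (4 : ℝ) ^ (2 * L₂) * A.toReal + K ^ 2 * 4 / L, max R 1,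
    by positivity, fun ξ hR hξ' => ?_⟩
  have hr1 : 1 ≤ |ξ 0| := (le_max_right _ _).trans hR
  have hr0 : 0 < |ξ 0| := by linarith
  have hξ : ξ 0 ≠ 0 := abs_pos.1 hr0
  have b0 := ofReal_constPos_le h hsymm hξ
  have b1 := lintegral_steep_le hK₂ hML hM h2 hξ hξ'
  have b2 := lintegral_coarse_le (ψ := ψ) (M := M) (K := K) (L := L) (L' := L₂) (r := |ξ 0|) hM
    (by linarith) hL hr1 (by
      filter_upwards [h1] with η hη hlt
      have hη1 : 1 ≤ |η 0| := by linarith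
      refine (hη ((le_max_left _ _).trans (hR.trans hlt.le))).trans ?_
      have e1 : K₁ ≤ K := (le_abs_self _).trans (le_max_left _ _)
      have e2 : |η 0| ^ (-L₁) ≤ |η 0| ^ (-L) :=
        Real.rpow_le_rpow_of_exponent_le hη1 (by linarith)
      gcongr) (by
      filter_upwards [h2] with η hη
      refine hη.trans ?_
      have e1 : K₂ ≤ K := le_max_right _ _
      gcongr)
  have b3 : ENNReal.ofReal (constPos ψ) ≤ lDelta ψ ξ + ENNReal.ofReal
      ((K₂ ^ 2 * (4 : ℝ) ^ (2 * L₂) * A.toReal + K ^ 2 * 4 / L) * |ξ 0| ^ (-(2 * L))) := by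
    refine b0.trans ?_
    gcongr
    refine (add_le_add b1 b2).trans ?_
    rw [← hA, ← ENNReal.ofReal_toReal hAt, ← ENNReal.ofReal_mul (by positivity),
      ← ENNReal.ofReal_add (by positivity) (by positivity)]
    apply ENNReal.ofReal_le_ofReal
    rw [ENNReal.ofReal_toReal hAt]
    have e3 : |ξ 0| ^ (2 * M - 2 * L₂) ≤ |ξ 0| ^ (-(2 * L)) :=
      Real.rpow_le_rpow_of_exponent_le hr1 (by linarith)
    calc _ ≤ K₂ ^ 2 * (4 : ℝ) ^ (2 * L₂) * |ξ 0| ^ (-(2 * L)) * A.toReal +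
          K ^ 2 * 4 * (|ξ 0| ^ (-(2 * L)) / L) := by gcongr
      _ = _ := by ring
  have hfin : lDelta ψ ξ ≠ ⊤ :=
    ne_top_of_le_ne_top ENNReal.ofReal_ne_top (lDelta_le h hsymm hξ)
  rw [← ENNReal.ofReal_toReal hfin, ← ENNReal.ofReal_add ENNReal.toReal_nonneg (by positivity),
    ENNReal.ofReal_le_ofReal_iff (by positivity)] at b3
  linarith

/-! ### The smoothed cone indicator -/

/-- The convolution of `Φ̂` with the indicator function of a set. -/
noncomputable def smoothIndicator (Φ : Plane → ℂ) (D : Set Plane) (ξ : Plane) : ℂ :=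
  ∫ η : Plane, 𝓕⁻ Φ η * D.indicator (fun _ => (1 : ℂ)) (ξ - η)

theorem p0hat_eq (Φ : Plane → ℂ) : p0hat Φ = smoothIndicator Φ cone := rfl

theorem measurableSet_cone : MeasurableSet cone :=
  measurableSet_le (measurable_coord 1).abs (measurable_coord 0).abs

section Smooth

variable {Φ : Plane → ℂ}

theorem exists_schwartz (hΦ : ContDiff ℝ ∞ Φ) (hΦc : HasCompactSupport Φ) :
    ∃ u : 𝓢(Plane, ℂ), (u : Plane → ℂ) = Φ :=
  ⟨hΦc.toSchwartzMap hΦ, rfl⟩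

theorem integrable_pow_mul_fourierInv (hΦ : ContDiff ℝ ∞ Φ) (hΦc : HasCompactSupport Φ) (k : ℕ) :
    Integrable (fun η : Plane => ‖η‖ ^ k * ‖𝓕⁻ Φ η‖) volume := by
  obtain ⟨u, rfl⟩ := exists_schwartz hΦ hΦc
  rw [← SchwartzMap.fourierInv_coe]
  exact SchwartzMap.integrable_pow_mul _ _ _

theorem integrable_fourierInv (hΦ : ContDiff ℝ ∞ Φ) (hΦc : HasCompactSupport Φ) :
    Integrable (𝓕⁻ Φ) volume := by
  obtain ⟨u, rfl⟩ := exists_schwartz hΦ hΦc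
  rw [← SchwartzMap.fourierInv_coe]
  exact SchwartzMap.integrable _

theorem integral_fourierInv (hΦ : ContDiff ℝ ∞ Φ) (hΦc : HasCompactSupport Φ) :
    ∫ η, 𝓕⁻ Φ η = Φ 0 := by
  obtain ⟨u, rfl⟩ := exists_schwartz hΦ hΦc
  have h : 𝓕 (𝓕⁻ u) = u := FourierTransform.fourier_fourierInv_eq u
  have h2 := DFunLike.congr_fun h 0
  rw [SchwartzMap.fourier_coe, Real.fourier_eq, SchwartzMap.fourierInv_coe] at h2
  simpa using h2

theorem integrable_mul_indicator (hΦ : ContDiff ℝ ∞ Φ) (hΦc : HasCompactSupport Φ)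
    {D : Set Plane} (hD : MeasurableSet D) (ξ : Plane) :
    Integrable (fun η => 𝓕⁻ Φ η * D.indicator (fun _ => (1 : ℂ)) (ξ - η)) volume := by
  refine (integrable_fourierInv hΦ hΦc).mul_bdd (c := 1) ?_ ?_
  · exact ((measurable_const.indicator hD).comp (measurable_const_sub ξ)).aestronglyMeasurable
  · refine Filter.Eventually.of_forall fun η => ?_
    simp only [indicator]
    split_ifs <;> simp

/-- Fourier inversion gives `∫ Φ̂ = Φ(0) = 1`. Hence `p̂₁` is itself a smoothed indicator, of the
complementary cone, and every lemma for a general set `D` serves both symbols. -/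
theorem smoothIndicator_compl (hΦ : ContDiff ℝ ∞ Φ) (hΦc : HasCompactSupport Φ)
    (hΦ0 : Φ 0 = 1) {D : Set Plane} (hD : MeasurableSet D) (ξ : Plane) :
    smoothIndicator Φ Dᶜ ξ = 1 - smoothIndicator Φ D ξ := by
  rw [eq_sub_iff_add_eq, smoothIndicator, smoothIndicator,
    ← integral_add (integrable_mul_indicator hΦ hΦc hD.compl ξ)
      (integrable_mul_indicator hΦ hΦc hD ξ)]
  refine Eq.trans ?_ ((integral_fourierInv hΦ hΦc).trans hΦ0)
  congr 1
  ext η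
  by_cases h : ξ - η ∈ D <;> simp [h]

theorem p1hat_eq (hΦ : ContDiff ℝ ∞ Φ) (hΦc : HasCompactSupport Φ) (hΦ0 : Φ 0 = 1) :
    p1hat Φ = smoothIndicator Φ coneᶜ := by
  ext ξ
  rw [smoothIndicator_compl hΦ hΦc hΦ0 measurableSet_cone]
  rfl

theorem smoothIndicator_nonneg
    (hΦr : ∀ ξ : Plane, (𝓕⁻ Φ ξ).im = 0 ∧ 0 ≤ (𝓕⁻ Φ ξ).re ∧ (𝓕⁻ Φ ξ).re ≤ 1)
    (D : Set Plane) (ξ : Plane) : ∃ p : ℝ, 0 ≤ p ∧ smoothIndicator Φ D ξ = p := by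
  refine ⟨∫ η, (𝓕⁻ Φ η).re * D.indicator (fun _ => (1 : ℝ)) (ξ - η), ?_, ?_⟩
  · apply integral_nonneg
    intro η
    exact mul_nonneg (hΦr η).2.1 (indicator_nonneg (fun _ _ => zero_le_one) _)
  · rw [← integral_complex_ofReal, smoothIndicator]
    congr 1
    ext η
    have : 𝓕⁻ Φ η = ((𝓕⁻ Φ η).re : ℂ) := Complex.ext rfl (by simp [(hΦr η).1])
    by_cases h : ξ - η ∈ D
    · simp [h, ← this]
    · simp [h]

theorem p0hat_mem_Icc (hΦ : ContDiff ℝ ∞ Φ) (hΦc : HasCompactSupport Φ) (hΦ0 : Φ 0 = 1)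
    (hΦr : ∀ ξ : Plane, (𝓕⁻ Φ ξ).im = 0 ∧ 0 ≤ (𝓕⁻ Φ ξ).re ∧ (𝓕⁻ Φ ξ).re ≤ 1) (ξ : Plane) :
    ∃ p : ℝ, 0 ≤ p ∧ p ≤ 1 ∧ p0hat Φ ξ = p ∧ p1hat Φ ξ = ((1 - p : ℝ) : ℂ) := by
  obtain ⟨p, hp, h⟩ := smoothIndicator_nonneg hΦr cone ξ
  obtain ⟨p', hp', h'⟩ := smoothIndicator_nonneg hΦr coneᶜ ξ
  rw [smoothIndicator_compl hΦ hΦc hΦ0 measurableSet_cone, h] at h'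
  norm_cast at h'
  refine ⟨p, hp, by linarith, h, ?_⟩
  rw [p1hat, p0hat_eq, h]
  push_cast
  rfl

theorem measurable_smoothIndicator (hΦ : ContDiff ℝ ∞ Φ) (hΦc : HasCompactSupport Φ)
    {D : Set Plane} (hD : MeasurableSet D) : Measurable (smoothIndicator Φ D) := by
  obtain ⟨u, hu⟩ := exists_schwartz hΦ hΦc
  have hc : Continuous (𝓕⁻ Φ) := by
    rw [← hu]; exact continuous_fourierInv u.integrable
  have : StronglyMeasurable fun p : Plane × Plane =>
      𝓕⁻ Φ p.2 * D.indicator (fun _ => (1 : ℂ)) (p.1 - p.2) :=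
    ((hc.measurable.comp measurable_snd).mul ((measurable_const.indicator hD).comp
      (measurable_fst.sub measurable_snd))).stronglyMeasurable
  exact this.integral_prod_right'.measurable

/-- Where the integrand is nonzero, `‖η‖ ≥ ρ`, so a factor `(‖η‖ / ρ)^k ≥ 1` may be inserted. -/
theorem norm_smoothIndicator_le (hΦ : ContDiff ℝ ∞ Φ) (hΦc : HasCompactSupport Φ)
    {D : Set Plane} {ξ : Plane} {ρ : ℝ} (hρ : 0 < ρ)
    (h : ∀ η, ξ - η ∈ D → ρ ≤ ‖η‖) (k : ℕ) :
    ‖smoothIndicator Φ D ξ‖ ≤ (∫ η : Plane, ‖η‖ ^ k * ‖𝓕⁻ Φ η‖) / ρ ^ k := by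
  rw [div_eq_inv_mul, ← integral_const_mul, smoothIndicator]
  apply norm_integral_le_of_norm_le ((integrable_pow_mul_fourierInv hΦ hΦc k).const_mul _)
  refine Filter.Eventually.of_forall fun η => ?_
  by_cases hη : ξ - η ∈ D
  · have h1 : ρ ^ k ≤ ‖η‖ ^ k := pow_le_pow_left₀ hρ.le (h η hη) k
    have h2 : 0 < ρ ^ k := by positivity
    rw [norm_mul, indicator_of_mem hη, norm_one, mul_one, ← mul_assoc]
    refine le_mul_of_one_le_left (norm_nonneg _) ?_
    rw [← div_eq_inv_mul, one_le_div h2]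
    exact h1
  · rw [indicator_of_notMem hη, mul_zero, norm_zero]
    positivity

theorem abs_coord_le (x : Plane) (i : Fin 2) : |x i| ≤ ‖x‖ := by
  simpa using PiLp.norm_apply_le x i

theorem norm_le_abs_add_abs (x : Plane) : ‖x‖ ≤ |x 0| + |x 1| := by
  rw [EuclideanSpace.norm_eq, Fin.sum_univ_two]
  apply Real.sqrt_le_iff.2
  refine ⟨by positivity, ?_⟩
  simp only [Real.norm_eq_abs]
  nlinarith [abs_nonneg (x 0), abs_nonneg (x 1)]

theorem exists_smoothIndicator_decay (hΦ : ContDiff ℝ ∞ Φ) (hΦc : HasCompactSupport Φ) (N : ℝ)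
    {D : Set Plane} {i j : Fin 2} (hij : ∀ x : Plane, ‖x‖ ≤ |x i| + |x j|)
    (hD : ∀ x ∈ D, |x j| ≤ |x i|) :
    ∃ K : ℝ, 0 ≤ K ∧ ∀ ξ : Plane, 1 ≤ ‖ξ‖ → 3 / 2 * |ξ i| ≤ |ξ j| →
      ‖smoothIndicator Φ D ξ‖ ≤ K * ‖ξ‖ ^ (-N) := by
  obtain ⟨k, hk⟩ := exists_nat_ge N
  refine ⟨(∫ η : Plane, ‖η‖ ^ k * ‖𝓕⁻ Φ η‖) * 10 ^ k,
    mul_nonneg (integral_nonneg fun η => by positivity) (by positivity), fun ξ h1 h2 => ?_⟩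
  have hI : 0 ≤ ∫ η : Plane, ‖η‖ ^ k * ‖𝓕⁻ Φ η‖ := integral_nonneg fun η => by positivity
  -- If `ξ - η ∈ D`, then `2‖η‖ ≥ |ξ_j| - |ξ_i| ≥ |ξ_j| / 3`, while `‖ξ‖ ≤ (5/3)|ξ_j|`; hence `‖η‖ ≥
  -- ‖ξ‖ / 10`.
  have h := norm_smoothIndicator_le hΦ hΦc (D := D) (ξ := ξ) (ρ := ‖ξ‖ / 10) (by positivity)
    (fun η hη => by
      have h3 := hD _ hη
      simp only [PiLp.sub_apply] at h3
      have h4 := abs_sub_abs_le_abs_sub (ξ j) (η j)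
      have h5 := abs_sub (ξ i) (η i)
      have h6 := abs_coord_le η i
      have h7 := abs_coord_le η j
      have h8 := hij ξ
      linarith) k
  refine h.trans ?_
  rw [div_pow, div_div_eq_mul_div, div_eq_mul_inv]
  refine mul_le_mul_of_nonneg_left ?_ (mul_nonneg hI (by positivity))
  have e : (‖ξ‖ ^ k)⁻¹ = ‖ξ‖ ^ (-(k : ℝ)) := by
    rw [Real.rpow_neg (norm_nonneg _), Real.rpow_natCast]
  rw [e]
  exact Real.rpow_le_rpow_of_exponent_le h1 (by linarith)

/-! ### Locality of the smoothed cone indicator -/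

theorem hat_translate {h h' : L2Plane} {x : Plane}
    (hh : h' =ᵐ[volume] fun y => h (y - x)) :
    hat h' =ᵐ[volume] fun ξ => (Real.fourierChar (inner ℝ x ξ) : ℂ) * hat h ξ := by
  have e : ∀ y, planeMap 1 y = y := by
    intro y
    ext i
    fin_cases i <;> simp [planeMap]
  have := hat_affine (M := 1) (M' := 1) (k := 1) one_pos (by simp) (by simp) x (f := h) (h := h')
    (by simpa [e] using hh)
  simpa [e] using this

theorem exists_translate (h : L2Plane) (x : Plane) :
    ∃ h' : L2Plane, h' =ᵐ[volume] fun y => h (y - x) := by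
  have e : ∀ y, planeMap 1 y = y := by
    intro y
    ext i
    fin_cases i <;> simp [planeMap]
  have := memLp_affine (M := 1) (k := 1) one_pos (by simp) x h
  simp only [e, Complex.ofReal_one, one_mul] at this
  exact ⟨this.toLp _, this.coeFn_toLp⟩

theorem integrable_conj_hat_mul_hat (g h : L2Plane) :
    Integrable (fun ξ => conj (hat g ξ) * hat h ξ) volume := by
  refine (L2.integrable_inner (𝕜 := ℂ) (hat g) (hat h)).congr ?_
  refine Filter.Eventually.of_forall fun ξ => ?_
  simp [RCLike.inner_apply, mul_comm]

/-- By Parseval this inverse transform is the correlation of `g` with the translate of `h` by `x`,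
and the hypothesis says that these two have disjoint supports. -/
theorem fourierInv_conj_hat_mul_hat_eq_zero {g h : L2Plane} {x : Plane}
    (hx : ∀ᵐ y, g y = 0 ∨ h (y - x) = 0) :
    𝓕⁻ (fun ξ => conj (hat g ξ) * hat h ξ) x = 0 := by
  obtain ⟨h', hh'⟩ := exists_translate h x
  have h1 : inner ℂ g h' = 0 := by
    rw [inner_L2_eq_integral]
    apply integral_eq_zero_of_ae
    filter_upwards [hx, hh'] with y h1 h2
    rw [h2]
    rcases h1 with h1 | h1 <;> simp [h1]
  rw [← h1, inner_eq_integral_hat, Real.fourierInv_eq]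
  apply integral_congr_ae
  filter_upwards [hat_translate hh'] with ξ hξ
  rw [hξ, Circle.smul_def, smul_eq_mul, real_inner_comm]
  ring

/-- A translate of `Φ̂` is the transform of a modulated `Φ`. Moving the transform to the other
factor leaves `Φ(x)` times the correlation of `g` and `h` at `x`, and one of the two always
vanishes. -/
theorem integral_fourierInv_sub_mul_eq_zero (hΦ : ContDiff ℝ ∞ Φ) (hΦc : HasCompactSupport Φ)
    {g h : L2Plane} (hx : ∀ x, Φ x ≠ 0 → ∀ᵐ y, g y = 0 ∨ h (y - x) = 0) (ζ : Plane) :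
    ∫ ξ, 𝓕⁻ Φ (ξ - ζ) * (conj (hat g ξ) * hat h ξ) = 0 := by
  obtain ⟨u, hu⟩ := exists_schwartz hΦ hΦc
  have hc : Continuous fun x : Plane => (Real.fourierChar (-inner ℝ x ζ) : ℂ) :=
    continuous_subtype_val.comp
      (Real.continuous_fourierChar.comp (continuous_id.inner continuous_const).neg)
  have hi : Integrable (fun x => (Real.fourierChar (-inner ℝ x ζ) : ℂ) * Φ x) volume := by
    rw [← hu]
    exact u.integrable.bdd_mul (c := 1) hc.aestronglyMeasurable
      (Filter.Eventually.of_forall fun x => (Circle.norm_coe _).le)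
  have h1 : ∀ ξ, 𝓕⁻ Φ (ξ - ζ) =
      𝓕⁻ (fun x => (Real.fourierChar (-inner ℝ x ζ) : ℂ) * Φ x) ξ := by
    intro ξ
    rw [Real.fourierInv_eq, Real.fourierInv_eq]
    congr 1
    ext x
    rw [Circle.smul_def, Circle.smul_def, smul_eq_mul, smul_eq_mul, ← mul_assoc, ← Circle.coe_mul,
      ← AddChar.map_add_eq_mul, inner_sub_right, sub_eq_add_neg]
  simp_rw [h1]
  rw [integral_fourierInv_mul_eq hi (integrable_conj_hat_mul_hat g h)]
  apply integral_eq_zero_of_ae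
  refine Filter.Eventually.of_forall fun x => ?_
  by_cases h0 : Φ x = 0
  · simp [h0]
  · simp [fourierInv_conj_hat_mul_hat_eq_zero (hx x h0)]

/-- This expresses that the convolution kernel is supported in `supp Φ`, without introducing the
distribution with transform `χ_D`: the symbol is a superposition over `ζ ∈ D` of translates of `Φ̂`,
each of which contributes zero. -/
theorem inner_multiplier_smoothIndicator_eq_zero (hΦ : ContDiff ℝ ∞ Φ)
    (hΦc : HasCompactSupport Φ) {D : Set Plane} (hD : MeasurableSet D)
    (hb : MemLp (smoothIndicator Φ D) ⊤ volume)
    {g h : L2Plane} (hx : ∀ x, Φ x ≠ 0 → ∀ᵐ y, g y = 0 ∨ h (y - x) = 0) :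
    inner ℂ g (multiplier hb h) = 0 := by
  set G : Plane → ℂ := fun ξ => conj (hat g ξ) * hat h ξ with hG
  have hGi : Integrable G volume := integrable_conj_hat_mul_hat g h
  have h1 : inner ℂ g (multiplier hb h) =
      ∫ ξ, ∫ ζ, D.indicator (fun _ => (1 : ℂ)) ζ * (𝓕⁻ Φ (ξ - ζ) * G ξ) := by
    rw [inner_eq_integral_hat]
    apply integral_congr_ae
    filter_upwards [hat_multiplier_ae_eq hb h] with ξ hξ
    rw [hξ, smoothIndicator, ← integral_sub_left_eq_self _ volume ξ]
    simp only [sub_sub_cancel]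
    rw [← integral_mul_const, ← integral_const_mul]
    congr 1
    ext ζ
    simp only [hG]
    ring
  rw [h1, integral_integral_swap]
  · apply integral_eq_zero_of_ae
    refine Filter.Eventually.of_forall fun ζ => ?_
    simp only [Pi.zero_apply]
    rw [integral_const_mul, integral_fourierInv_sub_mul_eq_zero hΦ hΦc hx, mul_zero]
  -- Fubini is justified by joint integrability of a convolution integrand of two `L¹` functions;
  -- the indicator is a bounded factor.
  · have h2 : Integrable (fun p : Plane × Plane =>
        (ContinuousLinearMap.mul ℂ ℂ) (G p.2) (𝓕⁻ Φ (-(p.1 - p.2)))) (volume.prod volume) :=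
      hGi.convolution_integrand (ContinuousLinearMap.mul ℂ ℂ)
        (integrable_fourierInv hΦ hΦc).comp_neg
    have h3 := (h2.swap).bdd_mul (c := 1) (f := fun p : Plane × Plane =>
      D.indicator (fun _ => (1 : ℂ)) p.2)
      ((measurable_const.indicator hD).comp measurable_snd).aestronglyMeasurable
      (Filter.Eventually.of_forall fun p => by simp only [indicator]; split_ifs <;> simp)
    refine h3.congr (Filter.Eventually.of_forall fun p => ?_)
    simp [Function.uncurry, mul_comm]

end Smooth

/-! ### Supports of shearlets -/

theorem norm_sq_plane (x : Plane) : ‖x‖ ^ 2 = x 0 ^ 2 + x 1 ^ 2 := by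
  rw [EuclideanSpace.norm_sq_eq, Fin.sum_univ_two, Real.norm_eq_abs, Real.norm_eq_abs, sq_abs,
    sq_abs]

/-- The number `1 + √2` is the operator norm of the shear with `s = 2`, the worst case. For it the
difference of the two sides is a nonnegative multiple of a square. -/
theorem add_mul_sq_add_sq_le {p q s : ℝ} (hs : |s| ≤ 2) :
    (p + s * q) ^ 2 + q ^ 2 ≤ (1 + √2) ^ 2 * (p ^ 2 + q ^ 2) := by
  have h2 : √2 ^ 2 = 2 := Real.sq_sqrt (by norm_num)
  have h1 : 1 ≤ √2 := Real.one_le_sqrt.2 (by norm_num)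
  have h3 : (p + s * q) ^ 2 ≤ (|p| + 2 * |q|) ^ 2 := by
    rw [← sq_abs (p + s * q)]
    have : |p + s * q| ≤ |p| + 2 * |q| := by
      refine (abs_add_le _ _).trans ?_
      rw [abs_mul]
      gcongr
    gcongr
  have h4 : 0 ≤ 2 * (√2 - 1) * ((√2 + 1) * |p| - |q|) ^ 2 :=
    mul_nonneg (by linarith) (sq_nonneg _)
  have h5 : (1 + √2) ^ 2 * (p ^ 2 + q ^ 2) - ((|p| + 2 * |q|) ^ 2 + q ^ 2) =
      2 * (√2 - 1) * ((√2 + 1) * |p| - |q|) ^ 2 := by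
    rw [← sq_abs p, ← sq_abs q]
    linear_combination (-2 * √2 * |p| ^ 2 - |p| ^ 2 + 4 * |p| * |q| + |q| ^ 2) * h2
  linarith

theorem norm_le_of_shear_eq {x w : Plane} {a s : ℝ} {i j : Fin 2} (ha : 0 < a) (ha1 : a ≤ 1)
    (hs : |s| ≤ 2) (hx : ‖x‖ ^ 2 = x i ^ 2 + x j ^ 2)
    (h0 : x i - s * x j = a * w 0) (h1 : x j = √a * w 1) :
    ‖x‖ ≤ (1 + √2) * ‖w‖ := by
  have hi : x i = a * w 0 + s * (√a * w 1) := by rw [← h0, ← h1]; ring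
  have h2 := add_mul_sq_add_sq_le (p := a * w 0) (q := √a * w 1) hs
  have h3 : ‖x‖ ^ 2 ≤ ((1 + √2) * ‖w‖) ^ 2 := by
    rw [hx, hi, h1]
    refine h2.trans ?_
    rw [mul_pow _ ‖w‖, norm_sq_plane]
    have e1 : (a * w 0) ^ 2 ≤ w 0 ^ 2 := by
      rw [mul_pow]
      exact mul_le_of_le_one_left (sq_nonneg _) (pow_le_one₀ ha.le ha1)
    have e2 : (√a * w 1) ^ 2 ≤ w 1 ^ 2 := by
      rw [mul_pow, Real.sq_sqrt ha.le]
      exact mul_le_of_le_one_left (sq_nonneg _) ha1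
    gcongr
  exact (sq_le_sq₀ (norm_nonneg _) (by positivity)).1 h3

theorem norm_le_shearMatrix {a s : ℝ} (ha : 0 < a) (ha1 : a ≤ 1) (hs : |s| ≤ 2) (x : Plane) :
    ‖x‖ ≤ (1 + √2) * ‖planeMap (shearMatrix a s) x‖ := by
  have h0 : √a ≠ 0 := (Real.sqrt_pos.2 ha).ne'
  apply norm_le_of_shear_eq (i := 0) (j := 1) ha ha1 hs (norm_sq_plane x)
  · simp [planeMap, shearMatrix]
    field_simp
    ring
  · simp [planeMap, shearMatrix]
    field_simp

theorem norm_le_shearMatrixNu {a s : ℝ} (ha : 0 < a) (ha1 : a ≤ 1) (hs : |s| ≤ 2) (x : Plane) :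
    ‖x‖ ≤ (1 + √2) * ‖planeMap (shearMatrixNu a s) x‖ := by
  have h0 : √a ≠ 0 := (Real.sqrt_pos.2 ha).ne'
  apply norm_le_of_shear_eq (i := 1) (j := 0) ha ha1 hs ((norm_sq_plane x).trans (add_comm _ _))
  · simp [planeMap, shearMatrixNu]
    field_simp
    ring
  · simp [planeMap, shearMatrixNu]
    field_simp

theorem support_affine {ψ sh : L2Plane} {A k c : ℝ} {M : Matrix (Fin 2) (Fin 2) ℝ} {t : Plane}
    (hψA : ∀ᵐ x : Plane, A < ‖x‖ → ψ x = 0) (hk : 0 < k) (hM : |M.det| = k ^ 2) (hc : 0 < c)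
    (hMc : ∀ x, ‖x‖ ≤ c * ‖planeMap M x‖)
    (hsh : sh =ᵐ[volume] fun x => (k : ℂ) * ψ (planeMap M (x - t))) :
    ∀ᵐ y, c * A < ‖y - t‖ → sh y = 0 := by
  have hq := quasiMeasurePreserving_of_map_eq (measurable_planeMap_sub M t)
    (map_planeMap_sub hk hM t)
  filter_upwards [hsh, hq.ae hψA] with y h1 h2 h3
  rw [h1, h2, mul_zero]
  exact lt_of_mul_lt_mul_left (h3.trans_le (hMc _)) hc.le

theorem support_shearlet {ψ : L2Plane} {A : ℝ} (hψA : ∀ᵐ x : Plane, A < ‖x‖ → ψ x = 0)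
    {a s : ℝ} (ha : 0 < a) (ha1 : a ≤ 1) (hs : |s| ≤ 2) (t : Plane) :
    ∀ᵐ y, (1 + √2) * A < ‖y - t‖ → shearlet ψ a s t y = 0 :=
  support_affine hψA (Real.rpow_pos_of_pos ha _) (abs_det_shearMatrix ha s) (by positivity)
    (norm_le_shearMatrix ha ha1 hs) (shearlet_ae_eq ψ ha s t)

theorem support_shearletNu {ψ : L2Plane} {A : ℝ} (hψA : ∀ᵐ x : Plane, A < ‖x‖ → ψ x = 0)
    {a s : ℝ} (ha : 0 < a) (ha1 : a ≤ 1) (hs : |s| ≤ 2) (t : Plane) :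
    ∀ᵐ y, (1 + √2) * A < ‖y - t‖ → shearletNu ψ a s t y = 0 :=
  support_affine hψA (Real.rpow_pos_of_pos ha _) (abs_det_shearMatrixNu ha s) (by positivity)
    (norm_le_shearMatrixNu ha ha1 hs) (shearletNu_ae_eq ψ ha s t)

theorem ae_shearletMeasure_mem :
    ∀ᵐ z ∂shearletMeasure, 0 < z.2.2 ∧ z.2.2 ≤ 1 ∧ |z.2.1| ≤ 2 := by
  have h1 : ∀ᵐ a ∂((volume.restrict (Ioc (0 : ℝ) 1)).withDensity
      fun a => ENNReal.ofReal (a ^ (-3 : ℝ))), a ∈ Ioc (0 : ℝ) 1 :=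
    (withDensity_absolutelyContinuous _ _).ae_le (ae_restrict_mem measurableSet_Ioc)
  have h2 : ∀ᵐ s ∂(volume.restrict (Icc (-2 : ℝ) 2)), s ∈ Icc (-2 : ℝ) 2 :=
    ae_restrict_mem measurableSet_Icc
  have h3 : ∀ᵐ z ∂paramMeasure, 0 < z.2 ∧ z.2 ≤ 1 ∧ |z.1| ≤ 2 := by
    filter_upwards [Measure.quasiMeasurePreserving_snd.ae h1,
      Measure.quasiMeasurePreserving_fst.ae h2] with z ha hs
    exact ⟨ha.1, ha.2, abs_le.2 hs⟩
  exact Measure.quasiMeasurePreserving_snd.ae h3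

/-- If `t` is within `r + B` of some point of `U`, the shearlet lives where `f` vanishes, which
kills the first factor. Otherwise the shearlet, even after spreading by `B`, misses `U`, which kills
the second. -/
theorem coeff_mul_inner_eq_zero {Φ : Plane → ℂ} (hΦ : ContDiff ℝ ∞ Φ)
    (hΦc : HasCompactSupport Φ) {D : Set Plane} (hD : MeasurableSet D)
    (hb : MemLp (smoothIndicator Φ D) ⊤ volume) {B r : ℝ}
    (hB : ∀ x : Plane, B < ‖x‖ → Φ x = 0) {U : Set Plane} {t : Plane} {f g sh : L2Plane}
    (hsh : ∀ᵐ y, r < ‖y - t‖ → sh y = 0)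
    (hf : ∀ᵐ x, (∃ u ∈ U, ‖x - u‖ ≤ 2 * r + B) → f x = 0)
    (hg : ∀ᵐ y, y ∉ U → g y = 0) :
    inner ℂ sh f * inner ℂ g (multiplier hb sh) = 0 := by
  by_cases h : ∃ u ∈ U, ‖u - t‖ ≤ r + B
  · obtain ⟨u, hu, hut⟩ := h
    have : inner ℂ sh f = 0 := by
      rw [inner_L2_eq_integral]
      apply integral_eq_zero_of_ae
      filter_upwards [hsh, hf] with y h1 h2
      by_cases hy : r < ‖y - t‖
      · simp [h1 hy]
      · have h3 : ‖y - u‖ ≤ 2 * r + B := by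
          have h4 := norm_sub_le_norm_sub_add_norm_sub y t u
          rw [norm_sub_rev t u] at h4
          linarith
        simp [h2 ⟨u, hu, h3⟩]
    rw [this, zero_mul]
  · push Not at h
    rw [inner_multiplier_smoothIndicator_eq_zero hΦ hΦc hD hb, mul_zero]
    intro x hx
    have hxB : ‖x‖ ≤ B := by
      by_contra hn
      exact hx (hB x (not_le.1 hn))
    have hq := (measurePreserving_sub_right (volume : Measure Plane) x).quasiMeasurePreserving
    filter_upwards [hg, hq.ae hsh] with y h1 h2
    by_cases hy : y ∈ U
    · right
      apply h2
      have h3 := h y hy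
      have h4 : ‖y - t‖ ≤ ‖y - x - t‖ + ‖x‖ := by
        have := norm_add_le (y - x - t) x
        rwa [show y - x - t + x = y - t by abel] at this
      linarith
    · exact Or.inl (h1 hy)

/-! ### Multipliers and sesquilinear forms -/

theorem inner_multiplier_multiplier {m m' : Plane → ℂ} (hm : MemLp m ⊤ volume)
    (hm' : MemLp m' ⊤ volume) (f g : L2Plane) :
    inner ℂ (multiplier hm g) (multiplier hm' f) =
      ∫ ξ, conj (m ξ) * m' ξ * (hat f ξ * conj (hat g ξ)) := by
  rw [inner_eq_integral_hat]
  apply integral_congr_ae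
  filter_upwards [hat_multiplier_ae_eq hm g, hat_multiplier_ae_eq hm' f] with ξ h1 h2
  rw [h1, h2, map_mul]
  ring

theorem inner_multiplier_right {m : Plane → ℂ} (hm : MemLp m ⊤ volume) (f g : L2Plane) :
    inner ℂ g (multiplier hm f) = ∫ ξ, m ξ * (hat f ξ * conj (hat g ξ)) := by
  rw [inner_eq_integral_hat]
  apply integral_congr_ae
  filter_upwards [hat_multiplier_ae_eq hm f] with ξ h
  rw [h]
  ring

theorem integrable_mul_hat_mul_conj_hat {m : Plane → ℂ} (hm : MemLp m ⊤ volume)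
    (f g : L2Plane) : Integrable (fun ξ => m ξ * (hat f ξ * conj (hat g ξ))) volume := by
  have h1 : MemLp (fun ξ => hat f ξ * conj (hat g ξ)) 1 volume := by
    rw [memLp_one_iff_integrable]
    refine (integrable_conj_hat_mul_hat g f).congr (Filter.Eventually.of_forall fun ξ => ?_)
    simp only [mul_comm]
  exact memLp_one_iff_integrable.1 (h1.mul hm)

theorem memLp_one_top : MemLp (fun _ : Plane => (1 : ℂ)) ⊤ volume := memLp_top_const 1

theorem multiplier_one (f : L2Plane) : multiplier memLp_one_top f = f := by
  apply hat_injective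
  apply Lp.ext
  filter_upwards [hat_multiplier_ae_eq memLp_one_top f] with ξ h
  rw [h, one_mul]

theorem memLp_top_of_norm_le_one {q : Plane → ℂ} (hq : Measurable q) (h1 : ∀ ξ, ‖q ξ‖ ≤ 1) :
    MemLp q ⊤ volume :=
  memLp_top_of_bound hq.aestronglyMeasurable 1 (Filter.Eventually.of_forall h1)

theorem inner_conv_invHat {m : Plane → ℂ} (hm : MemLp m ⊤ volume) (f g : L2Plane) :
    inner ℂ g (conv (invHat m) f) = conj (inner ℂ (multiplier hm f) g) := by
  rw [conv_invHat hm, inner_conj_symm]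

theorem measurable_planeSwap : Measurable swap := by
  refine Continuous.measurable ((PiLp.continuous_toLp 2 _).comp (continuous_pi fun i => ?_))
  fin_cases i
  · exact (EuclideanSpace.proj (𝕜 := ℝ) 1).continuous
  · exact (EuclideanSpace.proj (𝕜 := ℝ) 0).continuous

/-- `C_ψ⁻¹ (p̂₀ Δ_ψ + p̂₁ Δ_{ψ^ν})`, by which the high frequency part multiplies Fourier
transforms. -/
noncomputable def highSymbol (ψ : L2Plane) (Φ : Plane → ℂ) (ξ : Plane) : ℂ :=
  ((1 / constPos ψ : ℝ) : ℂ) * (p0hat Φ ξ * ((lDelta ψ ξ).toReal : ℂ) +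
    p1hat Φ ξ * ((lDelta ψ (swap ξ)).toReal : ℂ))

section Main

variable {ψ : L2Plane} {Φ u₀ u₁ : Plane → ℂ}

/-- A pointwise form of the properties of the functions `p̂₀` and `p̂₁`. -/
def IsPartition (Φ : Plane → ℂ) : Prop :=
  (∀ ξ, ∃ p : ℝ, 0 ≤ p ∧ p ≤ 1 ∧ p0hat Φ ξ = p ∧ p1hat Φ ξ = ((1 - p : ℝ) : ℂ)) ∧
    Measurable (p0hat Φ) ∧ Measurable (p1hat Φ)

/-- The bounds `Δ_ψ ≤ C_ψ` and `Δ_{ψ^ν} ≤ C_ψ`. -/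
def IsDeltaBounded (ψ : L2Plane) : Prop :=
  (∀ᵐ ξ : Plane, lDelta ψ ξ ≤ ENNReal.ofReal (constPos ψ)) ∧
    ∀ᵐ ξ : Plane, lDelta ψ (swap ξ) ≤ ENNReal.ofReal (constPos ψ)

theorem IsPartition.norm_p0hat_le (h : IsPartition Φ) (ξ : Plane) : ‖p0hat Φ ξ‖ ≤ 1 := by
  obtain ⟨p, h0, h1, h2, -⟩ := h.1 ξ
  rw [h2, Complex.norm_real, Real.norm_of_nonneg h0]
  exact h1

theorem IsPartition.norm_p1hat_le (h : IsPartition Φ) (ξ : Plane) : ‖p1hat Φ ξ‖ ≤ 1 := by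
  obtain ⟨p, h0, h1, -, h2⟩ := h.1 ξ
  rw [h2, Complex.norm_real, Real.norm_of_nonneg (by linarith)]
  linarith

theorem IsPartition.memLp_p0hat (h : IsPartition Φ) : MemLp (p0hat Φ) ⊤ volume :=
  memLp_top_of_norm_le_one h.2.1 h.norm_p0hat_le

theorem IsPartition.memLp_p1hat (h : IsPartition Φ) : MemLp (p1hat Φ) ⊤ volume :=
  memLp_top_of_norm_le_one h.2.2 h.norm_p1hat_le

theorem measurable_sqrtHat {p : Plane → ℂ} (hp : Measurable p) : Measurable (sqrtHat p) := by
  unfold sqrtHat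
  exact Complex.measurable_ofReal.comp (Complex.measurable_re.comp hp).sqrt

theorem norm_sqrtHat_le {p : Plane → ℂ} (hp : ∀ ξ, ‖p ξ‖ ≤ 1) (ξ : Plane) :
    ‖sqrtHat p ξ‖ ≤ 1 := by
  rw [sqrtHat, Complex.norm_real, Real.norm_of_nonneg (Real.sqrt_nonneg _)]
  exact (Real.sqrt_le_sqrt ((Complex.re_le_norm _).trans (hp ξ))).trans_eq Real.sqrt_one

theorem conj_sqrtHat_mul_sqrtHat {p : Plane → ℂ} {ξ : Plane} {r : ℝ} (hr : 0 ≤ r)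
    (h : p ξ = r) : conj (sqrtHat p ξ) * sqrtHat p ξ = p ξ := by
  rw [sqrtHat, Complex.conj_ofReal, ← Complex.ofReal_mul, Real.mul_self_sqrt (by simp [h, hr]), h,
    Complex.ofReal_re]

theorem IsDeltaBounded.toReal_le (h : IsDeltaBounded ψ) :
    ∀ᵐ ξ : Plane, (lDelta ψ ξ).toReal ≤ constPos ψ ∧ (lDelta ψ (swap ξ)).toReal ≤ constPos ψ := by
  filter_upwards [h.1, h.2] with ξ h1 h2
  exact ⟨ENNReal.toReal_le_of_le_ofReal (constPos_nonneg ψ) h1,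
    ENNReal.toReal_le_of_le_ofReal (constPos_nonneg ψ) h2⟩

theorem memLp_lDelta (h : IsDeltaBounded ψ) :
    MemLp (fun ξ : Plane => ((lDelta ψ ξ).toReal : ℂ)) ⊤ volume := by
  refine memLp_top_of_bound (Complex.measurable_ofReal.comp
    (measurable_lDelta ψ).ennreal_toReal).aestronglyMeasurable (constPos ψ) ?_
  filter_upwards [h.toReal_le] with ξ hξ
  rw [Complex.norm_real, Real.norm_of_nonneg ENNReal.toReal_nonneg]
  exact hξ.1

theorem memLp_lDelta_swap (h : IsDeltaBounded ψ) :
    MemLp (fun ξ : Plane => ((lDelta ψ (swap ξ)).toReal : ℂ)) ⊤ volume := by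
  refine memLp_top_of_bound (Complex.measurable_ofReal.comp ((measurable_lDelta ψ).comp
    measurable_planeSwap).ennreal_toReal).aestronglyMeasurable (constPos ψ) ?_
  filter_upwards [h.toReal_le] with ξ hξ
  rw [Complex.norm_real, Real.norm_of_nonneg ENNReal.toReal_nonneg]
  exact hξ.2

theorem memLp_highSymbol (hp : IsPartition Φ) (hd : IsDeltaBounded ψ) :
    MemLp (highSymbol ψ Φ) ⊤ volume :=
  (((memLp_lDelta hd).mul hp.memLp_p0hat).add
    ((memLp_lDelta_swap hd).mul hp.memLp_p1hat)).const_mul _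

theorem memLp_lowSymbol (hp : IsPartition Φ) (hd : IsDeltaBounded ψ) :
    MemLp (fun ξ => 1 - highSymbol ψ Φ ξ) ⊤ volume :=
  memLp_one_top.sub (memLp_highSymbol hp hd)

theorem high_add_low (hp : IsPartition Φ) (hd : IsDeltaBounded ψ) (f : L2Plane) :
    f = multiplier (memLp_highSymbol hp hd) f + multiplier (memLp_lowSymbol hp hd) f := by
  apply hat_injective
  rw [hat_add]
  apply Lp.ext
  filter_upwards [hat_multiplier_ae_eq (memLp_highSymbol hp hd) f,
    hat_multiplier_ae_eq (memLp_lowSymbol hp hd) f,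
    Lp.coeFn_add (hat (multiplier (memLp_highSymbol hp hd) f))
      (hat (multiplier (memLp_lowSymbol hp hd) f))] with ξ h1 h2 h3
  rw [h3, Pi.add_apply, h1, h2]
  ring

theorem isHighPart_multiplier (hp : IsPartition Φ) (hd : IsDeltaBounded ψ) (f : L2Plane) :
    IsHighPart (constPos ψ) ψ Φ f (multiplier (memLp_highSymbol hp hd) f) := by
  intro g
  have h0 := integral_shearlet_coeff (isShearletFamily_shearlet ψ) measurable_id memLp_one_top
    measurable_const (by simp) hp.memLp_p0hat hp.2.1 hp.norm_p0hat_le ENNReal.ofReal_ne_top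
    hd.1 f g
  have h1 := integral_shearlet_coeff (isShearletFamily_shearletNu ψ) measurable_planeSwap
    memLp_one_top measurable_const (by simp) hp.memLp_p1hat hp.2.2 hp.norm_p1hat_le
    ENNReal.ofReal_ne_top hd.2 f g
  simp only [multiplier_one] at h0 h1
  simp only [inner_conv_invHat hp.memLp_p0hat, inner_conv_invHat hp.memLp_p1hat]
  refine ⟨h0.1, h1.1, ?_⟩
  have i0 := integrable_mul_hat_mul_conj_hat ((memLp_lDelta hd).mul hp.memLp_p0hat) f g
  have i1 := integrable_mul_hat_mul_conj_hat ((memLp_lDelta_swap hd).mul hp.memLp_p1hat) f g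
  rw [h0.2, h1.2, inner_multiplier_right]
  simp only [id, map_one, one_mul]
  refine Eq.trans ?_ (congrArg _ (integral_add i0 i1))
  rw [← integral_const_mul]
  congr 1
  ext ξ
  rw [highSymbol]
  ring

theorem memLp_of_norm_sq_eq {u : Plane → ℂ} {d : Plane → ℝ} {C : ℝ}
    (hu : AEStronglyMeasurable u volume) (h : ∀ᵐ ξ, ‖u ξ‖ ^ 2 = C - d ξ)
    (hd : ∀ ξ, 0 ≤ d ξ) : MemLp u ⊤ volume := by
  refine memLp_top_of_bound hu (√C) ?_
  filter_upwards [h] with ξ hξ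
  apply Real.le_sqrt_of_sq_le
  linarith [hd ξ]

/-- Writing `1` as `(p̂₀ + p̂₁) C_ψ / C_ψ` exhibits the complement of the high symbol as the symbol
produced by the windows. -/
theorem one_sub_highSymbol (hC : 0 < constPos ψ) {ξ : Plane} {x₀ x₁ : ℝ}
    (h0 : x₀ = constPos ψ - (lDelta ψ ξ).toReal)
    (h1 : x₁ = constPos ψ - (lDelta ψ (swap ξ)).toReal) :
    1 - highSymbol ψ Φ ξ = ((1 / constPos ψ : ℝ) : ℂ) * (p0hat Φ ξ * x₀ + p1hat Φ ξ * x₁) := by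
  have hC' : (constPos ψ : ℂ) ≠ 0 := by exact_mod_cast hC.ne'
  rw [highSymbol, h0, h1, p1hat]
  push_cast
  field_simp
  ring

theorem isLowPart_multiplier (hC : 0 < constPos ψ) (hp : IsPartition Φ) (hd : IsDeltaBounded ψ)
    (hm₀ : MemLp u₀ ⊤ volume) (hm₁ : MemLp u₁ ⊤ volume)
    (h₀ : ∀ᵐ ξ : Plane, ‖u₀ ξ‖ ^ 2 = constPos ψ - (lDelta ψ ξ).toReal)
    (h₁ : ∀ᵐ ξ : Plane, ‖u₁ ξ‖ ^ 2 = constPos ψ - (lDelta ψ (swap ξ)).toReal) (f : L2Plane) :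
    IsLowPart (constPos ψ) Φ u₀ u₁ f (multiplier (memLp_lowSymbol hp hd) f) := by
  intro g
  have m0 : MemLp (fun ξ => p0hat Φ ξ * u₀ ξ) ⊤ volume := hm₀.mul hp.memLp_p0hat
  have m1 : MemLp (fun ξ => p1hat Φ ξ * u₁ ξ) ⊤ volume := hm₁.mul hp.memLp_p1hat
  have key : ∀ F G : L2Plane, ∫ t, F t * conj (G t) = inner ℂ G F := fun F G => by
    rw [inner_L2_eq_integral]
    simp only [mul_comm]
  rw [key, key, windowCoeff_invHat hm₀, windowCoeff_invHat hm₁, windowCoeff_invHat m0,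
    windowCoeff_invHat m1, inner_multiplier_multiplier, inner_multiplier_multiplier,
    inner_multiplier_right]
  have i0 := integrable_mul_hat_mul_conj_hat
    ((MemLp.conj hm₀).mul (MemLp.conj (MemLp.conj m0)) (r := ⊤)) f g
  have i1 := integrable_mul_hat_mul_conj_hat
    ((MemLp.conj hm₁).mul (MemLp.conj (MemLp.conj m1)) (r := ⊤)) f g
  refine Eq.trans ?_ (congrArg _ (integral_add i0 i1))
  rw [← integral_const_mul]
  apply integral_congr_ae
  filter_upwards [h₀, h₁] with ξ e0 e1
  rw [one_sub_highSymbol hC e0 e1]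
  have c0 : u₀ ξ * conj (u₀ ξ) = ((‖u₀ ξ‖ ^ 2 : ℝ) : ℂ) := by
    rw [Complex.mul_conj, Complex.normSq_eq_norm_sq]
  have c1 : u₁ ξ * conj (u₁ ξ) = ((‖u₁ ξ‖ ^ 2 : ℝ) : ℂ) := by
    rw [Complex.mul_conj, Complex.normSq_eq_norm_sq]
  rw [← c0, ← c1]
  simp only [Complex.conj_conj]
  ring

theorem integrable_norm_sq_and_integral {α : Type*} [MeasurableSpace α] {μ : Measure α}
    {F : α → ℂ} (h : Integrable (fun z => F z * conj (F z)) μ) :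
    Integrable (fun z => ‖F z‖ ^ 2) μ ∧
      ((∫ z, ‖F z‖ ^ 2 ∂μ : ℝ) : ℂ) = ∫ z, F z * conj (F z) ∂μ := by
  have e : (fun z => F z * conj (F z)) = fun z => ((‖F z‖ ^ 2 : ℝ) : ℂ) := by
    ext z
    rw [Complex.mul_conj, Complex.normSq_eq_norm_sq]
  rw [e] at h ⊢
  exact ⟨h.re, integral_ofReal.symm⟩

theorem memLp_windowHat (hp : IsPartition Φ) (hm₀ : MemLp u₀ ⊤ volume)
    (hm₁ : MemLp u₁ ⊤ volume)
    (h₀ : ∀ᵐ ξ : Plane, ‖u₀ ξ‖ ^ 2 = constPos ψ - (lDelta ψ ξ).toReal)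
    (h₁ : ∀ᵐ ξ : Plane, ‖u₁ ξ‖ ^ 2 = constPos ψ - (lDelta ψ (swap ξ)).toReal) :
    MemLp (windowHat Φ u₀ u₁) ⊤ volume := by
  refine memLp_top_of_bound ?_ (√(constPos ψ)) ?_
  · have m0 := (Complex.measurable_re.comp hp.2.1).aestronglyMeasurable (μ := volume)
    have m1 := (Complex.measurable_re.comp hp.2.2).aestronglyMeasurable (μ := volume)
    have := (m0.mul (hm₀.1.norm.pow 2)).add (m1.mul (hm₁.1.norm.pow 2))
    exact Complex.continuous_ofReal.comp_aestronglyMeasurable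
      (Real.continuous_sqrt.comp_aestronglyMeasurable this)
  · filter_upwards [h₀, h₁] with ξ e0 e1
    obtain ⟨p, hp0, hp1, hq0, hq1⟩ := hp.1 ξ
    rw [windowHat, Complex.norm_real, Real.norm_of_nonneg (Real.sqrt_nonneg _), hq0, hq1,
      Complex.ofReal_re, Complex.ofReal_re]
    apply Real.sqrt_le_sqrt
    have d0 : 0 ≤ (lDelta ψ ξ).toReal := ENNReal.toReal_nonneg
    have d1 : 0 ≤ (lDelta ψ (swap ξ)).toReal := ENNReal.toReal_nonneg
    rw [e0, e1]
    nlinarith [mul_nonneg hp0 d0, mul_nonneg (sub_nonneg.2 hp1) d1]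

theorem tightFrameIdentity (hC : 0 < constPos ψ) (hp : IsPartition Φ) (hd : IsDeltaBounded ψ)
    (hm₀ : MemLp u₀ ⊤ volume) (hm₁ : MemLp u₁ ⊤ volume)
    (h₀ : ∀ᵐ ξ : Plane, ‖u₀ ξ‖ ^ 2 = constPos ψ - (lDelta ψ ξ).toReal)
    (h₁ : ∀ᵐ ξ : Plane, ‖u₁ ξ‖ ^ 2 = constPos ψ - (lDelta ψ (swap ξ)).toReal) (f : L2Plane) :
    TightFrameIdentity (constPos ψ) ψ (invHat (sqrtHat (p0hat Φ))) (invHat (sqrtHat (p1hat Φ)))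
      (invHat (windowHat Φ u₀ u₁)) f := by
  have n0 := norm_sqrtHat_le hp.norm_p0hat_le
  have n1 := norm_sqrtHat_le hp.norm_p1hat_le
  have s0 := measurable_sqrtHat hp.2.1
  have s1 := measurable_sqrtHat hp.2.2
  have q0 := memLp_top_of_norm_le_one s0 n0
  have q1 := memLp_top_of_norm_le_one s1 n1
  have hw := memLp_windowHat hp hm₀ hm₁ h₀ h₁
  obtain ⟨j0, k0⟩ := integral_shearlet_coeff (isShearletFamily_shearlet ψ) measurable_id q0 s0 n0
    q0 s0 n0 ENNReal.ofReal_ne_top hd.1 f f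
  obtain ⟨j1, k1⟩ := integral_shearlet_coeff (isShearletFamily_shearletNu ψ)
    measurable_planeSwap q1 s1 n1 q1 s1 n1 ENNReal.ofReal_ne_top hd.2 f f
  obtain ⟨a0, b0⟩ := integrable_norm_sq_and_integral j0
  obtain ⟨a1, b1⟩ := integrable_norm_sq_and_integral j1
  set W := multiplier (MemLp.conj hw) f with hW
  have j2 : Integrable (fun t => W t * conj (W t)) volume := by
    refine (L2.integrable_inner (𝕜 := ℂ) W W).congr (Filter.Eventually.of_forall fun t => ?_)
    simp only [RCLike.inner_apply]
  obtain ⟨a2, b2⟩ := integrable_norm_sq_and_integral j2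
  have k2 : ∫ t, W t * conj (W t) =
      ∫ ξ, conj (conj (windowHat Φ u₀ u₁ ξ)) * conj (windowHat Φ u₀ u₁ ξ) *
        (hat f ξ * conj (hat f ξ)) := by
    rw [← inner_multiplier_multiplier (MemLp.conj hw) (MemLp.conj hw), inner_L2_eq_integral]
    simp only [mul_comm, hW]
  rw [TightFrameIdentity, conv_invHat q0, conv_invHat q1, windowCoeff_invHat hw]
  refine ⟨a0, a1, a2, ?_⟩
  rw [← Complex.ofReal_inj]
  push_cast
  rw [b0, b1, b2, k0, k1, k2]
  have i0 := integrable_mul_hat_mul_conj_hat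
    ((memLp_lDelta hd).mul (q0.mul (MemLp.conj q0) (r := ⊤)) (r := ⊤)) f f
  have i1 := integrable_mul_hat_mul_conj_hat
    ((memLp_lDelta_swap hd).mul (q1.mul (MemLp.conj q1) (r := ⊤)) (r := ⊤)) f f
  have i2 := integrable_mul_hat_mul_conj_hat
    ((MemLp.conj hw).mul (MemLp.conj (MemLp.conj hw)) (r := ⊤)) f f
  have hf : ((‖f‖ : ℂ)) ^ 2 = ∫ ξ, 1 * (hat f ξ * conj (hat f ξ)) := by
    rw [← inner_multiplier_right memLp_one_top, multiplier_one, inner_self_eq_norm_sq_to_K]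
    rfl
  rw [hf]
  refine Eq.trans ?_ (congrArg _ ((integral_add (i0.add i1) i2).trans
    (congrArg (· + _) (integral_add i0 i1))))
  rw [← integral_const_mul]
  apply integral_congr_ae
  filter_upwards [h₀, h₁] with ξ e0 e1
  obtain ⟨p, hp0, hp1, hq0, hq1⟩ := hp.1 ξ
  have c0 := conj_sqrtHat_mul_sqrtHat (p := p0hat Φ) hp0 hq0
  have c1 := conj_sqrtHat_mul_sqrtHat (p := p1hat Φ) (sub_nonneg.2 hp1) hq1
  have cw : conj (conj (windowHat Φ u₀ u₁ ξ)) * conj (windowHat Φ u₀ u₁ ξ) =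
      p0hat Φ ξ * (‖u₀ ξ‖ ^ 2 : ℝ) + p1hat Φ ξ * (‖u₁ ξ‖ ^ 2 : ℝ) := by
    rw [Complex.conj_conj, Complex.mul_conj, Complex.normSq_eq_norm_sq, windowHat,
      Complex.norm_real, Real.norm_of_nonneg (Real.sqrt_nonneg _), hq0, hq1, Complex.ofReal_re,
      Complex.ofReal_re, Real.sq_sqrt]
    · push_cast
      ring
    · have : 0 ≤ 1 - p := sub_nonneg.2 hp1
      positivity
  simp only [Pi.add_apply, Pi.mul_apply]
  -- Pointwise the three symbols add up to `p̂₀ Δ_ψ + p̂₁ Δ_{ψ^ν} + p̂₀ (C_ψ - Δ_ψ) + p̂₁ (C_ψ -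
  -- Δ_{ψ^ν}) = C_ψ`.
  rw [c0, c1, cw, e0, e1]
  have hC' : (constPos ψ : ℂ) ≠ 0 := by exact_mod_cast hC.ne'
  have e : p1hat Φ ξ = 1 - p0hat Φ ξ := rfl
  rw [e]
  push_cast
  field_simp
  ring

end Main

/-! ### Decay of the low frequency part -/

/-- On each side of the slope `3/2` one factor decays and the other is bounded. In the cone around
the axis `i`, `‖ξ‖ ≤ (5/2)|ξ_i|` converts decay in the coordinate into decay in the norm, whence the
constant `2/5`. -/
theorem norm_mul_le_of_cone_decay {q : Plane → ℂ} {x : Plane → ℝ} {i j : Fin 2} {C N : ℝ}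
    (hN : 0 < N) (hij : ∀ ξ : Plane, ‖ξ‖ ≤ |ξ i| + |ξ j|) (hq : ∀ ξ, ‖q ξ‖ ≤ 1)
    (hqd : ∃ K : ℝ, 0 ≤ K ∧ ∀ ξ : Plane, 1 ≤ ‖ξ‖ → 3 / 2 * |ξ i| ≤ |ξ j| →
      ‖q ξ‖ ≤ K * ‖ξ‖ ^ (-N))
    (hx : ∃ K R : ℝ, 0 ≤ K ∧ ∀ ξ : Plane, R ≤ |ξ i| → |ξ j| ≤ 3 / 2 * |ξ i| →
      x ξ ≤ K * |ξ i| ^ (-N)) :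
    ∃ K R : ℝ, ∀ ξ : Plane, R ≤ ‖ξ‖ → 0 ≤ x ξ → x ξ ≤ C → ‖q ξ‖ * x ξ ≤ K * ‖ξ‖ ^ (-N) := by
  obtain ⟨K₁, hK₁, h₁⟩ := hqd
  obtain ⟨K₂, R, hK₂, h₂⟩ := hx
  refine ⟨K₁ * max C 0 + K₂ * (2 / 5) ^ (-N), max 1 (5 / 2 * R), fun ξ hξ h0 hC => ?_⟩
  have hξ1 : 1 ≤ ‖ξ‖ := (le_max_left _ _).trans hξ
  have hξ2 : 5 / 2 * R ≤ ‖ξ‖ := (le_max_right _ _).trans hξ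
  have hpow : 0 ≤ ‖ξ‖ ^ (-N) := Real.rpow_nonneg (norm_nonneg _) _
  have hpow' : (0 : ℝ) ≤ (2 / 5) ^ (-N) := Real.rpow_nonneg (by norm_num) _
  rcases le_total (3 / 2 * |ξ i|) |ξ j| with h | h
  · calc ‖q ξ‖ * x ξ ≤ (K₁ * ‖ξ‖ ^ (-N)) * max C 0 :=
          mul_le_mul (h₁ ξ hξ1 h) (hC.trans (le_max_left _ _)) h0 (by positivity)
      _ = K₁ * max C 0 * ‖ξ‖ ^ (-N) := by ring
      _ ≤ _ := by gcongr; exact le_add_of_nonneg_right (by positivity)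
  · have hi : 2 / 5 * ‖ξ‖ ≤ |ξ i| := by linarith [hij ξ]
    calc ‖q ξ‖ * x ξ ≤ x ξ := mul_le_of_le_one_left h0 (hq ξ)
      _ ≤ K₂ * |ξ i| ^ (-N) := h₂ ξ (by linarith) h
      _ ≤ K₂ * (2 / 5 * ‖ξ‖) ^ (-N) := by
          gcongr 1
          exact Real.rpow_le_rpow_of_nonpos (by positivity) hi (by linarith)
      _ = K₂ * (2 / 5) ^ (-N) * ‖ξ‖ ^ (-N) := by
          rw [Real.mul_rpow (by norm_num) (norm_nonneg _), mul_assoc]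
      _ ≤ _ := by gcongr; exact le_add_of_nonneg_left (by positivity)

theorem norm_hat_le_integral_norm {f : L2Plane} (hf : Integrable f volume) :
    ∀ᵐ ξ : Plane, ‖hat f ξ‖ ≤ ∫ x, ‖f x‖ := by
  have h := fourierInv_toLp_ae_eq hf (Lp.memLp f)
  rw [Lp.toLp_coeFn] at h
  filter_upwards [h] with ξ hξ
  rw [hat, hξ, Real.fourierInv_eq]
  refine (norm_integral_le_integral_norm _).trans_eq ?_
  simp only [Circle.norm_smul]

theorem isPartition {Φ : Plane → ℂ} (hΦ : ContDiff ℝ ∞ Φ) (hΦc : HasCompactSupport Φ)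
    (hΦ0 : Φ 0 = 1)
    (hΦr : ∀ ξ : Plane, (𝓕⁻ Φ ξ).im = 0 ∧ 0 ≤ (𝓕⁻ Φ ξ).re ∧ (𝓕⁻ Φ ξ).re ≤ 1) :
    IsPartition Φ := by
  refine ⟨p0hat_mem_Icc hΦ hΦc hΦ0 hΦr, ?_, ?_⟩
  · rw [p0hat_eq]
    exact measurable_smoothIndicator hΦ hΦc measurableSet_cone
  · rw [p1hat_eq hΦ hΦc hΦ0]
    exact measurable_smoothIndicator hΦ hΦc measurableSet_cone.compl

theorem isDeltaBounded {ψ : L2Plane}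
    (h : Integrable (fun ξ : Plane => ‖hat ψ ξ‖ ^ 2 / |ξ 0| ^ 2) volume)
    (hsymm : constPos ψ = constNeg ψ) : IsDeltaBounded ψ := by
  constructor
  · filter_upwards [ae_coord_ne_zero 0] with ξ hξ
    exact lDelta_le h hsymm hξ
  · filter_upwards [ae_coord_ne_zero 1] with ξ hξ
    exact lDelta_le h hsymm (by simpa [swap] using hξ)

theorem IsDeltaBounded.shearletDelta_eq {ψ : L2Plane} (hd : IsDeltaBounded ψ) :
    ∀ᵐ ξ : Plane, shearletDelta ψ ξ = (lDelta ψ ξ).toReal ∧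
      shearletDeltaNu ψ ξ = (lDelta ψ (swap ξ)).toReal := by
  filter_upwards [hd.1, hd.2] with ξ h1 h2
  exact ⟨shearletDelta_eq_toReal ψ (ne_top_of_le_ne_top ENNReal.ofReal_ne_top h1),
    shearletDelta_eq_toReal ψ (ne_top_of_le_ne_top ENNReal.ofReal_ne_top h2)⟩

theorem norm_lowSymbol_le {ψ : L2Plane} {Φ : Plane → ℂ} (hC : 0 < constPos ψ) {ξ : Plane}
    (h0 : (lDelta ψ ξ).toReal ≤ constPos ψ) (h1 : (lDelta ψ (swap ξ)).toReal ≤ constPos ψ) :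
    ‖1 - highSymbol ψ Φ ξ‖ ≤ 1 / constPos ψ *
      (‖p0hat Φ ξ‖ * (constPos ψ - (lDelta ψ ξ).toReal) +
        ‖p1hat Φ ξ‖ * (constPos ψ - (lDelta ψ (swap ξ)).toReal)) := by
  rw [one_sub_highSymbol hC rfl rfl, norm_mul, Complex.norm_real,
    Real.norm_of_nonneg (by positivity)]
  gcongr
  refine (norm_add_le _ _).trans_eq ?_
  rw [norm_mul, norm_mul, Complex.norm_real, Complex.norm_real,
    Real.norm_of_nonneg (sub_nonneg.2 h0), Real.norm_of_nonneg (sub_nonneg.2 h1)]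

theorem norm_lowSymbol_le_one {ψ : L2Plane} {Φ : Plane → ℂ} (hC : 0 < constPos ψ)
    (hp : IsPartition Φ) {ξ : Plane}
    (h0 : (lDelta ψ ξ).toReal ≤ constPos ψ) (h1 : (lDelta ψ (swap ξ)).toReal ≤ constPos ψ) :
    ‖1 - highSymbol ψ Φ ξ‖ ≤ 1 := by
  refine (norm_lowSymbol_le hC h0 h1).trans ?_
  obtain ⟨p, hp0, hp1, e0, e1⟩ := hp.1 ξ
  have d0 : 0 ≤ (lDelta ψ ξ).toReal := ENNReal.toReal_nonneg
  have d1 : 0 ≤ (lDelta ψ (swap ξ)).toReal := ENNReal.toReal_nonneg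
  rw [e0, e1, Complex.norm_real, Complex.norm_real, Real.norm_of_nonneg hp0,
    Real.norm_of_nonneg (sub_nonneg.2 hp1), one_div_mul_eq_div, div_le_one hC]
  nlinarith [mul_nonneg hp0 d0, mul_nonneg (sub_nonneg.2 hp1) d1]

theorem exists_lowSymbol_decay {ψ : L2Plane} {Φ : Plane → ℂ} {M : ℕ} {L₁ L₂ : ℝ}
    (h : Integrable (fun ξ : Plane => ‖hat ψ ξ‖ ^ 2 / |ξ 0| ^ 2) volume)
    (hsymm : constPos ψ = constNeg ψ) (hC : 0 < constPos ψ)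
    (hL₁ : ∃ K R : ℝ, ∀ᵐ ξ : Plane, R ≤ |ξ 0| → ‖hat ψ ξ‖ ≤ K * |ξ 0| ^ (-L₁))
    (hL₂ : ∃ K : ℝ, 0 ≤ K ∧ ∀ᵐ ξ : Plane, ‖hat ψ ξ‖ ≤ K * |ξ 0| ^ M * |ξ 1| ^ (-L₂))
    (hM : 1 ≤ M) (hML : (M : ℝ) < L₂) (hLM : L₂ < 2 * (M : ℝ) - 1 / 2)
    (hΦ : ContDiff ℝ ∞ Φ) (hΦc : HasCompactSupport Φ) (hΦ0 : Φ 0 = 1)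
    (hp : IsPartition Φ) (hd : IsDeltaBounded ψ) :
    ∃ K R : ℝ, ∀ᵐ ξ : Plane, R ≤ ‖ξ‖ →
      ‖1 - highSymbol ψ Φ ξ‖ ≤ K * ‖ξ‖ ^ (-(2 * min (L₂ - M) L₁)) := by
  rcases le_or_gt (min (L₂ - M) L₁) 0 with hL | hL
  -- A nonpositive minimum makes the claimed bound at least `1` for `‖ξ‖ ≥ 1`, and the low symbol
  -- never exceeds `1`.
  · refine ⟨1, 1, ?_⟩
    filter_upwards [hd.toReal_le] with ξ hξ h1
    rw [one_mul]
    exact (norm_lowSymbol_le_one hC hp hξ.1 hξ.2).trans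
      (Real.one_le_rpow h1 (by linarith))
  · have hN : 0 < 2 * min (L₂ - M) L₁ := by linarith
    obtain ⟨K, R, hK, hx⟩ := exists_constPos_sub_lDelta_le h hsymm hL₁ hL₂ hM hML hLM hL
    have hij : ∀ ξ : Plane, ‖ξ‖ ≤ |ξ 1| + |ξ 0| := fun ξ =>
      (norm_le_abs_add_abs ξ).trans_eq (add_comm _ _)
    obtain ⟨K₀, R₀, h₀⟩ := norm_mul_le_of_cone_decay (q := p0hat Φ) (C := constPos ψ) hN
      norm_le_abs_add_abs hp.norm_p0hat_le
      (exists_smoothIndicator_decay hΦ hΦc _ norm_le_abs_add_abs fun _ hx => hx) ⟨K, R, hK, hx⟩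
    obtain ⟨K₁, R₁, h₁⟩ := norm_mul_le_of_cone_decay (q := p1hat Φ) (C := constPos ψ)
      (x := fun ξ => constPos ψ - (lDelta ψ (swap ξ)).toReal) hN hij hp.norm_p1hat_le
      (by
        rw [p1hat_eq hΦ hΦc hΦ0]
        exact exists_smoothIndicator_decay hΦ hΦc _ hij fun ξ hξ => (le_total |ξ 0| |ξ 1|).elim id fun h' => absurd h' hξ)
      ⟨K, R, hK, fun ξ => by simpa [swap] using hx (swap ξ)⟩
    refine ⟨1 / constPos ψ * (K₀ + K₁), max R₀ R₁, ?_⟩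
    filter_upwards [hd.toReal_le] with ξ hξ hR
    refine (norm_lowSymbol_le hC hξ.1 hξ.2).trans ?_
    rw [mul_assoc, add_mul]
    refine mul_le_mul_of_nonneg_left (add_le_add ?_ ?_) (by positivity)
    · exact h₀ ξ ((le_max_left _ _).trans hR) (sub_nonneg.2 hξ.1)
        (sub_le_self _ ENNReal.toReal_nonneg)
    · exact h₁ ξ ((le_max_right _ _).trans hR) (sub_nonneg.2 hξ.2)
        (sub_le_self _ ENNReal.toReal_nonneg)

theorem multiplier_fourier_decay {m : Plane → ℂ} (hm : MemLp m ⊤ volume) {N : ℝ}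
    (h : ∃ K R : ℝ, ∀ᵐ ξ : Plane, R ≤ ‖ξ‖ → ‖m ξ‖ ≤ K * ‖ξ‖ ^ (-N)) :
    ∃ K R : ℝ,
      (∀ f : L2Plane, ∀ᵐ ξ : Plane, R ≤ ‖ξ‖ →
        ‖hat (multiplier hm f) ξ‖ ≤ K * ‖ξ‖ ^ (-N) * ‖hat f ξ‖) ∧
      (∀ f : L2Plane, Integrable f volume → ∀ᵐ ξ : Plane, R ≤ ‖ξ‖ →
        ‖hat (multiplier hm f) ξ‖ ≤ K * ‖ξ‖ ^ (-N) * ∫ x : Plane, ‖f x‖) := by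
  obtain ⟨K, R, h⟩ := h
  refine ⟨K, R, fun f => ?_, fun f hf => ?_⟩
  · filter_upwards [h, hat_multiplier_ae_eq hm f] with ξ h1 h2 hR
    rw [h2, norm_mul]
    exact mul_le_mul_of_nonneg_right (h1 hR) (norm_nonneg _)
  · filter_upwards [h, hat_multiplier_ae_eq hm f, norm_hat_le_integral_norm hf]
      with ξ h1 h2 h3 hR
    rw [h2, norm_mul]
    exact mul_le_mul (h1 hR) h3 (norm_nonneg _) ((norm_nonneg _).trans (h1 hR))

/-! ### Locality of the low frequency part -/

/-- Testing the weak formula with `g = χ_U h` makes both integrands vanish almost everywhere, while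
the left side is `‖g‖²`. -/
theorem IsHighPart.ae_eq_zero {C : ℝ} {ψ : L2Plane} {Φ : Plane → ℂ} (hΦ : ContDiff ℝ ∞ Φ)
    (hΦc : HasCompactSupport Φ) (hΦ0 : Φ 0 = 1) (hp : IsPartition Φ) {A B : ℝ}
    (hA : ∀ᵐ x : Plane, A < ‖x‖ → ψ x = 0) (hB : ∀ x : Plane, B < ‖x‖ → Φ x = 0)
    {U : Set Plane} (hU : MeasurableSet U) {f h : L2Plane} (hh : IsHighPart C ψ Φ f h)
    (hf : ∀ᵐ x : Plane, (∃ t ∈ U, ‖x - t‖ ≤ 2 * ((1 + √2) * A) + B) → f x = 0) :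
    ∀ᵐ t : Plane, t ∈ U → h t = 0 := by
  have hmem : MemLp (U.indicator h) 2 volume := (Lp.memLp h).indicator hU
  set g : L2Plane := hmem.toLp _ with hg
  have hgU : ∀ᵐ y, y ∉ U → g y = 0 := by
    filter_upwards [hmem.coeFn_toLp] with y hy hyU
    rw [hg, hy, indicator_of_notMem hyU]
  have hc0 : conv (invHat (p0hat Φ)) = multiplier hp.memLp_p0hat := conv_invHat _
  have hc1 : conv (invHat (p1hat Φ)) = multiplier hp.memLp_p1hat := conv_invHat _
  -- The symbol is a free variable here because `p̂₁` equals a smoothed indicator only by a proved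
  -- equation, and the multiplier depends on the proof of boundedness.
  have key : ∀ {m : Plane → ℂ} (hm : MemLp m ⊤ volume) {D : Set Plane}, MeasurableSet D →
      m = smoothIndicator Φ D → ∀ (sh : L2Plane) (t : Plane),
      (∀ᵐ y, (1 + √2) * A < ‖y - t‖ → sh y = 0) →
      inner ℂ sh f * inner ℂ g (multiplier hm sh) = 0 := by
    rintro m hm D hD rfl sh t hsh
    exact coeff_mul_inner_eq_zero hΦ hΦc hD hm hB hsh hf hgU
  obtain ⟨-, -, hi⟩ := hh g
  rw [hc0, hc1, integral_eq_zero_of_ae, integral_eq_zero_of_ae, add_zero, mul_zero] at hi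
  · have hgg : inner ℂ g h = inner ℂ g g := by
      rw [inner_L2_eq_integral, inner_L2_eq_integral]
      apply integral_congr_ae
      filter_upwards [hmem.coeFn_toLp] with y hy
      rw [hg, hy]
      by_cases hyU : y ∈ U
      · rw [indicator_of_mem hyU]
      · rw [indicator_of_notMem hyU]
        simp
    rw [hgg, inner_self_eq_zero] at hi
    have hz : (g : Plane → ℂ) =ᵐ[volume] 0 := by
      rw [hi]
      exact Lp.coeFn_zero _ _ _
    filter_upwards [hz, hmem.coeFn_toLp] with y h1 h2 hy
    rw [hg, h2, indicator_of_mem hy] at h1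
    exact h1
  · filter_upwards [ae_shearletMeasure_mem] with z hz
    exact key hp.memLp_p1hat measurableSet_cone.compl (p1hat_eq hΦ hΦc hΦ0) _ z.1
      (support_shearletNu hA hz.1 hz.2.1 hz.2.2 z.1)
  · filter_upwards [ae_shearletMeasure_mem] with z hz
    exact key hp.memLp_p0hat measurableSet_cone (p0hat_eq Φ) _ z.1
      (support_shearlet hA hz.1 hz.2.1 hz.2.2 z.1)

theorem nonneg_of_ae_norm_lt_eq_zero {ψ : L2Plane} (hψ : ψ ≠ 0) {A : ℝ}
    (hA : ∀ᵐ x : Plane, A < ‖x‖ → ψ x = 0) : 0 ≤ A := by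
  by_contra! h
  apply hψ
  rw [Lp.eq_zero_iff_ae_eq_zero]
  filter_upwards [hA] with x hx
  exact hx (h.trans_le (norm_nonneg x))

theorem low_ae_eq_of_ae_eq {ψ : L2Plane} {Φ : Plane → ℂ} (hψ : ψ ≠ 0) (hΦ : ContDiff ℝ ∞ Φ)
    (hΦc : HasCompactSupport Φ) (hΦ0 : Φ 0 = 1) (hp : IsPartition Φ) (hd : IsDeltaBounded ψ)
    {A B : ℝ} (hA : ∀ᵐ x : Plane, A < ‖x‖ → ψ x = 0) (hB : ∀ x : Plane, B < ‖x‖ → Φ x = 0)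
    {U : Set Plane} {f₁ f₂ : L2Plane} (hU : IsOpen U)
    (hf : ∀ᵐ x : Plane, (∃ t ∈ U, ‖x - t‖ ≤ 2 * (1 + √2) * A + B) → f₁ x = f₂ x) :
    ∀ᵐ t : Plane, t ∈ U → multiplier (memLp_lowSymbol hp hd) f₁ t =
      multiplier (memLp_lowSymbol hp hd) f₂ t := by
  -- Nonnegativity of the radii ensures that the neighbourhood of `U` contains `U` itself, so that
  -- `f₁ - f₂` vanishes on `U`.
  have hA0 := nonneg_of_ae_norm_lt_eq_zero hψ hA
  have hB0 : 0 ≤ B := by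
    by_contra! h
    have := hB 0 (by simpa using h)
    simp [hΦ0] at this
  have hsub : ∀ᵐ x : Plane, (∃ t ∈ U, ‖x - t‖ ≤ 2 * ((1 + √2) * A) + B) →
      (f₁ - f₂) x = 0 := by
    filter_upwards [hf, Lp.coeFn_sub f₁ f₂] with x h1 h2 h3
    rw [h2, Pi.sub_apply, h1 (by simpa only [mul_assoc] using h3), sub_self]
  have hhigh := (isHighPart_multiplier hp hd (f₁ - f₂)).ae_eq_zero hΦ hΦc hΦ0 hp hA hB
    hU.measurableSet hsub
  have e : f₁ - f₂ = multiplier (memLp_highSymbol hp hd) (f₁ - f₂) +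
      (multiplier (memLp_lowSymbol hp hd) f₁ - multiplier (memLp_lowSymbol hp hd) f₂) := by
    rw [← map_sub]
    exact high_add_low hp hd _
  have e2 := Lp.coeFn_add (multiplier (memLp_highSymbol hp hd) (f₁ - f₂))
    (multiplier (memLp_lowSymbol hp hd) f₁ - multiplier (memLp_lowSymbol hp hd) f₂)
  rw [← e] at e2
  filter_upwards [hsub, hhigh, e2, Lp.coeFn_sub (multiplier (memLp_lowSymbol hp hd) f₁)
    (multiplier (memLp_lowSymbol hp hd) f₂)] with t h1 h2 h3 h4 ht
  rw [h1 ⟨t, ht, by rw [sub_self, norm_zero]; positivity⟩, Pi.add_apply, h2 ht, zero_add, h4,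
    Pi.sub_apply] at h3
  exact sub_eq_zero.1 h3.symm

/-! ### The main theorem -/

theorem theorem1
    (ψ θ : L2Plane) (M : ℕ) (L₁ L₂ : ℝ)
    (hψ : ψ ≠ 0)
    (hmom : HasVanishingMoments M ψ)
    (hθ : IsIteratedPartial M θ ψ)
    (hL₁ : ∃ K R : ℝ, ∀ᵐ ξ : Plane, R ≤ |ξ 0| → ‖hat ψ ξ‖ ≤ K * |ξ 0| ^ (-L₁))
    (hL₂ : ∃ K : ℝ, ∀ᵐ ξ : Plane, ‖hat θ ξ‖ ≤ K * |ξ 1| ^ (-L₂))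
    (hM : 1 ≤ M) (hML : (M : ℝ) < L₂) (hLM : L₂ < 2 * (M : ℝ) - 1 / 2)
    (hsymm : constPos ψ = constNeg ψ)
    (Φ : Plane → ℂ) (hΦ : ContDiff ℝ ∞ Φ) (hΦc : HasCompactSupport Φ) (hΦ0 : Φ 0 = 1)
    (hΦr : ∀ ξ : Plane, (𝓕⁻ Φ ξ).im = 0 ∧ 0 ≤ (𝓕⁻ Φ ξ).re ∧ (𝓕⁻ Φ ξ).re ≤ 1) :
    (∀ᵐ ξ : Plane, shearletDelta ψ ξ ≤ constPos ψ ∧ shearletDeltaNu ψ ξ ≤ constPos ψ) ∧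
    ∀ u₀ u₁ : Plane → ℂ,
      AEStronglyMeasurable u₀ volume → AEStronglyMeasurable u₁ volume →
      (∀ᵐ ξ : Plane, ‖u₀ ξ‖ ^ 2 = constPos ψ - shearletDelta ψ ξ) →
      (∀ᵐ ξ : Plane, ‖u₁ ξ‖ ^ 2 = constPos ψ - shearletDeltaNu ψ ξ) →
      (∀ f : L2Plane, TightFrameIdentity (constPos ψ) ψ
        (invHat (sqrtHat (p0hat Φ))) (invHat (sqrtHat (p1hat Φ)))
        (invHat (windowHat Φ u₀ u₁)) f) ∧
      ∃ high low : L2Plane → L2Plane,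
        (∀ f : L2Plane, IsHighPart (constPos ψ) ψ Φ f (high f) ∧
          IsLowPart (constPos ψ) Φ u₀ u₁ f (low f) ∧ f = high f + low f) ∧
        (∃ K R : ℝ,
          (∀ f : L2Plane, ∀ᵐ ξ : Plane, R ≤ ‖ξ‖ →
            ‖hat (low f) ξ‖ ≤ K * ‖ξ‖ ^ (-(2 * min (L₂ - M) L₁)) * ‖hat f ξ‖) ∧
          (∀ f : L2Plane, Integrable f volume → ∀ᵐ ξ : Plane, R ≤ ‖ξ‖ →
            ‖hat (low f) ξ‖ ≤ K * ‖ξ‖ ^ (-(2 * min (L₂ - M) L₁)) * ∫ x : Plane, ‖f x‖)) ∧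
        (∀ A B : ℝ, (∀ᵐ x : Plane, A < ‖x‖ → ψ x = 0) → (∀ x : Plane, B < ‖x‖ → Φ x = 0) →
          ∀ (U : Set Plane) (f₁ f₂ : L2Plane), IsOpen U →
            (∀ᵐ x : Plane, (∃ t ∈ U, ‖x - t‖ ≤ 2 * (1 + √2) * A + B) → f₁ x = f₂ x) →
            ∀ᵐ t : Plane, t ∈ U → low f₁ t = low f₂ t) := by

  have hadm := integrable_admissible hM hmom
  have hC : 0 < constPos ψ := constPos_pos hψ hadm hsymm (ae_coord_ne_zero 0)
  have hp := isPartition hΦ hΦc hΦ0 hΦr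
  have hd := isDeltaBounded hadm hsymm
  refine ⟨?_, fun u₀ u₁ hu₀ hu₁ h₀ h₁ => ?_⟩
  · filter_upwards [hd.shearletDelta_eq, hd.toReal_le] with ξ h1 h2
    rw [h1.1, h1.2]
    exact h2
  have h₀' : ∀ᵐ ξ : Plane, ‖u₀ ξ‖ ^ 2 = constPos ψ - (lDelta ψ ξ).toReal := by
    filter_upwards [hd.shearletDelta_eq, h₀] with ξ h1 h2
    rw [h2, h1.1]
  have h₁' : ∀ᵐ ξ : Plane, ‖u₁ ξ‖ ^ 2 = constPos ψ - (lDelta ψ (swap ξ)).toReal := by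
    filter_upwards [hd.shearletDelta_eq, h₁] with ξ h1 h2
    rw [h2, h1.2]
  have hm₀ := memLp_of_norm_sq_eq hu₀ h₀' fun _ => ENNReal.toReal_nonneg
  have hm₁ := memLp_of_norm_sq_eq hu₁ h₁' fun _ => ENNReal.toReal_nonneg
  refine ⟨tightFrameIdentity hC hp hd hm₀ hm₁ h₀' h₁', multiplier (memLp_highSymbol hp hd),
    multiplier (memLp_lowSymbol hp hd), fun f => ⟨isHighPart_multiplier hp hd f,
      isLowPart_multiplier hC hp hd hm₀ hm₁ h₀' h₁' f, high_add_low hp hd f⟩, ?_,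
    fun A B hA hB U f₁ f₂ hU hf => low_ae_eq_of_ae_eq hψ hΦ hΦc hΦ0 hp hd hA hB hU hf⟩
  exact multiplier_fourier_decay _ (exists_lowSymbol_decay hadm hsymm hC hL₁
    (norm_hat_le_of_isIteratedPartial hθ hL₂) hM hML hLM hΦ hΦc hΦ0 hp hd)
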